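/- Let $m\ge 3$ and $1\le s<m$ be integers. Let $\mathbb R^m_s=\mathbb R^s\times\mathbb R^{m-s}$, with points $z=(t,x)$, carry the metric $\langle a,z\rangle=-\sum_{i\le s}a_iz_i+\sum_{i>s}a_iz_i$, and let $\square=-\sum_i\partial_{t_i}^2+\sum_j\partial_{x_j}^2$. Let $p>1$, $\mu\neq0$, and consider $$-\square u=\mu|u|^{p-1}u. \tag{1}$$ Solutions are classical ($C^2$). For $0\le k\le s$ and $0\le n\le m-s$ put $$\ell_{k,n}(z)=-\sum_{i=1}^k t_i^2+\sum_{j=1}^n x_j^2,\qquad N=k+n,$$ and let $F_{k,n}=\{t_1=\dots=t_k=x_1=\dots=x_n=0\}$ (the origin in the variables that $\ell_{k,n}$ depends on). If $m-2s\ge1$, then for $\epsilon\in\{-1,1\}^s$ and $1\le\omega\le m-2s$ put $$P_{\epsilon,\omega}(z)=\sum_{i=1}^s(t_i+\epsilon_ix_i)^2+2\sum_{j=s+1}^{s+\omega}x_j .$$ The nodal domains of $u$ are the connected components of the part of its domain where $u\ne0$. "Subcritical" means $p<\frac{N+2}{N-2}$ (with $\frac{N+2}{N-2}=\infty$ for $N=2$),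 and "non-subcritical" means $N>2$ and $p\ge\frac{N+2}{N-2}$. **Bounded solutions on all of $\mathbb R^m_s$.** * (Y1) Equation (1) has a bounded global solution that is sign-changing with infinitely many nodal domains and has the form $u=v\circ\varphi$, in each of the following cases: $\varphi=\langle a,\cdot\rangle$ for any $a$ with $\mu\langle a,a\rangle>0$; $\varphi=P_{\epsilon,\omega}$ for any $\epsilon,\omega$, if $\mu>0$; and $\varphi=\ell_{k,n}$ with $N=1$, where $k=0$ if $\mu>0$ and $n=0$ if $\mu<0$. * (Y2) Let $N\ge2$, with $k=0$ if $\mu>0$ and $n=0$ if $\mu<0$, and let $p$ be subcritical. Then (1) has a bounded global solution $u=v\circ\ell_{k,n}$ that is sign-changing with infinitely many nodal domains, and $|u(z)|\to0$ as $\ell_{0,n}(z)\to\infty$ (if $k=0$), respectively as $\ell_{k,0}(z)\to-\infty$ (if $n=0$). * (Y3) Let $N>2$, with $k=0$ if $\mu>0$ and $n=0$ if $\mu<0$, and let $p$ be non-subcritical. Then (1) has a bounded positive global solution $u=v\circ\ell_{k,n}$ whose critical set is exactly $F_{k,n}$, where $u$ attains its global maximum, and $|u(z)|\to0$ as in (Y2).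 **Blowing-up solutions.** * (Y4) In each of the following cases there are $R>0$ and a positive solution $u=v\circ\varphi$ of (1) on the open set $\Omega$ whose critical set is exactly $\{\varphi=0\}$ (which equals $F_{k,n}$ in the first two cases), where $u$ attains its global minimum over $\Omega$: * $\varphi=\ell_{0,n}$, $n\ge1$, if $\mu<0$, with $\Omega=\{\ell_{0,n}<R\}$ and $|u(z)|\to\infty$ as $\ell_{0,n}(z)\to R$; * $\varphi=\ell_{k,0}$, $k\ge1$, if $\mu>0$, with $\Omega=\{\ell_{k,0}>-R\}$ and $|u(z)|\to\infty$ as $\ell_{k,0}(z)\to-R$; * $\varphi=\langle a,\cdot\rangle$ for any $a$ with $\mu\langle a,a\rangle<0$, with $\Omega=\{|\varphi|<R\}$ and $|u(z)|\to\infty$ as $\varphi(z)\to\pm R$; * $\varphi=P_{\epsilon,\omega}$ for any $\epsilon,\omega$, if $\mu<0$, with $\Omega=\{|\varphi|<R\}$ and $|u(z)|\to\infty$ as $\varphi(z)\to\pm R$. * (Y5) Let $k,n\ge1$ and let $p$ be subcritical. Then there are $R>0$ and a solution $u=v\circ\ell_{k,n}$ of (1) on $\Omega$ that is sign-changing with infinitely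 many nodal domains. If $\mu>0$, then $\Omega=\{\ell_{k,n}>-R\}$, $|u(z)|\to0$ as $\ell_{k,n}(z)\to\infty$, and $|u(z)|\to\infty$ as $\ell_{k,n}(z)\to-R$. If $\mu<0$, then $\Omega=\{\ell_{k,n}<R\}$, $|u(z)|\to0$ as $\ell_{k,n}(z)\to-\infty$, and $|u(z)|\to\infty$ as $\ell_{k,n}(z)\to R$. * (Y6) Let $k,n\ge1$ and let $p$ be non-subcritical (so $N>2$). Then there are $R>0$ and a positive solution $u=v\circ\ell_{k,n}$ of (1) on $\Omega$ whose critical set is exactly $F_{k,n}$ and consists of saddle points (critical points that are not local extrema), with the same $\Omega$, decay and blow-up as in (Y5), according to the sign of $\mu$. -/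

import Mathlib

open Filter Topology Set

/-- The semi-Euclidean space `ℝ^m_s` (used for `s < m`): a point is `z = (t, x)` with time variables
`t = z.1 ∈ ℝ^s` and space variables `x = z.2 ∈ ℝ^(m-s)`.  Only its topological vector space
structure is used, never the (sup) norm. -/
abbrev SemiEuclidean (m s : ℕ) : Type := (Fin s → ℝ) × (Fin (m - s) → ℝ)

namespace SemiEuclidean

variable {m s : ℕ}

/-- The metric `⟨a, z⟩` of signature `(-,…,-,+,…,+)`, with `s` minus signs. -/
def metric (a z : SemiEuclidean m s) : ℝ :=
  -(∑ i, a.1 i * z.1 i) + ∑ j, a.2 j * z.2 j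

/-- The d'Alembertian `□ u = div grad u = -∑ ∂²u/∂tᵢ² + ∑ ∂²u/∂xⱼ²`. -/
noncomputable def box (u : SemiEuclidean m s → ℝ) (z : SemiEuclidean m s) : ℝ :=
  -(∑ i : Fin s, iteratedFDeriv ℝ 2 u z (fun _ => (Pi.single i 1, 0)))
    + ∑ j : Fin (m - s), iteratedFDeriv ℝ 2 u z (fun _ => (0, Pi.single j 1))

/-- `ℓ_{k,n}(z) = -(t₁² + ⋯ + t_k²) + (x₁² + ⋯ + x_n²)`. -/
def ell (k n : ℕ) (z : SemiEuclidean m s) : ℝ :=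
  -(∑ i : Fin s with i.val < k, z.1 i ^ 2) + ∑ j : Fin (m - s) with j.val < n, z.2 j ^ 2

/-- The subspace `t₁ = ⋯ = t_k = x₁ = ⋯ = x_n = 0`, that is, the origin in the variables on which
`ℓ_{k,n}` depends. -/
def focal (k n : ℕ) : Set (SemiEuclidean m s) :=
  {z | (∀ i : Fin s, i.val < k → z.1 i = 0) ∧ ∀ j : Fin (m - s), j.val < n → z.2 j = 0}

/-- `∑_{i ≤ s} (tᵢ + εᵢ xᵢ)² + 2 ∑_{s < j ≤ s + ω} xⱼ` (the coordinates are numbered from `0` in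
the code), whose level sets are parabolic cylinders. -/
def parabolic (h : s ≤ m - s) (ε : Fin s → ℝ) (ω : ℕ) (z : SemiEuclidean m s) : ℝ :=
  ∑ i, (z.1 i + ε i * z.2 (Fin.castLE h i)) ^ 2
    + 2 * ∑ j : Fin (m - s) with s ≤ j.val ∧ j.val < s + ω, z.2 j

/-- `u` is a classical solution of `-□ u = μ |u|^(p-1) u` in the open set `Ω`. -/
structure IsSolutionOn (p μ : ℝ) (Ω : Set (SemiEuclidean m s)) (u : SemiEuclidean m s → ℝ) :
    Prop where
  isOpen : IsOpen Ω
  contDiffOn : ContDiffOn ℝ 2 u Ω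
  equation : ∀ z ∈ Ω, -box u z = μ * |u z| ^ (p - 1) * u z

/-- `u` is a bounded classical solution defined in all of `ℝ^m_s`. -/
structure IsBoundedSolution (p μ : ℝ) (u : SemiEuclidean m s → ℝ) : Prop where
  isSolutionOn : IsSolutionOn p μ univ u
  bounded : ∃ C : ℝ, ∀ z, |u z| ≤ C

/-- `u` takes positive and negative values in `Ω`. -/
def IsSignChanging (Ω : Set (SemiEuclidean m s)) (u : SemiEuclidean m s → ℝ) : Prop :=
  (∃ z ∈ Ω, 0 < u z) ∧ ∃ z ∈ Ω, u z < 0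

/-- The nodal domains of `u` in `Ω`: the connected components of `{z ∈ Ω | u z ≠ 0}`. -/
def nodalDomains (Ω : Set (SemiEuclidean m s)) (u : SemiEuclidean m s → ℝ) :
    Set (Set (SemiEuclidean m s)) :=
  {C | ∃ z ∈ {y ∈ Ω | u y ≠ 0}, C = connectedComponentIn {y ∈ Ω | u y ≠ 0} z}

/-- The critical set of `u` in `Ω`. -/
def criticalSet (Ω : Set (SemiEuclidean m s)) (u : SemiEuclidean m s → ℝ) :
    Set (SemiEuclidean m s) :=
  {z ∈ Ω | fderiv ℝ u z = 0}

/-- `u` is sign-changing in `Ω` and has infinitely many nodal domains there. -/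
def IsOscillating (Ω : Set (SemiEuclidean m s)) (u : SemiEuclidean m s → ℝ) : Prop :=
  IsSignChanging Ω u ∧ (nodalDomains Ω u).Infinite

/-- `u` is positive in `Ω`, its critical set in `Ω` is `Z`, and at the points of `Z` it attains its
global maximum over `Ω`. -/
def IsPositiveWithMaxAt (Ω Z : Set (SemiEuclidean m s)) (u : SemiEuclidean m s → ℝ) : Prop :=
  (∀ z ∈ Ω, 0 < u z) ∧ criticalSet Ω u = Z ∧ ∀ z ∈ Z, IsMaxOn u Ω z

/-- `u` is positive in `Ω`, its critical set in `Ω` is `Z`, and at the points of `Z` it attains its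
global minimum over `Ω`. -/
def IsPositiveWithMinAt (Ω Z : Set (SemiEuclidean m s)) (u : SemiEuclidean m s → ℝ) : Prop :=
  (∀ z ∈ Ω, 0 < u z) ∧ criticalSet Ω u = Z ∧ ∀ z ∈ Z, IsMinOn u Ω z

/-- `u` is positive in `Ω`, its critical set in `Ω` is `Z`, and the points of `Z` are saddle points
of `u` (critical points that are not local extrema). -/
def IsPositiveWithSaddleAt (Ω Z : Set (SemiEuclidean m s)) (u : SemiEuclidean m s → ℝ) : Prop :=
  (∀ z ∈ Ω, 0 < u z) ∧ criticalSet Ω u = Z ∧ ∀ z ∈ Z, ¬ IsLocalExtr u z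

/-- `u(z) → 0` as `φ(z) → l`. -/
def VanishesAs (φ : SemiEuclidean m s → ℝ) (l : Filter ℝ) (u : SemiEuclidean m s → ℝ) : Prop :=
  Tendsto (fun z => |u z|) (comap φ l) (𝓝 0)

/-- `|u(z)| → ∞` as `φ(z) → l`. -/
def BlowsUpAs (φ : SemiEuclidean m s → ℝ) (l : Filter ℝ) (u : SemiEuclidean m s → ℝ) : Prop :=
  Tendsto (fun z => |u z|) (comap φ l) atTop

/-- `1 < p < (N+2)/(N-2)`, where the upper bound is `∞` for `N = 2` (used for `N ≥ 2`). -/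
def IsSubcritical (N : ℕ) (p : ℝ) : Prop :=
  1 < p ∧ (2 < N → p < ((N : ℝ) + 2) / ((N : ℝ) - 2))

end SemiEuclidean

/-! For a function `u = v ∘ φ` with `φ` polynomial of degree at most two, `□u` equals `v''(φ)⟨∇φ,∇φ⟩
+ v'(φ)□φ`. For `φ = ℓ_{k,n}` these coefficients are `4φ` and `2(k+n)`; for linear and parabolic `φ`
they are a constant `A` and `0`. Setting `v(r) = V(μ r)` in the first case and `v(y) = V((μ/A) y²)`
in the second reduces everything to the single problem `4 r V'' + 2(d+1) V' + |V|^(p-1) V = 0`,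
`V(0) = 1`, with `d + 1 = k + n`, respectively `d = 0`.

The equation degenerates at `r = 0`, but its regular solution satisfies `V'(r) = -½ ∫₀¹ θᵈ
|V|^(p-1)V(rθ²) dθ`. This form is smooth across `0`, is solved by contraction after truncating the
nonlinearity, and yields a solution on a maximal interval `(-R, ∞)` (`exists_isMaximalProfile`).

On the negative side `V ≥ 1` is decreasing in `r`, and superlinearity forces `V → ∞` at a finite
`-R` (`false_of_global_solution`). On the positive side `w(ρ) = V(ρ²)` is a radial solution of `-Δw
= |w|^(p-1)w` in dimension `d + 1`: the energy gives `|w| ≤ 1` and, if `d ≥ 1`, decay to `0`. The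
Pohozaev functional separates the two ranges of `p`. In the non-subcritical one it excludes a first
zero, so `V > 0` and `V' < 0` throughout. In the subcritical one it stays above a positive constant,
which is incompatible with the decay of an eventually nonnegative solution, so `V` changes sign
arbitrarily far out (`not_eventually_nonneg`).

Each case of the theorem is then decided by the range of `μ φ` (or of `(μ/A) φ²`): nonnegative
values give bounded solutions, nonpositive values give minima and blow-up, and both signs give
saddles or oscillation together with blow-up. Infinitely many nodal domains follow from sign changes
of `V`, because a connected nodal domain cannot cross a level set on which `u` has the opposite sign
(`isOscillating_comp`). -/

/-! ### Weighted means that resolve the singularity at the origin -/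

/-- The integral `∫₀¹ θᵈ h(r θ²) dθ`. -/
noncomputable def weightedMean (d : ℕ) (h : ℝ → ℝ) (r : ℝ) : ℝ :=
  ∫ θ in (0 : ℝ)..1, θ ^ d * h (r * θ ^ 2)

lemma continuous_weightedMean (d : ℕ) {h : ℝ → ℝ} (hh : Continuous h) :
    Continuous (weightedMean d h) := by
  apply intervalIntegral.continuous_parametric_intervalIntegral_of_continuous'
  fun_prop

lemma abs_weightedMean_le (d : ℕ) {h : ℝ → ℝ} {r C : ℝ}
    (hC : ∀ τ ∈ Icc (0 : ℝ) 1, |h (r * τ)| ≤ C) : |weightedMean d h r| ≤ C := by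
  have := intervalIntegral.norm_integral_le_of_norm_le_const (a := 0) (b := 1) (C := C)
    (f := fun θ : ℝ => θ ^ d * h (r * θ ^ 2)) ?_
  · simpa [weightedMean] using this
  · intro θ hθ
    rw [uIoc_of_le zero_le_one] at hθ
    have h1 := hC (θ ^ 2) ⟨by positivity, pow_le_one₀ hθ.1.le hθ.2⟩
    rw [Real.norm_eq_abs, abs_mul, abs_of_nonneg (pow_nonneg hθ.1.le d)]
    calc θ ^ d * |h (r * θ ^ 2)| ≤ 1 * |h (r * θ ^ 2)| := by
          gcongr; exact pow_le_one₀ hθ.1.le hθ.2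
      _ ≤ C := by linarith

lemma weightedMean_pos (d : ℕ) {h : ℝ → ℝ} (hh : Continuous h) {r : ℝ}
    (hpos : ∀ τ ∈ Ioo (0 : ℝ) 1, 0 < h (r * τ)) : 0 < weightedMean d h r := by
  apply intervalIntegral.intervalIntegral_pos_of_pos_on _ _ zero_lt_one
  · apply Continuous.intervalIntegrable; fun_prop
  · intro θ hθ
    exact mul_pos (pow_pos hθ.1 d)
      (hpos _ ⟨pow_pos hθ.1 2, pow_lt_one₀ hθ.1.le hθ.2 two_ne_zero⟩)

/-- Differentiation under the integral sign; the inner derivative `θ²` raises the weight from `d` to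
`d + 2`. -/
lemma hasDerivAt_weightedMean (d : ℕ) {h h' : ℝ → ℝ} (hd : ∀ x, HasDerivAt h (h' x) x)
    (hc : Continuous h') (r : ℝ) :
    HasDerivAt (weightedMean d h) (weightedMean (d + 2) h' r) r := by
  have hh : Continuous h := continuous_iff_continuousAt.2 fun x => (hd x).continuousAt
  obtain ⟨C, hC⟩ := (isCompact_Icc (a := -(|r| + 1)) (b := |r| + 1)).exists_bound_of_continuousOn
    hc.continuousOn
  refine (intervalIntegral.hasDerivAt_integral_of_dominated_loc_of_deriv_le (𝕜 := ℝ)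
    (F := fun r θ => θ ^ d * h (r * θ ^ 2)) (F' := fun r θ => θ ^ (d + 2) * h' (r * θ ^ 2))
    (bound := fun _ => C) (Metric.ball_mem_nhds r one_pos) ?_ ?_ ?_ ?_ ?_ ?_).2
  · exact .of_forall fun x => by
      apply Continuous.aestronglyMeasurable; fun_prop
  · apply Continuous.intervalIntegrable; fun_prop
  · apply Continuous.aestronglyMeasurable; fun_prop
  · refine .of_forall fun θ hθ x hx => ?_
    rw [uIoc_of_le zero_le_one] at hθ
    have hx' : |x| ≤ |r| + 1 := by
      have h1 := abs_sub_abs_le_abs_sub x r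
      rw [Metric.mem_ball, Real.dist_eq] at hx
      linarith
    have h1 : |x * θ ^ 2| ≤ |r| + 1 := by
      rw [abs_mul, abs_of_nonneg (pow_nonneg hθ.1.le 2)]
      calc |x| * θ ^ 2 ≤ |x| * 1 := by gcongr; exact pow_le_one₀ hθ.1.le hθ.2
        _ ≤ _ := by linarith
    have h2 := hC _ (abs_le.1 h1)
    rw [norm_mul, norm_pow, Real.norm_of_nonneg hθ.1.le]
    calc θ ^ (d + 2) * ‖h' (x * θ ^ 2)‖ ≤ 1 * ‖h' (x * θ ^ 2)‖ := by
          gcongr; exact pow_le_one₀ hθ.1.le hθ.2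
      _ ≤ C := by linarith
  · simp
  · refine .of_forall fun θ _ x _ => ?_
    have h1 : HasDerivAt (fun x : ℝ => x * θ ^ 2) (θ ^ 2) x := by
      simpa using (hasDerivAt_id x).mul_const (θ ^ 2)
    refine (((hd (x * θ ^ 2)).comp x h1).const_mul (θ ^ d)).congr_deriv ?_
    ring

/-- Integrate the `θ`-derivative of `θ^(d+1) h(rθ²)` over `[0,1]`. Applied to `h = g ∘ v`, whose
mean is `-2v'` for a profile, this first-order identity is the second-order equation for `v`. -/
lemma weightedMean_deriv_identity (d : ℕ) {h h' : ℝ → ℝ} (hd : ∀ x, HasDerivAt h (h' x) x)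
    (hc : Continuous h') (r : ℝ) :
    2 * r * weightedMean (d + 2) h' r + (d + 1) * weightedMean d h r = h r := by
  have hh : Continuous h := continuous_iff_continuousAt.2 fun x => (hd x).continuousAt
  have key := intervalIntegral.integral_eq_sub_of_hasDerivAt (a := 0) (b := 1)
    (f := fun θ : ℝ => θ ^ (d + 1) * h (r * θ ^ 2))
    (f' := fun θ => 2 * r * (θ ^ (d + 2) * h' (r * θ ^ 2)) + (d + 1) * (θ ^ d * h (r * θ ^ 2)))
    (fun θ _ => by
      have h1 : HasDerivAt (fun θ : ℝ => r * θ ^ 2) (r * (2 * θ)) θ := by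
        simpa using (hasDerivAt_pow 2 θ).const_mul r
      have h2 : HasDerivAt (fun θ : ℝ => θ ^ (d + 1)) ((d + 1) * θ ^ d) θ := by
        simpa using hasDerivAt_pow (d + 1) θ
      refine (h2.mul ((hd (r * θ ^ 2)).comp θ h1)).congr_deriv ?_
      simp only [Function.comp]
      ring)
    (by apply Continuous.intervalIntegrable; fun_prop)
  rw [intervalIntegral.integral_add, intervalIntegral.integral_const_mul,
    intervalIntegral.integral_const_mul] at key
  · simpa [weightedMean] using key
  · apply Continuous.intervalIntegrable; fun_prop
  · apply Continuous.intervalIntegrable; fun_prop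

/-- Integrating against an exponential weight gains a factor `1/K`. With `K` the Lipschitz constant
of the nonlinearity this gain cancels it, which drives both existence and uniqueness of profiles. -/
lemma abs_integral_weightedMean_le (d : ℕ) {h : ℝ → ℝ} {r K C : ℝ}
    (hK : 0 < K) (hC : ∀ τ ∈ Icc (0 : ℝ) 1, |h (r * τ)| ≤ C * Real.exp (K * |r * τ|)) :
    |∫ ρ in (0 : ℝ)..r, weightedMean d h ρ| ≤ C / K * (Real.exp (K * |r|) - 1) := by
  have hC0 : 0 ≤ C := by
    have := (abs_nonneg _).trans (hC 0 ⟨le_rfl, zero_le_one⟩)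
    simpa using this
  have h1 : ∫ ρ in (0 : ℝ)..r, weightedMean d h ρ
      = r * ∫ t in (0 : ℝ)..1, weightedMean d h (r * t) := by
    rw [intervalIntegral.mul_integral_comp_mul_left]; simp
  have h2 : ‖∫ t in (0 : ℝ)..1, weightedMean d h (r * t)‖
      ≤ ∫ t in (0 : ℝ)..1, C * Real.exp (K * |r| * t) := by
    refine intervalIntegral.norm_integral_le_of_norm_le zero_le_one (.of_forall fun t ht => ?_) ?_
    · refine abs_weightedMean_le d fun τ hτ => ?_
      have h3 := hC (t * τ) ⟨mul_nonneg ht.1.le hτ.1, mul_le_one₀ ht.2 hτ.1 hτ.2⟩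
      rw [← mul_assoc] at h3
      have h4 : |r * t * τ| ≤ |r| * t := by
        rw [abs_mul, abs_mul, abs_of_nonneg ht.1.le, abs_of_nonneg hτ.1]
        exact mul_le_of_le_one_right (mul_nonneg (abs_nonneg r) ht.1.le) hτ.2
      refine h3.trans (mul_le_mul_of_nonneg_left (Real.exp_le_exp.2 ?_) hC0)
      rw [mul_assoc K]
      exact mul_le_mul_of_nonneg_left h4 hK.le
    · apply Continuous.intervalIntegrable; fun_prop
  have h3 : |r| * ∫ t in (0 : ℝ)..1, C * Real.exp (K * |r| * t)
      = C / K * (Real.exp (K * |r|) - 1) := by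
    have key := intervalIntegral.integral_eq_sub_of_hasDerivAt (a := 0) (b := 1)
      (f := fun t : ℝ => C / K * Real.exp (K * |r| * t))
      (f' := fun t => |r| * (C * Real.exp (K * |r| * t)))
      (fun t _ => by
        have h4 : HasDerivAt (fun t : ℝ => K * |r| * t) (K * |r|) t := by
          simpa using (hasDerivAt_id t).const_mul (K * |r|)
        refine (h4.exp.const_mul (C / K)).congr_deriv ?_
        field_simp)
      (by apply Continuous.intervalIntegrable; fun_prop)
    rw [intervalIntegral.integral_const_mul] at key
    rw [key]; simp; ring
  rw [h1, abs_mul, ← h3]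
  exact mul_le_mul_of_nonneg_left h2 (abs_nonneg r)

/-! ### The integral equation: existence, uniqueness, regularity -/

/-- `v` solves the integral form `v(r) = 1 - ½ ∫₀ʳ ∫₀¹ θᵈ g(v(ρ θ²)) dθ dρ` of
`4 r v'' + 2 (d + 1) v' + g(v) = 0`, `v(0) = 1`. -/
structure IsProfile (d : ℕ) (g v : ℝ → ℝ) : Prop where
  continuous : Continuous v
  eq : ∀ r, v r = 1 - 1 / 2 * ∫ ρ in (0 : ℝ)..r, weightedMean d (g ∘ v) ρ

-- Banach's fixed point theorem in a weighted sup norm: with the unknown `w(r) = e^(-L|r|) v(r)` the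
-- integral operator contracts by `1/2` on the whole line at once, so no continuation argument is
-- needed.
open scoped BoundedContinuousFunction in
lemma exists_isProfile (d : ℕ) {g : ℝ → ℝ} {L : ℝ} (hL : 0 < L)
    (hg : ∀ x y, |g x - g y| ≤ L * |x - y|) : ∃ v, IsProfile d g v := by
  have hgc : Continuous g := by
    have : LipschitzWith ⟨L, hL.le⟩ g := LipschitzWith.of_dist_le_mul fun x y => by
      simp only [Real.dist_eq]; exact hg x y
    exact this.continuous
  have hexpn : Continuous fun r : ℝ => Real.exp (-(L * |r|)) := by fun_prop
  have hx : ∀ w : ℝ →ᵇ ℝ, Continuous fun r => g (Real.exp (L * |r|) * w r) := fun w => by fun_prop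
  have hI : ∀ w : ℝ →ᵇ ℝ, Continuous fun r =>
      ∫ ρ in (0 : ℝ)..r, weightedMean d (fun r => g (Real.exp (L * |r|) * w r)) ρ := fun w =>
    intervalIntegral.continuous_primitive
      (fun a b => (continuous_weightedMean d (hx w)).intervalIntegrable a b) 0
  have hexp1 : ∀ r : ℝ, 1 ≤ Real.exp (L * |r|) := fun r =>
    Real.one_le_exp (mul_nonneg hL.le (abs_nonneg r))
  have hcancel : ∀ r : ℝ, Real.exp (-(L * |r|)) * Real.exp (L * |r|) = 1 := fun r => by
    rw [← Real.exp_add]; simp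
  let Φ : (ℝ →ᵇ ℝ) → ℝ →ᵇ ℝ := fun w => BoundedContinuousFunction.ofNormedAddCommGroup
    (fun r => Real.exp (-(L * |r|)) * (1 - 1 / 2 *
      ∫ ρ in (0 : ℝ)..r, weightedMean d (fun r => g (Real.exp (L * |r|) * w r)) ρ))
    (hexpn.mul (continuous_const.sub (continuous_const.mul (hI w))))
    (1 + 1 / 2 * ((|g 0| + L * ‖w‖) / L)) (fun r => by
      have hb : ∀ s, |g (Real.exp (L * |s|) * w s)| ≤ (|g 0| + L * ‖w‖) * Real.exp (L * |s|) := by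
        intro s
        have h1 := hg (Real.exp (L * |s|) * w s) 0
        have h2 := abs_sub_abs_le_abs_sub (g (Real.exp (L * |s|) * w s)) (g 0)
        rw [sub_zero, abs_mul, abs_of_pos (Real.exp_pos _)] at h1
        have h3 : |w s| ≤ ‖w‖ := w.norm_coe_le_norm s
        have h4 : L * (Real.exp (L * |s|) * |w s|) ≤ L * (Real.exp (L * |s|) * ‖w‖) := by gcongr
        have h5 : |g 0| * 1 ≤ |g 0| * Real.exp (L * |s|) := by gcongr; exact hexp1 s
        linarith
      have h1 := abs_integral_weightedMean_le d (h := fun r => g (Real.exp (L * |r|) * w r))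
        (r := r) hL (fun τ _ => hb (r * τ))
      have hA : 0 ≤ (|g 0| + L * ‖w‖) / L := by positivity
      rw [norm_mul, Real.norm_of_nonneg (Real.exp_pos _).le, Real.norm_eq_abs]
      calc _ ≤ Real.exp (-(L * |r|)) *
            (Real.exp (L * |r|) * (1 + 1 / 2 * ((|g 0| + L * ‖w‖) / L))) := by
            gcongr
            refine (abs_sub _ _).trans ?_
            rw [abs_one, abs_mul, abs_of_pos (by norm_num : (0 : ℝ) < 1 / 2)]
            nlinarith [hexp1 r]
        _ = _ := by rw [← mul_assoc, hcancel, one_mul])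
  have hΦ : ContractingWith (1 / 2) Φ := by
    refine ⟨by rw [← NNReal.coe_lt_coe]; norm_num, LipschitzWith.of_dist_le_mul fun w₁ w₂ => ?_⟩
    rw [BoundedContinuousFunction.dist_le (by positivity)]
    intro r
    have hsub : (∫ ρ in (0 : ℝ)..r, weightedMean d (fun r => g (Real.exp (L * |r|) * w₁ r)) ρ)
        - (∫ ρ in (0 : ℝ)..r, weightedMean d (fun r => g (Real.exp (L * |r|) * w₂ r)) ρ)
        = ∫ ρ in (0 : ℝ)..r, weightedMean d
          (fun r => g (Real.exp (L * |r|) * w₁ r) - g (Real.exp (L * |r|) * w₂ r)) ρ := by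
      rw [← intervalIntegral.integral_sub
        ((continuous_weightedMean d (hx w₁)).intervalIntegrable _ _)
        ((continuous_weightedMean d (hx w₂)).intervalIntegrable _ _)]
      congr 1; ext ρ
      rw [weightedMean, weightedMean, ← intervalIntegral.integral_sub]
      · simp only [weightedMean, mul_sub]
      · apply Continuous.intervalIntegrable; fun_prop
      · apply Continuous.intervalIntegrable; fun_prop
    -- Here the Lipschitz constant `L` is divided by the weight rate `L`; the prefactor `1/2` of the
    -- integral equation is left as contraction constant.
    have h1 := abs_integral_weightedMean_le d (h := fun r => g (Real.exp (L * |r|) * w₁ r)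
        - g (Real.exp (L * |r|) * w₂ r)) (r := r) (K := L)
      (C := L * dist w₁ w₂) hL (fun τ _ => by
        refine (hg _ _).trans ?_
        rw [← mul_sub, abs_mul, abs_of_pos (Real.exp_pos _), mul_comm (Real.exp _), ← mul_assoc]
        gcongr
        exact BoundedContinuousFunction.dist_coe_le_dist (f := w₁) (g := w₂) (r * τ))
    rw [mul_div_cancel_left₀ _ hL.ne'] at h1
    have h2 : Φ w₁ r - Φ w₂ r = Real.exp (-(L * |r|)) * (-(1 / 2) * ∫ ρ in (0 : ℝ)..r, weightedMean d
          (fun r => g (Real.exp (L * |r|) * w₁ r) - g (Real.exp (L * |r|) * w₂ r)) ρ) := by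
      rw [← hsub]
      simp only [Φ, BoundedContinuousFunction.coe_ofNormedAddCommGroup]
      ring
    rw [Real.dist_eq, h2, abs_mul, abs_mul, abs_of_pos (Real.exp_pos _), abs_neg,
      abs_of_pos (by norm_num : (0 : ℝ) < 1 / 2)]
    calc _ ≤ Real.exp (-(L * |r|)) * (1 / 2 * (dist w₁ w₂ * Real.exp (L * |r|))) := by
          gcongr
          refine h1.trans ?_
          gcongr
          linarith
      _ = 1 / 2 * dist w₁ w₂ * (Real.exp (-(L * |r|)) * Real.exp (L * |r|)) := by ring
      _ = _ := by rw [hcancel]; simp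
  have hfix := hΦ.fixedPoint_isFixedPt
  set w := hΦ.fixedPoint with hw
  refine ⟨fun r => Real.exp (L * |r|) * w r, by fun_prop, fun r => ?_⟩
  have h1 : Φ w r = w r := by rw [hfix]
  simp only [Φ, BoundedContinuousFunction.coe_ofNormedAddCommGroup] at h1
  conv_lhs => rw [← h1]
  rw [← mul_assoc, mul_comm (Real.exp _), hcancel, one_mul]
  rfl

/-- The weighted difference attains a maximum `S` on the compact interval, and the integral equation
bounds it there by a quantity below `S/2` unless `S = 0`. Two nonlinearities are allowed so that
truncations at different heights can be compared along their solutions. -/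
lemma IsProfile.eqOn {d : ℕ} {g₁ g₂ v₁ v₂ : ℝ → ℝ} (h₁ : IsProfile d g₁ v₁)
    (h₂ : IsProfile d g₂ v₂) (hg₁ : Continuous g₁) (hg₂ : Continuous g₂) {a b L : ℝ} (hL : 0 < L)
    (ha : a ≤ 0) (hb : 0 ≤ b) (hg : ∀ r ∈ Icc a b, |g₁ (v₁ r) - g₂ (v₂ r)| ≤ L * |v₁ r - v₂ r|) :
    EqOn v₁ v₂ (Icc a b) := by
  have hv₁ := h₁.continuous
  have hv₂ := h₂.continuous
  have c₁ : Continuous (g₁ ∘ v₁) := hg₁.comp hv₁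
  have c₂ : Continuous (g₂ ∘ v₂) := hg₂.comp hv₂
  obtain ⟨r, hr, hmax⟩ := isCompact_Icc.exists_isMaxOn (⟨0, ha, hb⟩ : (Icc a b).Nonempty)
    (f := fun r => Real.exp (-(L * |r|)) * |v₁ r - v₂ r|) (by fun_prop)
  set S := Real.exp (-(L * |r|)) * |v₁ r - v₂ r| with hS
  have hD : ∀ s ∈ Icc a b, |v₁ s - v₂ s| ≤ S * Real.exp (L * |s|) := by
    intro s hs
    have h3 : Real.exp (-(L * |s|)) * |v₁ s - v₂ s| ≤ S := hmax hs
    rw [Real.exp_neg, inv_mul_le_iff₀ (Real.exp_pos _)] at h3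
    linarith
  have hsub : v₁ r - v₂ r
      = -(1 / 2) * ∫ ρ in (0 : ℝ)..r, weightedMean d (fun r => g₁ (v₁ r) - g₂ (v₂ r)) ρ := by
    have h3 : ∫ ρ in (0 : ℝ)..r, weightedMean d (fun r => g₁ (v₁ r) - g₂ (v₂ r)) ρ
        = (∫ ρ in (0 : ℝ)..r, weightedMean d (g₁ ∘ v₁) ρ)
          - ∫ ρ in (0 : ℝ)..r, weightedMean d (g₂ ∘ v₂) ρ := by
      rw [← intervalIntegral.integral_sub
        ((continuous_weightedMean d c₁).intervalIntegrable _ _)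
        ((continuous_weightedMean d c₂).intervalIntegrable _ _)]
      congr 1; ext ρ
      rw [weightedMean, weightedMean, weightedMean, ← intervalIntegral.integral_sub]
      · simp only [Function.comp, mul_sub]
      · apply Continuous.intervalIntegrable; fun_prop
      · apply Continuous.intervalIntegrable; fun_prop
    rw [h3, h₁.eq r, h₂.eq r]; ring
  have h4 := abs_integral_weightedMean_le d (h := fun r => g₁ (v₁ r) - g₂ (v₂ r)) (r := r)
    (K := L) (C := L * S) hL
    (fun τ hτ => by
      -- The interval contains `0`, hence the whole segment from `0` to `r`.
      have hm : r * τ ∈ Icc a b := by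
        have := (convex_Icc a b) ⟨ha, hb⟩ hr (sub_nonneg.2 hτ.2) hτ.1 (by ring)
        simpa [mul_comm] using this
      refine (hg _ hm).trans ?_
      rw [mul_assoc]
      gcongr
      exact hD _ hm)
  have h5 : |v₁ r - v₂ r| ≤ 1 / 2 * (S * (Real.exp (L * |r|) - 1)) := by
    rw [hsub, abs_mul, abs_neg, abs_of_pos (by norm_num : (0 : ℝ) < 1 / 2)]
    rw [mul_comm L S, mul_div_assoc, div_self hL.ne', mul_one] at h4
    gcongr
  have h6 : S * Real.exp (L * |r|) = |v₁ r - v₂ r| := by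
    rw [hS, mul_right_comm, ← Real.exp_add]; simp
  have h7 : 0 ≤ S := by positivity
  -- The two bounds combine to `S e^(L|r|) ≤ ½ S (e^(L|r|) - 1)`.
  have hS0 : S = 0 := by nlinarith [Real.exp_pos (L * |r|)]
  intro s hs
  have := hD s hs
  rw [hS0, zero_mul] at this
  exact sub_eq_zero.1 (abs_nonpos_iff.1 this)

lemma IsProfile.apply_zero {d : ℕ} {g v : ℝ → ℝ} (h : IsProfile d g v) : v 0 = 1 := by
  rw [h.eq]; simp

lemma IsProfile.hasDerivAt {d : ℕ} {g v : ℝ → ℝ} (h : IsProfile d g v) (hg : Continuous g)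
    (r : ℝ) : HasDerivAt v (-(1 / 2) * weightedMean d (g ∘ v) r) r := by
  have hc := continuous_weightedMean d (hg.comp h.continuous)
  have h1 := intervalIntegral.integral_hasDerivAt_right (hc.intervalIntegrable 0 r)
    (hc.stronglyMeasurableAtFilter _ _) hc.continuousAt
  refine (((h1.const_mul (1 / 2)).const_sub 1).congr_of_eventuallyEq
    (.of_forall h.eq)).congr_deriv (by ring)

/-- A profile of a `C¹` nonlinearity is a `C²` solution of the differential equation. -/
lemma IsProfile.contDiff_and_eqn {d : ℕ} {g g' v : ℝ → ℝ} (h : IsProfile d g v)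
    (hg : ∀ x, HasDerivAt g (g' x) x) (hg' : Continuous g') :
    ContDiff ℝ 2 v ∧ ∀ r, 4 * r * deriv (deriv v) r + 2 * (d + 1) * deriv v r + g (v r) = 0 := by
  have hgc : Continuous g := continuous_iff_continuousAt.2 fun x => (hg x).continuousAt
  have hv := h.continuous
  have hd := h.hasDerivAt hgc
  have e1 : deriv v = fun r => -(1 / 2) * weightedMean d (g ∘ v) r := funext fun r => (hd r).deriv
  have hc1 : Continuous (deriv v) := by
    rw [e1]; exact continuous_const.mul (continuous_weightedMean d (hgc.comp hv))
  have hgv : ∀ x, HasDerivAt (g ∘ v) (g' (v x) * deriv v x) x := fun x =>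
    (hg (v x)).comp x (hd x).differentiableAt.hasDerivAt
  have hcv : Continuous fun x => g' (v x) * deriv v x := (hg'.comp hv).mul hc1
  have hd2 : ∀ r, HasDerivAt (deriv v)
      (-(1 / 2) * weightedMean (d + 2) (fun x => g' (v x) * deriv v x) r) r := fun r => by
    have := (hasDerivAt_weightedMean d hgv hcv r).const_mul (-(1 / 2))
    rwa [← e1] at this
  have e2 : deriv (deriv v) = _ := funext fun r => (hd2 r).deriv
  constructor
  · have hC1 : ContDiff ℝ 1 (deriv v) := contDiff_one_iff_deriv.2
      ⟨fun r => (hd2 r).differentiableAt, by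
        rw [e2]; exact continuous_const.mul (continuous_weightedMean _ hcv)⟩
    rw [show (2 : WithTop ℕ∞) = 1 + 1 from rfl, contDiff_succ_iff_deriv]
    exact ⟨fun r => (hd r).differentiableAt, by simp, hC1⟩
  · intro r
    have h1 := weightedMean_deriv_identity d hgv hcv r
    rw [e2, (hd r).deriv]
    simp only [Function.comp] at h1 ⊢
    rw [← h1]; simp only [Function.comp_def]; ring

/-! ### The odd power and its globally Lipschitz truncations -/

/-- The odd power `|x|^(p-1) x`. -/
noncomputable def oddPow (p x : ℝ) : ℝ := |x| ^ (p - 1) * x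

lemma oddPow_neg (p x : ℝ) : oddPow p (-x) = -oddPow p x := by simp [oddPow]

lemma oddPow_of_pos {p x : ℝ} (hx : 0 < x) : oddPow p x = x ^ p := by
  rw [oddPow, abs_of_pos hx, ← Real.rpow_add_one hx.ne', sub_add_cancel]

lemma oddPow_pos {p x : ℝ} (hx : 0 < x) : 0 < oddPow p x :=
  mul_pos (Real.rpow_pos_of_pos (abs_pos.2 hx.ne') _) hx

lemma continuous_abs_rpow_sub_one {p : ℝ} (hp : 1 < p) : Continuous fun x : ℝ => |x| ^ (p - 1) :=
  continuous_abs.rpow_const fun _ => Or.inr (by linarith)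

lemma hasDerivAt_oddPow {p : ℝ} (hp : 1 < p) (x : ℝ) :
    HasDerivAt (oddPow p) (p * |x| ^ (p - 1)) x := by
  have hpos : ∀ y : ℝ, 0 < y → HasDerivAt (oddPow p) (p * |y| ^ (p - 1)) y := fun y hy => by
    rw [abs_of_pos hy]
    refine (Real.hasDerivAt_rpow_const (Or.inl hy.ne')).congr_of_eventuallyEq ?_
    filter_upwards [lt_mem_nhds hy] with z hz using oddPow_of_pos hz
  rcases lt_trichotomy x 0 with hx | rfl | hx
  · have h1 := (hpos (-x) (neg_pos.2 hx)).comp x (hasDerivAt_neg x)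
    refine (h1.neg.congr_of_eventuallyEq (.of_forall fun y => ?_)).congr_deriv ?_
    · simp [oddPow_neg]
    · simp
  · rw [hasDerivAt_iff_tendsto_slope]
    have h1 : Tendsto (fun x : ℝ => |x| ^ (p - 1)) (𝓝[≠] 0) (𝓝 (|0| ^ (p - 1))) :=
      ((continuous_abs_rpow_sub_one hp).tendsto 0).mono_left nhdsWithin_le_nhds
    have h2 : p * |(0 : ℝ)| ^ (p - 1) = |0| ^ (p - 1) := by
      rw [abs_zero, Real.zero_rpow (by linarith), mul_zero]
    rw [h2]
    refine h1.congr' ?_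
    filter_upwards [self_mem_nhdsWithin] with y hy
    have hy : y ≠ 0 := hy
    simp [slope_def_field, oddPow, hy]
  · exact hpos x hx

/-- The odd power, continued linearly outside of `[-M, M]`. -/
noncomputable def truncPow (p M x : ℝ) : ℝ := ∫ s in (0 : ℝ)..x, p * (min |s| M) ^ (p - 1)

lemma continuous_truncPow_deriv {p : ℝ} (hp : 1 < p) (M : ℝ) :
    Continuous fun s : ℝ => p * (min |s| M) ^ (p - 1) :=
  continuous_const.mul ((continuous_abs.min continuous_const).rpow_const
    fun _ => Or.inr (by linarith))

lemma hasDerivAt_truncPow {p : ℝ} (hp : 1 < p) (M x : ℝ) :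
    HasDerivAt (truncPow p M) (p * (min |x| M) ^ (p - 1)) x :=
  intervalIntegral.integral_hasDerivAt_right
    ((continuous_truncPow_deriv hp M).intervalIntegrable _ _)
    ((continuous_truncPow_deriv hp M).stronglyMeasurableAtFilter _ _)
    (continuous_truncPow_deriv hp M).continuousAt

lemma continuous_truncPow {p : ℝ} (hp : 1 < p) (M : ℝ) : Continuous (truncPow p M) :=
  continuous_iff_continuousAt.2 fun x => (hasDerivAt_truncPow hp M x).continuousAt

lemma truncPow_lipschitz {p M : ℝ} (hp : 1 < p) (hM : 0 < M) (x y : ℝ) :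
    |truncPow p M x - truncPow p M y| ≤ p * M ^ (p - 1) * |x - y| := by
  have := (convex_univ).norm_image_sub_le_of_norm_hasDerivWithin_le (f := truncPow p M)
    (C := p * M ^ (p - 1)) (fun z _ => (hasDerivAt_truncPow hp M z).hasDerivWithinAt)
    (fun z _ => by
      have h0 : 0 ≤ min |z| M := le_min (abs_nonneg z) hM.le
      rw [Real.norm_of_nonneg (mul_nonneg (by linarith) (Real.rpow_nonneg h0 _))]
      exact mul_le_mul_of_nonneg_left
        (Real.rpow_le_rpow h0 (min_le_right _ _) (by linarith)) (by linarith))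
    (mem_univ y) (mem_univ x)
  simpa using this

lemma truncPow_eq_oddPow {p M x : ℝ} (hp : 1 < p) (hx : |x| ≤ M) :
    truncPow p M x = oddPow p x := by
  have h1 : truncPow p M x = ∫ s in (0 : ℝ)..x, p * |s| ^ (p - 1) := by
    refine intervalIntegral.integral_congr fun s hs => ?_
    have h2 : |s| ≤ |x| := by simpa using abs_sub_left_of_mem_uIcc hs
    simp only [min_eq_left (h2.trans hx)]
  rw [h1, intervalIntegral.integral_eq_sub_of_hasDerivAt (fun s _ => hasDerivAt_oddPow hp s)
    ((continuous_const.mul (continuous_abs_rpow_sub_one hp)).intervalIntegrable _ _)]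
  simp [oddPow]

lemma truncPow_neg (p M x : ℝ) : truncPow p M (-x) = -truncPow p M x := by
  rw [truncPow, truncPow]
  have h := intervalIntegral.integral_comp_neg (a := 0) (b := x)
    (fun s : ℝ => p * (min |s| M) ^ (p - 1))
  simp only [abs_neg, neg_zero] at h
  rw [h, intervalIntegral.integral_symm]

lemma monotone_truncPow {p M : ℝ} (hp : 1 < p) (hM : 0 < M) : Monotone (truncPow p M) :=
  monotone_of_hasDerivAt_nonneg (hasDerivAt_truncPow hp M) fun x =>
    mul_nonneg (by linarith) (Real.rpow_nonneg (le_min (abs_nonneg x) hM.le) _)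

lemma truncPow_pos {p M x : ℝ} (hp : 1 < p) (hM : 0 < M) (hx : 0 < x) : 0 < truncPow p M x :=
  intervalIntegral.intervalIntegral_pos_of_pos_on
    ((continuous_truncPow_deriv hp M).intervalIntegrable _ _)
    (fun s hs => mul_pos (by linarith)
      (Real.rpow_pos_of_pos (lt_min (abs_pos.2 hs.1.ne') hM) _)) hx

lemma one_le_truncPow {p M x : ℝ} (hp : 1 < p) (hM : 1 ≤ M) (hx : 1 ≤ x) : 1 ≤ truncPow p M x := by
  have h1 : truncPow p M 1 = 1 := by
    rw [truncPow_eq_oddPow hp (by simpa using hM)]; simp [oddPow]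
  rw [← h1]
  exact monotone_truncPow hp (by linarith) hx

/-! ### Sign, monotonicity and boundedness of profiles -/

lemma exists_first_zero {u : ℝ → ℝ} (hu : Continuous u) (h0 : 0 < u 0) {y : ℝ} (hy : 0 ≤ y)
    (huy : u y ≤ 0) : ∃ z, 0 < z ∧ z ≤ y ∧ u z = 0 ∧ ∀ t ∈ Ico 0 z, 0 < u t := by
  obtain ⟨z, ⟨hz, hzu⟩, hleast⟩ := ((isCompact_Icc (a := (0 : ℝ)) (b := y)).inter_right
    (isClosed_le hu continuous_const : IsClosed {t | u t ≤ 0})).exists_isLeast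
    ⟨y, ⟨hy, le_rfl⟩, huy⟩
  have hpos : ∀ t ∈ Ico 0 z, 0 < u t := fun t ht => by
    by_contra hc
    exact absurd (hleast ⟨⟨ht.1, ht.2.le.trans hz.2⟩, not_lt.1 hc⟩) (not_le.2 ht.2)
  have hz0 : 0 < z := hz.1.lt_of_ne fun h => by subst h; exact absurd h0 (not_lt.2 hzu)
  refine ⟨z, hz0, hz.2, le_antisymm hzu ?_, hpos⟩
  have h1 : Tendsto u (𝓝[<] z) (𝓝 (u z)) := (hu.tendsto z).mono_left nhdsWithin_le_nhds
  refine ge_of_tendsto h1 ?_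
  filter_upwards [Ioo_mem_nhdsLT hz0] with t ht using (hpos t ⟨ht.1.le, ht.2⟩).le

/-- By the integral equation `-2v'(r)` is a weighted mean of `g ∘ v` over the segment between `0`
and `r`, on either side of `0`. -/
lemma IsProfile.deriv_neg {d : ℕ} {g v : ℝ → ℝ} (h : IsProfile d g v) (hg : Continuous g)
    (hpos : ∀ x, 0 < x → 0 < g x) {r : ℝ} (hr : ∀ τ ∈ Ioo (0 : ℝ) 1, 0 < v (r * τ)) :
    deriv v r < 0 := by
  rw [(h.hasDerivAt hg r).deriv]
  have := weightedMean_pos d (hg.comp h.continuous) fun τ hτ => hpos _ (hr τ hτ)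
  linarith

/-- Up to the first zero `-z` met when moving left from `0`, `v` is positive and therefore strictly
decreasing, so `v(-z) > v(0) = 1`, a contradiction. -/
lemma IsProfile.pos_of_nonpos {d : ℕ} {g v : ℝ → ℝ} (h : IsProfile d g v) (hg : Continuous g)
    (hpos : ∀ x, 0 < x → 0 < g x) {r : ℝ} (hr : r ≤ 0) : 0 < v r := by
  by_contra hc
  have hv := h.continuous
  obtain ⟨z, hz, -, hz0, hzpos⟩ := exists_first_zero (u := fun t => v (-t)) (by fun_prop)
    (by simp [h.apply_zero]) (neg_nonneg.2 hr) (by simpa using hc)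
  have hanti : StrictAntiOn v (Icc (-z) 0) := by
    refine strictAntiOn_of_deriv_neg (convex_Icc _ _) hv.continuousOn fun r hr => ?_
    rw [interior_Icc] at hr
    refine h.deriv_neg hg hpos fun τ hτ => ?_
    have := hzpos (-(r * τ)) ⟨by nlinarith [hτ.1, hr.2], by nlinarith [hτ.1, hτ.2, hr.1, hr.2]⟩
    simpa using this
  have := hanti ⟨le_rfl, by linarith⟩ ⟨by linarith, le_rfl⟩ (by linarith : -z < 0)
  rw [hz0, h.apply_zero] at this
  linarith

lemma IsProfile.deriv_neg_of_nonpos {d : ℕ} {g v : ℝ → ℝ} (h : IsProfile d g v)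
    (hg : Continuous g) (hpos : ∀ x, 0 < x → 0 < g x) {r : ℝ} (hr : r ≤ 0) : deriv v r < 0 :=
  h.deriv_neg hg hpos fun _ hτ =>
    h.pos_of_nonpos hg hpos (mul_nonpos_of_nonpos_of_nonneg hr hτ.1.le)

lemma IsProfile.strictAntiOn {d : ℕ} {g v : ℝ → ℝ} (h : IsProfile d g v)
    (hg : Continuous g) (hpos : ∀ x, 0 < x → 0 < g x) : StrictAntiOn v (Iic 0) :=
  strictAntiOn_of_deriv_neg (convex_Iic _) h.continuous.continuousOn fun r hr => by
    rw [interior_Iic] at hr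
    exact h.deriv_neg_of_nonpos hg hpos (mem_Iio.1 hr).le

lemma IsProfile.one_le {d : ℕ} {g v : ℝ → ℝ} (h : IsProfile d g v) (hg : Continuous g)
    (hpos : ∀ x, 0 < x → 0 < g x) {r : ℝ} (hr : r ≤ 0) : 1 ≤ v r := by
  rw [← h.apply_zero]
  exact (h.strictAntiOn hg hpos).antitoneOn (mem_Iic.2 hr) self_mem_Iic hr

lemma le_weightedMean (d : ℕ) {h : ℝ → ℝ} (hh : Continuous h) {r c : ℝ}
    (hc : ∀ τ ∈ Icc (0 : ℝ) 1, c ≤ h (r * τ)) : c / (d + 1) ≤ weightedMean d h r := by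
  have h1 : ∫ θ in (0 : ℝ)..1, θ ^ d * c = c / (d + 1) := by
    rw [intervalIntegral.integral_mul_const, integral_pow]; simp; ring
  rw [← h1]
  refine intervalIntegral.integral_mono_on zero_le_one ?_ ?_ fun θ hθ => ?_
  · apply Continuous.intervalIntegrable; fun_prop
  · apply Continuous.intervalIntegrable; fun_prop
  · exact mul_le_mul_of_nonneg_left (hc _ ⟨by positivity, pow_le_one₀ hθ.1 hθ.2⟩)
      (pow_nonneg hθ.1 d)

/-- To the left of `0` one has `g(v) ≥ 1`, so the slope is at most `-1/(2(d+1))` and every height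
above `1` is reached. -/
lemma IsProfile.exists_eq {d : ℕ} {g v : ℝ → ℝ} (h : IsProfile d g v) (hg : Continuous g)
    (hpos : ∀ x, 0 < x → 0 < g x) (hone : ∀ x, 1 ≤ x → 1 ≤ g x) {M : ℝ} (hM : 1 < M) :
    ∃ y, 0 < y ∧ v (-y) = M := by
  have hv := h.continuous
  have hder : ∀ y, 0 ≤ y → (1 : ℝ) / (2 * (d + 1)) ≤ -deriv v (-y) := fun y hy => by
    rw [(h.hasDerivAt hg (-y)).deriv]
    have := le_weightedMean d (hg.comp h.continuous) (r := -y) (c := 1) fun τ hτ =>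
      hone _ (h.one_le hg hpos (mul_nonpos_of_nonpos_of_nonneg (by linarith) hτ.1))
    have h2 : (1 : ℝ) / (2 * (d + 1)) = 1 / 2 * (1 / (d + 1)) := by field_simp
    linarith
  have hd : ∀ y, HasDerivAt (fun y => v (-y)) (-deriv v (-y)) y := fun y => by
    have h1 := (h.hasDerivAt hg (-y)).differentiableAt.hasDerivAt
    simpa [Function.comp_def] using h1.comp y (hasDerivAt_neg y)
  -- The linear lower bound `1 + y/(2(d+1))` equals `M` at `y = Y`.
  set Y : ℝ := 2 * (d + 1) * (M - 1) with hY
  have hd0 : (0 : ℝ) < d + 1 := by positivity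
  have hY0 : 0 < Y := by have : 0 < M - 1 := by linarith
                         positivity
  have hMY : M ≤ v (-Y) := by
    have := (convex_Icc (0 : ℝ) Y).mul_sub_le_image_sub_of_le_deriv (f := fun y => v (-y))
      (C := 1 / (2 * (d + 1))) (by fun_prop)
      (fun y _ => (hd y).differentiableAt.differentiableWithinAt)
      (fun y hy => by
        rw [interior_Icc] at hy
        rw [(hd y).deriv]; exact hder y hy.1.le) 0 ⟨le_rfl, hY0.le⟩ Y ⟨hY0.le, le_rfl⟩ hY0.le
    have h2 : 1 / (2 * ((d : ℝ) + 1)) * (Y - 0) = M - 1 := by rw [hY]; field_simp; ring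
    rw [h2] at this
    simp only [neg_zero, h.apply_zero] at this
    linarith
  obtain ⟨y, hy, hyM⟩ := intermediate_value_Icc hY0.le (f := fun y => v (-y))
    (by fun_prop) (show M ∈ Icc _ _ from ⟨by simp [h.apply_zero, hM.le], hMY⟩)
  refine ⟨y, hy.1.lt_of_ne fun h0 => ?_, hyM⟩
  subst h0
  simp [h.apply_zero] at hyM
  linarith

/-- With `G` the primitive of `g`, the energy `2 r v'² + G(v)` has derivative `-2d v'² ≤ 0`, so
`G(v) ≤ G(1)` for `r ≥ 0`. Since `G` is even and strictly increasing on `[0, ∞)`, this bounds `|v|`.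
-/
lemma IsProfile.abs_le_one {d : ℕ} {g g' v : ℝ → ℝ} (h : IsProfile d g v)
    (hg : ∀ x, HasDerivAt g (g' x) x) (hg' : Continuous g') (hpos : ∀ x, 0 < x → 0 < g x)
    (hodd : ∀ x, g (-x) = -g x) {r : ℝ} (hr : 0 ≤ r) : |v r| ≤ 1 := by
  obtain ⟨hC2, heqn⟩ := h.contDiff_and_eqn hg hg'
  have hgc : Continuous g := continuous_iff_continuousAt.2 fun x => (hg x).continuousAt
  have hd1 : ∀ r, HasDerivAt v (deriv v r) r := fun r =>
    (hC2.differentiable (by norm_num) r).hasDerivAt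
  have hd2 : ∀ r, HasDerivAt (deriv v) (deriv (deriv v) r) r := fun r => by
    have : ContDiff ℝ 1 (deriv v) :=
      (contDiff_succ_iff_deriv.1 (show ContDiff ℝ (1 + 1) v from hC2)).2.2
    exact (this.differentiable (by norm_num) r).hasDerivAt
  set G : ℝ → ℝ := fun x => ∫ s in (0 : ℝ)..x, g s with hG
  have hGd : ∀ x, HasDerivAt G (g x) x := fun x =>
    intervalIntegral.integral_hasDerivAt_right (hgc.intervalIntegrable _ _)
      (hgc.stronglyMeasurableAtFilter _ _) hgc.continuousAt
  have hGeven : ∀ x, G (-x) = G x := fun x => by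
    have := intervalIntegral.integral_comp_neg (a := 0) (b := x) g
    simp only [hodd, intervalIntegral.integral_neg, neg_zero] at this
    simp only [hG]
    rw [intervalIntegral.integral_symm, ← this, neg_neg]
  have hGabs : G (v r) = G |v r| := by
    rcases abs_choice (v r) with h1 | h1 <;> rw [h1]
    exact (hGeven _).symm
  have hE : AntitoneOn (fun r => 2 * r * deriv v r ^ 2 + G (v r)) (Ici 0) := by
    have hEd : ∀ r, HasDerivAt (fun r => 2 * r * deriv v r ^ 2 + G (v r))
        (-(2 * d) * deriv v r ^ 2) r := fun r => by
      have h1 := ((hasDerivAt_id r).const_mul 2).mul ((hd2 r).pow 2)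
      refine (h1.add ((hGd (v r)).comp r (hd1 r))).congr_deriv ?_
      simp only [id, Pi.pow_apply]
      push_cast
      linear_combination deriv v r * heqn r
    refine antitoneOn_of_deriv_nonpos (convex_Ici 0)
      (fun r _ => (hEd r).continuousAt.continuousWithinAt)
      (fun r _ => (hEd r).differentiableAt.differentiableWithinAt) fun r _ => ?_
    rw [(hEd r).deriv]
    have : (0 : ℝ) ≤ d := d.cast_nonneg
    nlinarith [mul_nonneg this (sq_nonneg (deriv v r))]
  have hle := hE (mem_Ici.2 le_rfl) (mem_Ici.2 hr) hr
  simp only [mul_zero, zero_mul, zero_add, h.apply_zero] at hle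
  by_contra hc
  push Not at hc
  have hsm : StrictMonoOn G (Ici 0) :=
    strictMonoOn_of_deriv_pos (convex_Ici 0) (fun x _ => (hGd x).continuousAt.continuousWithinAt)
      fun x hx => by
        rw [interior_Ici] at hx
        rw [(hGd x).deriv]; exact hpos x hx
  have h3 := hsm (mem_Ici.2 zero_le_one) (mem_Ici.2 (abs_nonneg _)) hc
  have h4 : 0 ≤ 2 * r * deriv v r ^ 2 := by positivity
  rw [hGabs] at hle
  linarith

/-! ### Finite-time blow-up and the maximal profile -/

lemma ContDiffAt.hasDerivAt_deriv {v : ℝ → ℝ} {r : ℝ} (h : ContDiffAt ℝ 2 v r) :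
    HasDerivAt v (deriv v r) r ∧ HasDerivAt (deriv v) (deriv (deriv v) r) r := by
  refine ⟨(h.differentiableAt (by norm_num)).hasDerivAt, ?_⟩
  have h1 : ContDiffAt ℝ 1 (fderiv ℝ v) r := h.fderiv_right (by norm_num)
  have h2 : DifferentiableAt ℝ (fun x => fderiv ℝ v x 1) r :=
    (h1.differentiableAt (by norm_num)).clm_apply (differentiableAt_const _)
  simp only [fderiv_apply_one_eq_deriv] at h2
  exact h2.hasDerivAt

/-- The hypothesis says that `W^(1-q) + (q-1) c log y` is nonincreasing; but `W^(1-q)` is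
nonnegative and the logarithm is unbounded. -/
lemma false_of_superlinear_growth {W W' : ℝ → ℝ} {c q : ℝ} (hc : 0 < c) (hq : 1 < q)
    (hd : ∀ y, 1 ≤ y → HasDerivAt W (W' y) y) (hW : ∀ y, 1 ≤ y → 0 < W y)
    (hgrow : ∀ y, 1 ≤ y → c * W y ^ q ≤ y * W' y) : False := by
  have hdG : ∀ y, 1 ≤ y → HasDerivAt (fun y => W y ^ (1 - q) + (q - 1) * c * Real.log y)
      (W' y * (1 - q) * W y ^ (1 - q - 1) + (q - 1) * c * y⁻¹) y := fun y hy =>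
    ((hd y hy).rpow_const (Or.inl (hW y hy).ne')).add
      ((Real.hasDerivAt_log (by linarith)).const_mul _)
  have hanti : AntitoneOn (fun y => W y ^ (1 - q) + (q - 1) * c * Real.log y) (Ici 1) := by
    refine antitoneOn_of_deriv_nonpos (convex_Ici 1)
      (fun y hy => (hdG y hy).continuousAt.continuousWithinAt)
      (fun y hy => ?_) fun y hy => ?_
    all_goals rw [interior_Ici] at hy; have hy1 : 1 ≤ y := (mem_Ioi.1 hy).le
    · exact (hdG y hy1).differentiableAt.differentiableWithinAt
    · have hy0 : 0 < y := by linarith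
      rw [(hdG y hy1).deriv]
      have h1 : W y ^ (1 - q - 1) * W y ^ q = 1 := by
        rw [← Real.rpow_add (hW y hy1)]; simp
      have h2 : c ≤ y * W' y * W y ^ (1 - q - 1) := by
        have := mul_le_mul_of_nonneg_right (hgrow y hy1)
          (Real.rpow_nonneg (hW y hy1).le (1 - q - 1))
        nlinarith
      have h3 : W' y * (1 - q) * W y ^ (1 - q - 1) + (q - 1) * c * y⁻¹
          = (q - 1) * (c - y * W' y * W y ^ (1 - q - 1)) * y⁻¹ := by field_simp; ring
      rw [h3]
      exact mul_nonpos_of_nonpos_of_nonneg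
        (mul_nonpos_of_nonneg_of_nonpos (by linarith) (by linarith)) (inv_pos.2 hy0).le
  have hlog : Tendsto (fun y => (q - 1) * c * Real.log y) atTop atTop :=
    Real.tendsto_log_atTop.const_mul_atTop (mul_pos (by linarith) hc)
  obtain ⟨y, hy1, hy⟩ := ((eventually_ge_atTop 1).and
    (hlog.eventually_gt_atTop (W 1 ^ (1 - q) + (q - 1) * c * Real.log 1))).exists
  have h1 := hanti (mem_Ici.2 le_rfl) (mem_Ici.2 hy1) hy1
  have h2 := Real.rpow_nonneg (hW y hy1).le (1 - q)
  simp only at h1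
  linarith

/-- Positive increasing solutions of `4 y W'' + 2 (d + 1) W' = W^p` blow up in finite time. -/
lemma false_of_global_solution (d : ℕ) {p : ℝ} (hp : 1 < p) {W W' W'' : ℝ → ℝ}
    (hd1 : ∀ y, 1 ≤ y → HasDerivAt W (W' y) y) (hd2 : ∀ y, 1 ≤ y → HasDerivAt W' (W'' y) y)
    (hW : ∀ y, 1 ≤ y → 1 ≤ W y) (hW' : ∀ y, 1 ≤ y → 0 < W' y)
    (heqn : ∀ y, 1 ≤ y → 4 * y * W'' y + 2 * (d + 1) * W' y = W y ^ p) : False := by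
  -- The exponent lies strictly between `1` and `p`, and `2q - 1 = p`, so `W^q W^(q-1) = W^p` in the
  -- comparison of derivatives.
  set q := (p + 1) / 2 with hq
  have hW0 : ∀ y, 1 ≤ y → 0 < W y := fun y hy => zero_lt_one.trans_le (hW y hy)
  have hd0 : (0 : ℝ) ≤ d := d.cast_nonneg
  -- The first entry makes `c W^q ≤ y W'` hold at `y = 1`; the second makes the derivative
  -- comparison strict at any contact point.
  set c := min (W' 1 / W 1 ^ q) (1 / (4 * (q + d + 1) + 4)) with hcdef
  have hc : 0 < c := lt_min (div_pos (hW' 1 le_rfl) (Real.rpow_pos_of_pos (hW0 1 le_rfl) _))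
    (by positivity)
  have hc2 : c * (4 * (q + d + 1) + 4) ≤ 1 := by
    rw [← le_div_iff₀ (by positivity)]; exact min_le_right _ _
  have hc1 : c ≤ 1 := by nlinarith
  refine false_of_superlinear_growth hc (by linarith : 1 < q) hd1 hW0 fun y hy => ?_
  have hf : ∀ y, 1 ≤ y → HasDerivAt (fun y => c * W y ^ q) (c * (W' y * q * W y ^ (q - 1))) y :=
    fun y hy => ((hd1 y hy).rpow_const (Or.inl (hW0 y hy).ne')).const_mul c
  have hB : ∀ y, 1 ≤ y → HasDerivAt (fun y => y * W' y) (1 * W' y + y * W'' y) y :=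
    fun y hy => (hasDerivAt_id y).mul (hd2 y hy)
  -- Barrier argument for `c W^q ≤ y W'`: at a contact point `W' ≤ c W^q ≤ c W^p`, so in the
  -- derivative of `y W'` the source `W^p / 4` outweighs all terms containing `W'`.
  refine image_le_of_deriv_right_lt_deriv_boundary' (f := fun y => c * W y ^ q)
    (B := fun y => y * W' y) (a := 1) (b := y)
    (fun z hz => (hf z hz.1).continuousAt.continuousWithinAt)
    (fun z hz => (hf z hz.1).hasDerivWithinAt) ?_
    (fun z hz => (hB z hz.1).continuousAt.continuousWithinAt)
    (fun z hz => (hB z hz.1).hasDerivWithinAt) (fun z hz heq => ?_) ⟨hy, le_rfl⟩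
  · have h1 : c ≤ W' 1 / W 1 ^ q := min_le_left _ _
    rw [le_div_iff₀ (Real.rpow_pos_of_pos (hW0 1 le_rfl) _)] at h1
    linarith
  · have hz : 1 ≤ z := hz.1
    have hz0 : 0 < z := by linarith
    have hWz := hW0 z hz
    have e1 : W z ^ q * W z ^ (q - 1) = W z ^ p := by
      rw [← Real.rpow_add hWz]; congr 1; rw [hq]; ring
    have e2 : W z ^ q ≤ W z ^ p := Real.rpow_le_rpow_of_exponent_le (hW z hz) (by linarith)
    have hWp : 0 < W z ^ p := Real.rpow_pos_of_pos hWz p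
    have hWq1 : 0 ≤ W z ^ (q - 1) := Real.rpow_nonneg hWz.le _
    have hle : W' z ≤ c * W z ^ q := by
      rw [heq]; nlinarith [hW' z hz]
    have h1 : W' z * q * W z ^ (q - 1) ≤ c * q * W z ^ p := by
      rw [← e1]
      calc W' z * q * W z ^ (q - 1) = W' z * (q * W z ^ (q - 1)) := by ring
        _ ≤ c * W z ^ q * (q * W z ^ (q - 1)) :=
            mul_le_mul_of_nonneg_right hle (by positivity)
        _ = _ := by ring
    have h2 : c * (W' z * q * W z ^ (q - 1)) ≤ c * q * W z ^ p := by
      have : 0 ≤ W' z * q * W z ^ (q - 1) :=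
        mul_nonneg (mul_nonneg (hW' z hz).le (by linarith)) hWq1
      nlinarith
    have h3 : W' z ≤ c * W z ^ p := hle.trans (mul_le_mul_of_nonneg_left e2 hc.le)
    have h4 : (d : ℝ) * W' z ≤ d * (c * W z ^ p) := mul_le_mul_of_nonneg_left h3 hd0
    have h5 := mul_le_mul_of_nonneg_right hc2 hWp.le
    have h6 := mul_pos hc hWp
    have h7 := mul_nonneg hd0 h6.le
    have h8 := heqn z hz
    nlinarith [hW' z hz]

/-- The solution of `4 r v'' + 2 (d + 1) v' + |v|^(p-1) v = 0`, `v(0) = 1`, on its maximal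
interval of existence `(-R, ∞)`. -/
structure IsMaximalProfile (d : ℕ) (p R : ℝ) (v : ℝ → ℝ) : Prop where
  pos : 0 < R
  contDiffAt : ∀ r, -R < r → ContDiffAt ℝ 2 v r
  eqn : ∀ r, -R < r → 4 * r * deriv (deriv v) r + 2 * (d + 1) * deriv v r + oddPow p (v r) = 0
  apply_zero : v 0 = 1
  abs_le_one : ∀ r, 0 ≤ r → |v r| ≤ 1
  one_le : ∀ r, -R < r → r ≤ 0 → 1 ≤ v r
  deriv_neg_of_nonpos : ∀ r, -R < r → r ≤ 0 → deriv v r < 0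
  deriv_neg : ∀ r, 0 ≤ r → (∀ t ∈ Ico 0 r, 0 < v t) → deriv v r < 0
  tendsto : Tendsto v (𝓝[>] (-R)) atTop

/-- Solve with the power truncated at height `n + 2`, and let `-y n` be the negative point where
that height is reached. To the right of it the truncation is invisible, so successive profiles agree
and glue to `V`. The sequence `y n` increases and is bounded, and `R` is its supremum; blow-up at
`-R` follows from `V(-y n) = n + 2` and monotonicity. -/
theorem exists_isMaximalProfile (d : ℕ) {p : ℝ} (hp : 1 < p) :
    ∃ R v, IsMaximalProfile d p R v := by
  have hM : ∀ n : ℕ, (0 : ℝ) < n + 2 := fun n => by positivity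
  have hM1 : ∀ n : ℕ, (1 : ℝ) < n + 2 := fun n => by
    have : (0 : ℝ) ≤ n := n.cast_nonneg
    linarith
  have hL : ∀ n : ℕ, 0 < p * ((n : ℝ) + 2) ^ (p - 1) := fun n =>
    mul_pos (by linarith) (Real.rpow_pos_of_pos (hM n) _)
  choose v hv using fun n : ℕ => exists_isProfile d (hL n) (truncPow_lipschitz hp (hM n))
  have hgc : ∀ n : ℕ, Continuous (truncPow p (n + 2)) := fun n => continuous_truncPow hp _
  have hgpos : ∀ (n : ℕ) x, 0 < x → 0 < truncPow p (n + 2) x := fun n x =>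
    truncPow_pos hp (hM n)
  have hpos : ∀ n r, r ≤ 0 → 1 ≤ v n r := fun n r => (hv n).one_le (hgc n) (hgpos n)
  have hbd : ∀ n r, 0 ≤ r → |v n r| ≤ 1 := fun n r => (hv n).abs_le_one
    (hasDerivAt_truncPow hp _) (continuous_truncPow_deriv hp _) (hgpos n) (truncPow_neg p _)
  choose y hy0 hy using fun n : ℕ => (hv n).exists_eq (hgc n) (hgpos n)
    (fun x => one_le_truncPow hp (hM1 n).le) (hM1 n)
  have hanti : ∀ n, StrictAntiOn (v n) (Iic 0) := fun n => (hv n).strictAntiOn (hgc n) (hgpos n)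
  have hle : ∀ n r, -y n ≤ r → |v n r| ≤ n + 2 := fun n r hr => by
    rcases le_total 0 r with h | h
    · exact (hbd n r h).trans (hM1 n).le
    · rw [abs_of_nonneg (zero_le_one.trans (hpos n r h)), ← hy n]
      exact (hanti n).antitoneOn (by simpa using (hy0 n).le) h hr
  -- Along `v n` both truncations coincide with the odd power, so the Lipschitz bound of the higher
  -- one alone controls the difference.
  have hagree : ∀ n m, n ≤ m → ∀ r, -y n ≤ r → v n r = v m r := fun n m hnm r hr => by
    refine (hv n).eqOn (hv m) (hgc n) (hgc m) (a := -y n) (b := max r 0) (hL m)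
      (by linarith [hy0 n]) (le_max_right _ _) (fun t ht => ?_) ⟨hr, le_max_left _ _⟩
    have h1 := hle n t ht.1
    have h2 : (n : ℝ) ≤ m := by exact_mod_cast hnm
    rw [truncPow_eq_oddPow hp h1, ← truncPow_eq_oddPow hp (h1.trans (by linarith :
      (n : ℝ) + 2 ≤ m + 2))]
    exact truncPow_lipschitz hp (hM m) _ _
  -- Otherwise `v n` would agree at `-y (n + 1)` with the next profile and take there the value `n +
  -- 3`, above its bound `n + 2`.
  have hylt : StrictMono y := strictMono_nat_of_lt_succ fun n => by
    by_contra hc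
    have h1 := hagree n (n + 1) n.le_succ (-y (n + 1)) (by linarith)
    have h2 := hle n (-y (n + 1)) (by linarith)
    rw [h1, hy, abs_of_pos (hM _)] at h2
    push_cast at h2
    linarith
  obtain ⟨V, hV⟩ : ∃ V : ℝ → ℝ, ∀ n r, -y n ≤ r → V r = v n r := by
    classical
    refine ⟨fun r => if h : ∃ n, -y n ≤ r then v h.choose r else 0, fun n r hr => ?_⟩
    have h : ∃ n, -y n ≤ r := ⟨n, hr⟩
    simp only [h, dif_pos]
    rcases le_total n h.choose with h1 | h1
    · exact (hagree _ _ h1 r hr).symm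
    · exact hagree _ _ h1 r h.choose_spec
  have hVn : ∀ n r, -y n < r → V =ᶠ[𝓝 r] v n := fun n r hr => by
    filter_upwards [lt_mem_nhds hr] with t ht using hV n t ht.le
  have hC2 : ∀ n r, -y n < r → ContDiffAt ℝ 2 V r := fun n r hr =>
    (((hv n).contDiff_and_eqn (hasDerivAt_truncPow hp _)
      (continuous_truncPow_deriv hp _)).1.contDiffAt).congr_of_eventuallyEq (hVn n r hr)
  have heqn : ∀ n r, -y n < r →
      4 * r * deriv (deriv V) r + 2 * (d + 1) * deriv V r + oddPow p (V r) = 0 := fun n r hr => by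
    have h1 := ((hv n).contDiff_and_eqn (hasDerivAt_truncPow hp _)
      (continuous_truncPow_deriv hp _)).2 r
    rw [(hVn n r hr).deriv.deriv_eq, (hVn n r hr).deriv_eq, (hVn n r hr).eq_of_nhds]
    rwa [truncPow_eq_oddPow hp (hle n r hr.le)] at h1
  have hone : ∀ n r, -y n < r → r ≤ 0 → 1 ≤ V r := fun n r hr hr0 => by
    rw [hV n r hr.le]; exact hpos n r hr0
  have hneg : ∀ n r, -y n < r → r ≤ 0 → deriv V r < 0 := fun n r hr hr0 => by
    rw [(hVn n r hr).deriv_eq]; exact (hv n).deriv_neg_of_nonpos (hgc n) (hgpos n) hr0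
  -- If `y` were unbounded, `t ↦ V(-t)` would be a global positive increasing solution of the
  -- reflected equation.
  have hbdd : BddAbove (range y) := by
    by_contra hunb
    have hex : ∀ t, 1 ≤ t → ∃ n, -y n < -t := fun t _ => by
      rw [not_bddAbove_iff] at hunb
      obtain ⟨_, ⟨n, rfl⟩, hn⟩ := hunb t
      exact ⟨n, by linarith⟩
    refine false_of_global_solution d hp (W := fun t => V (-t)) (W' := fun t => -deriv V (-t))
      (W'' := fun t => deriv (deriv V) (-t)) (fun t ht => ?_) (fun t ht => ?_) (fun t ht => ?_)
      (fun t ht => ?_) (fun t ht => ?_) <;> obtain ⟨n, hn⟩ := hex t ht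
    · simpa [Function.comp_def] using (hC2 n _ hn).hasDerivAt_deriv.1.comp t (hasDerivAt_neg t)
    · exact ((hC2 n _ hn).hasDerivAt_deriv.2.comp t (hasDerivAt_neg t)).neg.congr_deriv (by simp)
    · exact hone n _ hn (by linarith)
    · exact neg_pos.2 (hneg n _ hn (by linarith))
    · have h1 := heqn n _ hn
      rw [oddPow_of_pos (zero_lt_one.trans_le (hone n _ hn (by linarith)))] at h1
      linarith
  set R := ⨆ n, y n with hR
  have hyR : ∀ n, y n < R := fun n => (hylt n.lt_succ_self).trans_le (le_ciSup hbdd (n + 1))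
  have hex : ∀ r, -R < r → ∃ n, -y n < r := fun r hr => by
    obtain ⟨n, hn⟩ := exists_lt_of_lt_ciSup (show -r < ⨆ n, y n by linarith)
    exact ⟨n, by linarith⟩
  have hVanti : AntitoneOn V (Ioc (-R) 0) := by
    refine antitoneOn_of_deriv_nonpos (convex_Ioc _ _) (fun r hr => ?_) (fun r hr => ?_)
      (fun r hr => ?_)
    · obtain ⟨n, hn⟩ := hex r hr.1
      exact (hC2 n r hn).continuousAt.continuousWithinAt
    all_goals
      rw [interior_Ioc] at hr
      obtain ⟨n, hn⟩ := hex r hr.1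
    · exact (hC2 n r hn).hasDerivAt_deriv.1.differentiableAt.differentiableWithinAt
    · exact (hneg n r hn hr.2.le).le
  refine ⟨R, V, (hy0 0).trans (hyR 0), fun r hr => ?_, fun r hr => ?_, ?_, fun r hr => ?_,
    fun r hr => ?_, fun r hr => ?_, fun r hr hpos => ?_, ?_⟩
  · obtain ⟨n, hn⟩ := hex r hr
    exact hC2 n r hn
  · obtain ⟨n, hn⟩ := hex r hr
    exact heqn n r hn
  · rw [hV 0 0 (by linarith [hy0 0]), (hv 0).apply_zero]
  · rw [hV 0 r (by linarith [hy0 0])]; exact hbd 0 r hr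
  · obtain ⟨n, hn⟩ := hex r hr
    exact hone n r hn
  · obtain ⟨n, hn⟩ := hex r hr
    exact hneg n r hn
  · rw [(hVn 0 r (by linarith [hy0 0])).deriv_eq]
    refine (hv 0).deriv_neg (hgc 0) (hgpos 0) fun τ hτ => ?_
    rcases hr.eq_or_lt with rfl | hr
    · simp [(hv 0).apply_zero]
    · rw [← hV 0 _ (by nlinarith [hy0 0, hτ.1])]
      exact hpos _ ⟨mul_nonneg hr.le hτ.1.le, by nlinarith [hτ.2]⟩
  · refine tendsto_atTop.2 fun b => ?_
    obtain ⟨n, hn⟩ := exists_nat_ge b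
    filter_upwards [Ioo_mem_nhdsGT (show -R < -y n by linarith [hyR n])] with r hr
    have h1 := hVanti ⟨hr.1, by linarith [hr.2, hy0 n]⟩
      ⟨by linarith [hyR n], by linarith [hy0 n]⟩ hr.2.le
    rw [hV n _ le_rfl, hy n] at h1
    linarith

/-! ### Radial solutions: energy decay and the Pohozaev functional -/

/-- `w` is a radial solution of `-Δw = |w|^(p-1) w` in dimension `d + 1`, with first and second
derivatives `w'` and `w''`. -/
structure IsRadialSolution (d : ℕ) (p : ℝ) (w w' w'' : ℝ → ℝ) : Prop where
  hasDerivAt : ∀ ρ, HasDerivAt w (w' ρ) ρ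
  hasDerivAt' : ∀ ρ, HasDerivAt w' (w'' ρ) ρ
  deriv_zero : w' 0 = 0
  eqn : ∀ ρ, ρ * w'' ρ + d * w' ρ + ρ * oddPow p (w ρ) = 0

lemma IsMaximalProfile.isRadialSolution {d : ℕ} {p R : ℝ} {v : ℝ → ℝ}
    (h : IsMaximalProfile d p R v) :
    IsRadialSolution d p (fun ρ => v (ρ ^ 2)) (fun ρ => 2 * ρ * deriv v (ρ ^ 2))
      (fun ρ => 2 * deriv v (ρ ^ 2) + 4 * ρ ^ 2 * deriv (deriv v) (ρ ^ 2)) := by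
  have hR : ∀ ρ : ℝ, -R < ρ ^ 2 := fun ρ => by nlinarith [h.pos, sq_nonneg ρ]
  have hsq : ∀ ρ : ℝ, HasDerivAt (fun ρ : ℝ => ρ ^ 2) (2 * ρ) ρ := fun ρ => by
    simpa using hasDerivAt_pow 2 ρ
  refine ⟨fun ρ => ?_, fun ρ => ?_, by simp, fun ρ => ?_⟩
  · exact (HasDerivAt.comp (h := fun ρ : ℝ => ρ ^ 2) ρ
      (h.contDiffAt _ (hR ρ)).hasDerivAt_deriv.1 (hsq ρ)).congr_deriv (by ring)
  · exact (((hasDerivAt_id ρ).const_mul 2).mul (HasDerivAt.comp (h := fun ρ : ℝ => ρ ^ 2) ρ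
      (h.contDiffAt _ (hR ρ)).hasDerivAt_deriv.2 (hsq ρ))).congr_deriv
      (by simp only [id, Function.comp]; ring)
  · linear_combination ρ * h.eqn _ (hR ρ)

lemma mul_oddPow_self {p : ℝ} (hp : 1 < p) (x : ℝ) : x * oddPow p x = |x| ^ (p + 1) := by
  rcases eq_or_ne x 0 with rfl | hx
  · simp [oddPow, Real.zero_rpow (by linarith : p + 1 ≠ 0)]
  · have h1 : p + 1 = (p - 1) + (2 : ℕ) := by push_cast; ring
    rw [h1, Real.rpow_add_natCast (abs_pos.2 hx).ne', oddPow, sq_abs]; ring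

/-- The primitive of the odd power. -/
noncomputable def powPrimitive (p x : ℝ) : ℝ := |x| ^ (p + 1) / (p + 1)

lemma powPrimitive_nonneg {p : ℝ} (hp : 1 < p) (x : ℝ) : 0 ≤ powPrimitive p x :=
  div_nonneg (Real.rpow_nonneg (abs_nonneg x) _) (by linarith)

lemma mul_oddPow_self_eq {p : ℝ} (hp : 1 < p) (x : ℝ) :
    x * oddPow p x = (p + 1) * powPrimitive p x := by
  rw [mul_oddPow_self hp, powPrimitive]; field_simp

lemma hasDerivAt_powPrimitive {p : ℝ} (hp : 1 < p) (x : ℝ) :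
    HasDerivAt (powPrimitive p) (oddPow p x) x := by
  refine ((hasDerivAt_abs_rpow x (by linarith : 1 < p + 1)).div_const (p + 1)).congr_deriv ?_
  rw [oddPow, show p + 1 - 2 = p - 1 by ring]
  field_simp

namespace IsRadialSolution

variable {d : ℕ} {p : ℝ} {w w' w'' : ℝ → ℝ}

lemma neg (h : IsRadialSolution d p w w' w'') :
    IsRadialSolution d p (fun ρ => -w ρ) (fun ρ => -w' ρ) (fun ρ => -w'' ρ) :=
  ⟨fun ρ => (h.hasDerivAt ρ).neg, fun ρ => (h.hasDerivAt' ρ).neg, by simp [h.deriv_zero],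
    fun ρ => by rw [oddPow_neg]; linear_combination -h.eqn ρ⟩

lemma continuous (h : IsRadialSolution d p w w' w'') : Continuous w :=
  continuous_iff_continuousAt.2 fun ρ => (h.hasDerivAt ρ).continuousAt

lemma continuous' (h : IsRadialSolution d p w w' w'') : Continuous w' :=
  continuous_iff_continuousAt.2 fun ρ => (h.hasDerivAt' ρ).continuousAt

lemma hasDerivAt_powPrimitive_comp (h : IsRadialSolution d p w w' w'') (hp : 1 < p) (ρ : ℝ) :
    HasDerivAt (fun ρ => powPrimitive p (w ρ)) (oddPow p (w ρ) * w' ρ) ρ :=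
  (hasDerivAt_powPrimitive hp (w ρ)).comp ρ (h.hasDerivAt ρ)

lemma hasDerivAt_energy (h : IsRadialSolution d p w w' w'') (hp : 1 < p) (ρ : ℝ) :
    HasDerivAt (fun ρ => w' ρ ^ 2 / 2 + powPrimitive p (w ρ))
      (w' ρ * (w'' ρ + oddPow p (w ρ))) ρ := by
  refine ((((h.hasDerivAt' ρ).pow 2).div_const 2).add
    (h.hasDerivAt_powPrimitive_comp hp ρ)).congr_deriv ?_
  push_cast; ring

/-- The first-order term acts as friction: `ρ E' = -d w'²`. -/
lemma antitoneOn_energy (h : IsRadialSolution d p w w' w'') (hp : 1 < p) :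
    AntitoneOn (fun ρ => w' ρ ^ 2 / 2 + powPrimitive p (w ρ)) (Ici 0) := by
  refine antitoneOn_of_deriv_nonpos (convex_Ici 0)
    (fun ρ _ => (h.hasDerivAt_energy hp ρ).continuousAt.continuousWithinAt)
    (fun ρ _ => (h.hasDerivAt_energy hp ρ).differentiableAt.differentiableWithinAt)
    fun ρ hρ => ?_
  rw [interior_Ici] at hρ
  have hρ : 0 < ρ := hρ
  rw [(h.hasDerivAt_energy hp ρ).deriv]
  have h1 : ρ * (w' ρ * (w'' ρ + oddPow p (w ρ))) = -(d * w' ρ ^ 2) := by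
    linear_combination w' ρ * h.eqn ρ
  have h2 : 0 ≤ d * w' ρ ^ 2 := by positivity
  by_contra hc
  push Not at hc
  nlinarith [mul_pos hρ hc]

/-- Friction only dissipates `w'²`; adding `w w'/ρ` to `2E` trades part of it for `|w|^(p+1)`, so
that the whole energy is dissipated at rate `1/ρ`. If `E ≥ ε` persisted, `2E + w w'/ρ + ε log ρ`
would be nonincreasing for large `ρ` although it tends to infinity. -/
lemma exists_energy_lt (h : IsRadialSolution d p w w' w'') (hp : 1 < p) (hd : 1 ≤ d)
    (hb : ∀ ρ, 0 ≤ ρ → |w ρ| ≤ 1) {ε : ℝ} (hε : 0 < ε) :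
    ∃ ρ, 0 ≤ ρ ∧ w' ρ ^ 2 / 2 + powPrimitive p (w ρ) < ε := by
  by_contra! hE
  set C := 1 + (w' 0 ^ 2 / 2 + powPrimitive p (w 0)) with hC
  have hC0 : 0 < C := by
    have := powPrimitive_nonneg hp (w 0)
    positivity
  have hprod : ∀ ρ, 0 ≤ ρ → |w ρ * w' ρ| ≤ C := fun ρ hρ => by
    have h1 := h.antitoneOn_energy hp (mem_Ici.2 le_rfl) (mem_Ici.2 hρ) hρ
    simp only at h1
    have h2 : w ρ ^ 2 ≤ 1 := by rw [sq_le_one_iff_abs_le_one]; exact hb ρ hρ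
    have h3 := powPrimitive_nonneg hp (w ρ)
    rw [abs_le]
    constructor <;> nlinarith [sq_nonneg (w ρ + w' ρ), sq_nonneg (w ρ - w' ρ)]
  have hd1 : (1 : ℝ) ≤ d := by exact_mod_cast hd
  -- Beyond this radius the error term `(d+1)|w w'|/ρ²` is at most `ε/ρ`.
  set ρ₀ := max 1 ((d + 1) * C / ε) with hρ₀
  have hρ1 : 1 ≤ ρ₀ := le_max_left _ _
  set G : ℝ → ℝ := fun ρ => 2 * (w' ρ ^ 2 / 2 + powPrimitive p (w ρ)) + w ρ * w' ρ / ρ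
    + ε * Real.log ρ with hG
  have hGd : ∀ ρ, 0 < ρ → HasDerivAt G (2 * (w' ρ * (w'' ρ + oddPow p (w ρ)))
      + ((w' ρ * w' ρ + w ρ * w'' ρ) * ρ - w ρ * w' ρ * 1) / ρ ^ 2 + ε * ρ⁻¹) ρ := fun ρ hρ =>
    (((h.hasDerivAt_energy hp ρ).const_mul 2).add
      (((h.hasDerivAt ρ).mul (h.hasDerivAt' ρ)).div (hasDerivAt_id ρ) hρ.ne')).add
      ((Real.hasDerivAt_log hρ.ne').const_mul ε)
  have hanti : AntitoneOn G (Ici ρ₀) := by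
    refine antitoneOn_of_deriv_nonpos (convex_Ici _)
      (fun ρ hρ => (hGd ρ (by linarith [mem_Ici.1 hρ])).continuousAt.continuousWithinAt)
      (fun ρ hρ => ?_) fun ρ hρ => ?_
    all_goals
      rw [interior_Ici] at hρ
      have hρ : ρ₀ < ρ := hρ
      have hρ0 : 0 < ρ := by linarith
    · exact (hGd ρ hρ0).differentiableAt.differentiableWithinAt
    · rw [(hGd ρ hρ0).deriv]
      have h1 : (d + 1) * C ≤ ε * ρ := by
        have := (le_max_right 1 ((d + 1) * C / ε)).trans hρ.le
        rwa [div_le_iff₀ hε, mul_comm ρ] at this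
      have h2 := mul_oddPow_self_eq hp (w ρ)
      have h3 := abs_le.1 (hprod ρ hρ0.le)
      have h4 := hE ρ hρ0.le
      have h5 := powPrimitive_nonneg hp (w ρ)
      have e1 : 2 * (w' ρ * (w'' ρ + oddPow p (w ρ)))
          + ((w' ρ * w' ρ + w ρ * w'' ρ) * ρ - w ρ * w' ρ * 1) / ρ ^ 2 + ε * ρ⁻¹
          = (-((2 * d - 1) * w' ρ ^ 2) * ρ - (p + 1) * powPrimitive p (w ρ) * ρ
            - (d + 1) * (w ρ * w' ρ) + ε * ρ) / ρ ^ 2 := by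
        have h6 := h.eqn ρ
        field_simp
        linear_combination (2 * w' ρ * ρ + w ρ) * h6 - ρ * h2
      rw [e1]
      refine div_nonpos_of_nonpos_of_nonneg ?_ (by positivity)
      have h7 : -((d + 1) * (w ρ * w' ρ)) ≤ (d + 1) * C := by nlinarith
      -- `d ≥ 1` gives `2d - 1 ≥ 1`; together with `p + 1 ≥ 2` the dissipation is at least `2E ≥
      -- 2ε`, and one `ε` remains for the error term.
      have h8 : w' ρ ^ 2 ≤ (2 * d - 1) * w' ρ ^ 2 := by nlinarith [sq_nonneg (w' ρ)]
      have h9 : 2 * powPrimitive p (w ρ) ≤ (p + 1) * powPrimitive p (w ρ) := by nlinarith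
      have h10 : 2 * ε ≤ (2 * d - 1) * w' ρ ^ 2 + (p + 1) * powPrimitive p (w ρ) := by linarith
      nlinarith [mul_le_mul_of_nonneg_right h10 hρ0.le]
  have hlog : Tendsto (fun ρ => ε * Real.log ρ) atTop atTop :=
    Real.tendsto_log_atTop.const_mul_atTop hε
  obtain ⟨ρ, hρ, hρG⟩ := ((eventually_ge_atTop ρ₀).and
    (hlog.eventually_gt_atTop (G ρ₀ + C))).exists
  have h1 := hanti (mem_Ici.2 le_rfl) (mem_Ici.2 hρ) hρ
  have hρ0 : 1 ≤ ρ := hρ1.trans hρ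
  have h2 : -C ≤ w ρ * w' ρ / ρ := by
    rw [le_div_iff₀ (by linarith)]
    nlinarith [(abs_le.1 (hprod ρ (by linarith))).1]
  have h3 := powPrimitive_nonneg hp (w ρ)
  have h4 : G ρ = 2 * (w' ρ ^ 2 / 2 + powPrimitive p (w ρ)) + w ρ * w' ρ / ρ
    + ε * Real.log ρ := rfl
  nlinarith [sq_nonneg (w' ρ)]

/-- A nonincreasing energy that becomes arbitrarily small tends to `0`, and it dominates
`|w|^(p+1)/(p+1)`. For `d = 0` there is no friction and the energy is conserved. -/
lemma tendsto_zero (h : IsRadialSolution d p w w' w'') (hp : 1 < p) (hd : 1 ≤ d)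
    (hb : ∀ ρ, 0 ≤ ρ → |w ρ| ≤ 1) : Tendsto w atTop (𝓝 0) := by
  have hpow : Tendsto (fun ρ => |w ρ| ^ (p + 1)) atTop (𝓝 0) := by
    refine Metric.tendsto_atTop.2 fun ε hε => ?_
    have hp0 : 0 < p + 1 := by linarith
    obtain ⟨ρ₀, hρ₀, hlt⟩ := h.exists_energy_lt hp hd hb (div_pos hε hp0)
    refine ⟨ρ₀, fun ρ hρ => ?_⟩
    have h1 := h.antitoneOn_energy hp (mem_Ici.2 hρ₀) (mem_Ici.2 (hρ₀.trans hρ)) hρ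
    simp only [powPrimitive] at h1 hlt
    have h2 : |w ρ| ^ (p + 1) / (p + 1) < ε / (p + 1) := by nlinarith [sq_nonneg (w' ρ)]
    rw [dist_zero_right, Real.norm_of_nonneg (Real.rpow_nonneg (abs_nonneg _) _)]
    exact (div_lt_div_iff_of_pos_right hp0).1 h2
  have hroot := hpow.rpow_const (p := (p + 1)⁻¹) (Or.inr (by positivity))
  rw [Real.zero_rpow (inv_pos.2 (by linarith)).ne'] at hroot
  refine tendsto_zero_iff_abs_tendsto_zero _ |>.2 (hroot.congr fun ρ => ?_)
  exact Real.rpow_rpow_inv (abs_nonneg _) (by linarith)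

/-- The Pohozaev functional. -/
noncomputable def pohozaev (d : ℕ) (p : ℝ) (w w' : ℝ → ℝ) (ρ : ℝ) : ℝ :=
  ρ ^ d * (ρ * (w' ρ ^ 2 / 2 + powPrimitive p (w ρ)) + (d - 1) / 2 * (w ρ * w' ρ))

lemma pohozaev_zero (h : IsRadialSolution d p w w' w'') : pohozaev d p w w' 0 = 0 := by
  simp [pohozaev, h.deriv_zero]

/-- The multiple `(d-1)/2` of `w w'` is the one that cancels all `w'²` terms. The remaining
coefficient is `N/(p+1) - (N-2)/2` with `N = d + 1`, which changes sign at the critical exponent. -/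
lemma hasDerivAt_pohozaev (h : IsRadialSolution d p w w' w'') (hp : 1 < p) {ρ : ℝ} (hρ : 0 < ρ) :
    HasDerivAt (pohozaev d p w w')
      (((d + 1) / (p + 1) - (d - 1) / 2) * ρ ^ d * |w ρ| ^ (p + 1)) ρ := by
  have h1 := (hasDerivAt_pow d ρ).mul (((hasDerivAt_id ρ).mul (h.hasDerivAt_energy hp ρ)).add
    (((h.hasDerivAt ρ).mul (h.hasDerivAt' ρ)).const_mul ((d - 1 : ℝ) / 2)))
  refine h1.congr_deriv ?_
  -- For `d = 0` the truncated exponent `d - 1` is harmless, since both sides vanish.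
  have h2 : (d : ℝ) * ρ ^ (d - 1) = ρ ^ d * (d / ρ) := by
    rcases d with _ | d
    · simp
    · simp only [Nat.add_sub_cancel, pow_succ]; field_simp
  have h3 := mul_oddPow_self hp (w ρ)
  have h4 := h.eqn ρ
  rw [h2]
  simp only [id, Pi.mul_apply, Pi.add_apply, powPrimitive]
  have hp1 : p + 1 ≠ 0 := by linarith
  have h5 : ρ * w'' ρ = -(d * w' ρ) - ρ * oddPow p (w ρ) := by linarith
  have h6 : w'' ρ = -(d * w' ρ) / ρ - oddPow p (w ρ) := by field_simp; linarith
  rw [h6, ← h3]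
  field_simp
  ring

lemma continuous_pohozaev (h : IsRadialSolution d p w w' w'') (hp : 1 < p) :
    Continuous (pohozaev d p w w') := by
  have h1 := h.continuous
  have h2 := h.continuous'
  have h3 : Continuous (powPrimitive p) :=
    continuous_iff_continuousAt.2 fun x => (hasDerivAt_powPrimitive hp x).continuousAt
  unfold pohozaev
  fun_prop

lemma pohozaev_coeff_pos {p : ℝ} (hp : 1 < p) (hsub : ((d : ℝ) - 1) * (p - 1) < 4) :
    0 < ((d : ℝ) + 1) / (p + 1) - (d - 1) / 2 := by
  rw [sub_pos, lt_div_iff₀ (by linarith)]; nlinarith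

lemma pohozaev_coeff_nonpos {p : ℝ} (hp : 1 < p) (hsup : 4 ≤ ((d : ℝ) - 1) * (p - 1)) :
    ((d : ℝ) + 1) / (p + 1) - (d - 1) / 2 ≤ 0 := by
  rw [sub_nonpos, div_le_iff₀ (by linarith)]; nlinarith

/-- In the non-subcritical range, a radial solution that decreases as long as it is positive stays
positive. -/
lemma pos_of_supercritical (h : IsRadialSolution d p w w' w'') (hp : 1 < p)
    (hsup : 4 ≤ ((d : ℝ) - 1) * (p - 1)) (h0 : 0 < w 0)
    (hneg : ∀ ρ, 0 < ρ → (∀ t ∈ Ico 0 ρ, 0 < w t) → w' ρ < 0) {ρ : ℝ} (hρ : 0 ≤ ρ) : 0 < w ρ := by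
  by_contra hc
  obtain ⟨z, hz, -, hwz, hpos⟩ := exists_first_zero h.continuous h0 hρ (not_lt.1 hc)
  have hanti : AntitoneOn (pohozaev d p w w') (Ici 0) := by
    refine antitoneOn_of_deriv_nonpos (convex_Ici 0) (h.continuous_pohozaev hp).continuousOn
      (fun ρ hρ => ?_) fun ρ hρ => ?_
    all_goals
      rw [interior_Ici] at hρ
      have hρ : 0 < ρ := hρ
    · exact (h.hasDerivAt_pohozaev hp hρ).differentiableAt.differentiableWithinAt
    · rw [(h.hasDerivAt_pohozaev hp hρ).deriv]
      exact mul_nonpos_of_nonpos_of_nonneg (mul_nonpos_of_nonpos_of_nonneg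
        (pohozaev_coeff_nonpos hp hsup) (by positivity)) (Real.rpow_nonneg (abs_nonneg _) _)
  have h1 := hanti (mem_Ici.2 le_rfl) (mem_Ici.2 hz.le) hz.le
  rw [h.pohozaev_zero] at h1
  have h2 := hneg z hz hpos
  -- At a first zero the functional reduces to `z^(d+1) w'(z)²/2 > 0`, while it starts at `0` and
  -- does not increase.
  have h3 : 0 < pohozaev d p w w' z := by
    rw [pohozaev, hwz, zero_mul, mul_zero, add_zero]
    have h4 := powPrimitive_nonneg hp 0
    have h5 : 0 < w' z ^ 2 := by nlinarith
    positivity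
  linarith

/-- The functional starts at `0`, is nondecreasing, and is strictly increasing near `0` because
`w(0) ≠ 0`. -/
lemma exists_pohozaev_ge (h : IsRadialSolution d p w w' w'') (hp : 1 < p)
    (hsub : ((d : ℝ) - 1) * (p - 1) < 4) (h0 : w 0 ≠ 0) :
    ∃ δ > 0, ∃ ε > 0, ∀ ρ, δ ≤ ρ → ε ≤ pohozaev d p w w' ρ := by
  have hκ := pohozaev_coeff_pos hp hsub
  obtain ⟨δ, hδ, hne⟩ : ∃ δ > 0, ∀ ρ ∈ Icc 0 δ, w ρ ≠ 0 := by
    obtain ⟨δ, hδ, hb⟩ := Metric.eventually_nhds_iff.1 (h.continuous.continuousAt.eventually_ne h0)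
    refine ⟨δ / 2, by positivity, fun ρ hρ => hb ?_⟩
    rw [Real.dist_eq, sub_zero, abs_of_nonneg hρ.1]
    linarith [hρ.2]
  have hmono : MonotoneOn (pohozaev d p w w') (Ici 0) := by
    refine monotoneOn_of_deriv_nonneg (convex_Ici 0) (h.continuous_pohozaev hp).continuousOn
      (fun ρ hρ => ?_) fun ρ hρ => ?_
    all_goals
      rw [interior_Ici] at hρ
      have hρ : 0 < ρ := hρ
    · exact (h.hasDerivAt_pohozaev hp hρ).differentiableAt.differentiableWithinAt
    · rw [(h.hasDerivAt_pohozaev hp hρ).deriv]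
      exact mul_nonneg (by positivity) (Real.rpow_nonneg (abs_nonneg _) _)
  have hstrict : StrictMonoOn (pohozaev d p w w') (Icc 0 δ) := by
    refine strictMonoOn_of_deriv_pos (convex_Icc 0 δ) (h.continuous_pohozaev hp).continuousOn
      fun ρ hρ => ?_
    rw [interior_Icc] at hρ
    have hρ0 : 0 < ρ := hρ.1
    rw [(h.hasDerivAt_pohozaev hp hρ.1).deriv]
    have := Real.rpow_pos_of_pos (abs_pos.2 (hne ρ ⟨hρ.1.le, hρ.2.le⟩)) (p + 1)
    positivity
  refine ⟨δ, hδ, pohozaev d p w w' δ, ?_, fun ρ hρ =>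
    hmono (mem_Ici.2 hδ.le) (mem_Ici.2 (hδ.le.trans hρ)) hρ⟩
  have := hstrict ⟨le_rfl, hδ.le⟩ ⟨hδ.le, le_rfl⟩ hδ
  rwa [h.pohozaev_zero] at this

end IsRadialSolution

/-! ### Flux estimates and oscillation in the subcritical range -/

namespace IsRadialSolution

variable {d : ℕ} {p : ℝ} {w w' w'' : ℝ → ℝ}

lemma hasDerivAt_flux (h : IsRadialSolution d p w w' w'') {ρ : ℝ} (hρ : 0 < ρ) :
    HasDerivAt (fun ρ => ρ ^ d * w' ρ) (-(ρ ^ d * oddPow p (w ρ))) ρ := by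
  refine ((hasDerivAt_pow d ρ).mul (h.hasDerivAt' ρ)).congr_deriv ?_
  have h2 : (d : ℝ) * ρ ^ (d - 1) = ρ ^ d * (d / ρ) := by
    rcases d with _ | d
    · simp
    · simp only [Nat.add_sub_cancel, pow_succ]; field_simp
  rw [h2]
  have h3 : w'' ρ = -(d * w' ρ) / ρ - oddPow p (w ρ) := by
    field_simp; linear_combination h.eqn ρ
  rw [h3]
  field_simp
  ring

/-- Comparison of the flux `ρᵈ w'` with the flux of a constant source. -/
lemma antitoneOn_flux_add (h : IsRadialSolution d p w w' w'') {a b c : ℝ} (ha : 0 < a)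
    (hc : ∀ ρ ∈ Ioo a b, c ≤ oddPow p (w ρ)) :
    AntitoneOn (fun ρ => ρ ^ d * w' ρ + c * ρ ^ (d + 1) / (d + 1)) (Icc a b) := by
  have hder : ∀ ρ, 0 < ρ → HasDerivAt (fun ρ => ρ ^ d * w' ρ + c * ρ ^ (d + 1) / (d + 1))
      (-(ρ ^ d * oddPow p (w ρ)) + ρ ^ d * c) ρ := fun ρ hρ => by
    refine ((h.hasDerivAt_flux hρ).add
      (((hasDerivAt_pow (d + 1) ρ).const_mul c).div_const _)).congr_deriv ?_
    push_cast
    field_simp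
  refine antitoneOn_of_deriv_nonpos (convex_Icc a b)
    (fun ρ hρ => (hder ρ (ha.trans_le hρ.1)).continuousAt.continuousWithinAt)
    (fun ρ hρ => ?_) fun ρ hρ => ?_
  all_goals rw [interior_Icc] at hρ
  · exact (hder ρ (ha.trans hρ.1)).differentiableAt.differentiableWithinAt
  · rw [(hder ρ (ha.trans hρ.1)).deriv]
    have := mul_le_mul_of_nonneg_left (hc ρ hρ) (pow_nonneg (ha.trans hρ.1).le d)
    linarith

lemma antitoneOn_flux (h : IsRadialSolution d p w w' w'') {a : ℝ} (ha : 0 < a)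
    (hw : ∀ ρ, a ≤ ρ → 0 ≤ w ρ) : AntitoneOn (fun ρ => ρ ^ d * w' ρ) (Ici a) := by
  intro x hx y hy hxy
  have := h.antitoneOn_flux_add (b := y) (c := 0) ha (fun ρ hρ =>
    mul_nonneg (Real.rpow_nonneg (abs_nonneg _) _) (hw ρ hρ.1.le)) ⟨hx, hxy⟩ ⟨hy, le_rfl⟩ hxy
  simpa using this

/-- If `w' > 0` throughout, then `w` stays above a positive constant, and this source drives the
flux `ρᵈ w'` below zero. -/
lemma exists_deriv_nonpos (h : IsRadialSolution d p w w' w'') (hp : 1 < p) {a : ℝ} (ha : 1 ≤ a)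
    (hw : ∀ ρ, a ≤ ρ → 0 ≤ w ρ) : ∃ ρ, a ≤ ρ ∧ w' ρ ≤ 0 := by
  by_contra! hpos
  have hmono : StrictMonoOn w (Ici a) :=
    strictMonoOn_of_deriv_pos (convex_Ici a) h.continuous.continuousOn fun ρ hρ => by
      rw [interior_Ici] at hρ
      rw [(h.hasDerivAt ρ).deriv]; exact hpos ρ (mem_Ioi.1 hρ).le
  have hc : 0 < w (a + 1) := (hw a le_rfl).trans_lt
    (hmono (mem_Ici.2 le_rfl) (mem_Ici.2 (by linarith)) (by linarith))
  set c := oddPow p (w (a + 1)) with hcdef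
  have hc0 : 0 < c := oddPow_pos hc
  have hd : (0 : ℝ) < d + 1 := by positivity
  set K := (a + 1) ^ d * w' (a + 1) + c * (a + 1) ^ (d + 1) / (d + 1) with hK
  set b := max (a + 1) (K * (d + 1) / c + 1) with hb
  have hab : a + 1 ≤ b := le_max_left _ _
  have h1 := h.antitoneOn_flux_add (a := a + 1) (b := b) (c := c) (by linarith) (fun ρ hρ => by
    have h2 : w (a + 1) ≤ w ρ := (hmono (mem_Ici.2 (by linarith))
      (mem_Ici.2 (by linarith [hρ.1])) hρ.1).le
    rw [hcdef, oddPow_of_pos hc, oddPow_of_pos (hc.trans_le h2)]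
    exact Real.rpow_le_rpow hc.le h2 (by linarith)) ⟨le_rfl, hab⟩ ⟨hab, le_rfl⟩ hab
  have h3 : 0 ≤ b ^ d * w' b := mul_nonneg (pow_nonneg (by linarith) d)
    (hpos b (by linarith)).le
  have h4 : b ≤ b ^ (d + 1) := le_self_pow₀ (by linarith) (by omega)
  have h5 : K * (d + 1) / c < b := (by linarith : K * (d + 1) / c < K * (d + 1) / c + 1).trans_le
    (le_max_right _ _)
  rw [div_lt_iff₀ hc0] at h5
  have h6 : c * b ^ (d + 1) / (d + 1) ≤ K := by simp only at h1; linarith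
  rw [div_le_iff₀ hd] at h6
  nlinarith

/-- Decay rate of positive nonincreasing radial solutions. -/
lemma exists_decay (h : IsRadialSolution d p w w' w'') (hp : 1 < p) {a : ℝ} (ha : 1 ≤ a)
    (hw : ∀ ρ, a ≤ ρ → 0 < w ρ) (hw' : ∀ ρ, a ≤ ρ → w' ρ ≤ 0) :
    ∃ C > 0, ∀ ρ, 4 * a ≤ ρ → w ρ ^ (p - 1) * ρ ^ 2 ≤ C := by
  have hd : (0 : ℝ) < d + 1 := by positivity
  have hanti : AntitoneOn w (Ici a) :=
    antitoneOn_of_deriv_nonpos (convex_Ici a) h.continuous.continuousOn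
      (fun ρ _ => (h.hasDerivAt ρ).differentiableAt.differentiableWithinAt) fun ρ hρ => by
        rw [interior_Ici] at hρ
        rw [(h.hasDerivAt ρ).deriv]; exact hw' ρ (mem_Ioi.1 hρ).le
  -- Since `w` is nonincreasing, on `[a, ρ]` the source is at least the constant `w(ρ)^p`. The
  -- condition `ρ ≥ 2a` keeps at least half of the `ρ^(d+1)` term.
  have hslope : ∀ ρ, 2 * a ≤ ρ → w' ρ ≤ -(1 / (2 * (d + 1)) * ρ * w ρ ^ p) := fun ρ hρ => by
    have haρ : a ≤ ρ := by linarith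
    have hρ0 : 0 < ρ := by linarith
    have h1 := h.antitoneOn_flux_add (a := a) (b := ρ) (c := w ρ ^ p) (by linarith)
      (fun σ hσ => by
        rw [oddPow_of_pos (hw σ hσ.1.le)]
        exact Real.rpow_le_rpow (hw ρ haρ).le (hanti (mem_Ici.2 hσ.1.le) (mem_Ici.2 haρ) hσ.2.le)
          (by linarith)) ⟨le_rfl, haρ⟩ ⟨haρ, le_rfl⟩ haρ
    simp only at h1
    have hwp : 0 < w ρ ^ p := Real.rpow_pos_of_pos (hw ρ haρ) p
    have h2 : a ^ d * w' a ≤ 0 :=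
      mul_nonpos_of_nonneg_of_nonpos (by positivity) (hw' a le_rfl)
    have h3 : 2 * a ^ (d + 1) ≤ ρ ^ (d + 1) := by
      have h4 : (2 * a) ^ (d + 1) ≤ ρ ^ (d + 1) := pow_le_pow_left₀ (by linarith) hρ _
      have h5 : (2 : ℝ) ≤ 2 ^ (d + 1) := le_self_pow₀ (by norm_num) (by omega)
      rw [mul_pow] at h4
      have : 0 < a ^ (d + 1) := by positivity
      nlinarith
    have h6 : ρ ^ d * w' ρ ≤ ρ ^ d * (-(1 / (2 * (d + 1)) * ρ * w ρ ^ p)) := by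
      have e1 : ρ ^ d * (-(1 / (2 * (d + 1)) * ρ * w ρ ^ p))
          = -(w ρ ^ p * ρ ^ (d + 1) / (d + 1)) + w ρ ^ p * (ρ ^ (d + 1) / 2) / (d + 1) := by
        field_simp; ring
      have h7 : w ρ ^ p * a ^ (d + 1) / (d + 1) ≤ w ρ ^ p * (ρ ^ (d + 1) / 2) / (d + 1) := by
        gcongr; linarith
      rw [e1]; linarith
    exact le_of_mul_le_mul_left h6 (by positivity)
  set c : ℝ := 1 / (2 * (d + 1)) with hc
  have hc0 : 0 < c := by positivity
  have hp1 : 0 < p - 1 := by linarith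
  have hder : ∀ ρ, 2 * a ≤ ρ → HasDerivAt (fun ρ => w ρ ^ (1 - p) - (p - 1) * c / 2 * ρ ^ 2)
      (w' ρ * (1 - p) * w ρ ^ (1 - p - 1) - (p - 1) * c / 2 * (2 * ρ)) ρ := fun ρ hρ => by
    refine (((h.hasDerivAt ρ).rpow_const (Or.inl (hw ρ (by linarith)).ne')).sub
      ((hasDerivAt_pow 2 ρ).const_mul _)).congr_deriv ?_
    push_cast; ring
  -- This integrates the differential inequality `w' ≤ -c ρ w^p`.
  have hmono : MonotoneOn (fun ρ => w ρ ^ (1 - p) - (p - 1) * c / 2 * ρ ^ 2) (Ici (2 * a)) := by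
    refine monotoneOn_of_deriv_nonneg (convex_Ici _)
      (fun ρ hρ => (hder ρ hρ).continuousAt.continuousWithinAt) (fun ρ hρ => ?_) fun ρ hρ => ?_
    all_goals
      rw [interior_Ici] at hρ
      have hρ : 2 * a ≤ ρ := (mem_Ioi.1 hρ).le
    · exact (hder ρ hρ).differentiableAt.differentiableWithinAt
    · rw [(hder ρ hρ).deriv]
      have hwρ := hw ρ (by linarith)
      have e1 : w ρ ^ p * w ρ ^ (1 - p - 1) = 1 := by
        rw [← Real.rpow_add hwρ]; simp
      have h1 := mul_le_mul_of_nonneg_right (hslope ρ hρ) (Real.rpow_nonneg hwρ.le (1 - p - 1))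
      have h2 : w' ρ * w ρ ^ (1 - p - 1) ≤ -(c * ρ) := by
        calc _ ≤ _ := h1
          _ = -(c * ρ) * (w ρ ^ p * w ρ ^ (1 - p - 1)) := by ring
          _ = _ := by rw [e1, mul_one]
      nlinarith
  -- For `ρ ≥ 4a` the difference `ρ² - (2a)²` is at least `ρ²/2`, so `w^(1-p) ≥ (p-1) c ρ²/4`.
  refine ⟨4 / ((p - 1) * c), by positivity, fun ρ hρ => ?_⟩
  have h1 := hmono (mem_Ici.2 le_rfl) (mem_Ici.2 (by linarith)) (by linarith : 2 * a ≤ ρ)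
  simp only at h1
  have hwρ := hw ρ (by linarith)
  have h2 : 0 ≤ w (2 * a) ^ (1 - p) := Real.rpow_nonneg (hw _ (by linarith)).le _
  have h3 : (p - 1) * c / 4 * ρ ^ 2 ≤ w ρ ^ (1 - p) := by
    have h4 : 8 * a ^ 2 ≤ ρ ^ 2 := by nlinarith
    have h5 : 0 < (p - 1) * c := by positivity
    nlinarith
  have e1 : w ρ ^ (p - 1) * w ρ ^ (1 - p) = 1 := by
    rw [← Real.rpow_add hwρ]; simp
  rw [le_div_iff₀ (by positivity)]
  have h4 := mul_le_mul_of_nonneg_left h3 (Real.rpow_nonneg hwρ.le (p - 1))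
  rw [e1] at h4
  linarith

/-- An eventually nonnegative `w` is eventually positive and nonincreasing, hence `O(ρ^(-2/(p-1)))`.
The Pohozaev functional is then, at points of each interval `(ρ, 2ρ)` with `ρ` large, at most a
constant times `ρ^((d-1) - 4/(p-1))`. This tends to `0` exactly when `p` is subcritical,
contradicting the positive lower bound. -/
lemma not_eventually_nonneg (h : IsRadialSolution d p w w' w'') (hp : 1 < p)
    (hsub : ((d : ℝ) - 1) * (p - 1) < 4) (h0 : w 0 ≠ 0) : ¬ ∀ᶠ ρ in atTop, 0 ≤ w ρ := by
  intro hev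
  obtain ⟨δ, hδ, ε, hε, hP⟩ := h.exists_pohozaev_ge hp hsub h0
  obtain ⟨a₀, ha₀⟩ := eventually_atTop.1 hev
  set a₁ := max 1 (max a₀ δ) with ha₁
  have h1a : 1 ≤ a₁ := le_max_left _ _
  have hδa : δ ≤ a₁ := (le_max_right _ _).trans (le_max_right _ _)
  have hnn : ∀ ρ, a₁ ≤ ρ → 0 ≤ w ρ := fun ρ hρ =>
    ha₀ ρ (((le_max_left _ _).trans (le_max_right _ _)).trans hρ)
  obtain ⟨a, ha, hwa⟩ := h.exists_deriv_nonpos hp h1a hnn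
  have ha1 : 1 ≤ a := h1a.trans ha
  have hw' : ∀ ρ, a ≤ ρ → w' ρ ≤ 0 := fun ρ hρ => by
    have h1 := h.antitoneOn_flux (by linarith) hnn (mem_Ici.2 ha) (mem_Ici.2 (ha.trans hρ)) hρ
    simp only at h1
    have h2 : a ^ d * w' a ≤ 0 := mul_nonpos_of_nonneg_of_nonpos (by positivity) hwa
    by_contra hc
    push Not at hc
    have : 0 < ρ ^ d * w' ρ := mul_pos (pow_pos (by linarith) d) hc
    linarith
  have hanti : AntitoneOn w (Ici a) :=
    antitoneOn_of_deriv_nonpos (convex_Ici a) h.continuous.continuousOn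
      (fun ρ _ => (h.hasDerivAt ρ).differentiableAt.differentiableWithinAt) fun ρ hρ => by
        rw [interior_Ici] at hρ
        rw [(h.hasDerivAt ρ).deriv]; exact hw' ρ (mem_Ioi.1 hρ).le
  have hw : ∀ ρ, a ≤ ρ → 0 < w ρ := fun ρ hρ => by
    -- A zero would make the nonincreasing nonnegative `w` vanish from there on, and with it the
    -- Pohozaev functional.
    refine (hnn ρ (ha.trans hρ)).lt_of_ne fun hzero => ?_
    have hz : ∀ t, ρ ≤ t → w t = 0 := fun t ht => le_antisymm
      (hzero ▸ hanti (mem_Ici.2 hρ) (mem_Ici.2 (hρ.trans ht)) ht)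
      (hnn t (ha.trans (hρ.trans ht)))
    have hz' : w' (ρ + 1) = 0 := by
      refine (h.hasDerivAt (ρ + 1)).unique
        ((hasDerivAt_const (ρ + 1) (0 : ℝ)).congr_of_eventuallyEq ?_)
      filter_upwards [lt_mem_nhds (by linarith : ρ < ρ + 1)] with t ht using hz t ht.le
    have h1 := hP (ρ + 1) (by linarith)
    rw [pohozaev, hz', hz (ρ + 1) (by linarith), powPrimitive, abs_zero,
      Real.zero_rpow (by linarith)] at h1
    simp at h1
    linarith
  obtain ⟨C, hC, hdecay⟩ := h.exists_decay hp ha1 hw hw'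
  set A : ℝ := 2 ^ (d + 1) * (1 / 2 + C / (p + 1)) + 2 ^ d * |((d : ℝ) - 1) / 2| with hA
  have hp1 : 0 < p - 1 := by linarith
  have hpp : 0 < p + 1 := by linarith
  have hA0 : 0 < A := by positivity
  have hbound : ∀ ρ, 4 * a ≤ ρ → ε ≤ A * (ρ ^ (d + 1) * (w ρ / ρ) ^ 2) := fun ρ hρ => by
    have hρ0 : 0 < ρ := by linarith
    have haρ : a ≤ ρ := by linarith
    -- The mean value theorem on `[ρ, 2ρ]` supplies a point where `|w'| ≤ w(ρ)/ρ`; a bound on `w'`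
    -- at one point per interval is enough.
    obtain ⟨ξ, hξ, hslope⟩ := exists_hasDerivAt_eq_slope w w' (by linarith : ρ < 2 * ρ)
      h.continuous.continuousOn fun t _ => h.hasDerivAt t
    have hξ1 : ρ < ξ := hξ.1
    have hξ2 : ξ < 2 * ρ := hξ.2
    have hξ0 : 0 < ξ := by linarith
    set m := w ρ / ρ with hm
    have hwm : w ρ = m * ρ := by rw [hm]; field_simp
    have hm0 : 0 < m := div_pos (hw ρ haρ) hρ0
    have hwξ : w ξ ≤ m * ρ := hwm ▸ hanti (mem_Ici.2 haρ) (mem_Ici.2 (by linarith)) hξ1.le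
    have hwξ0 : 0 < w ξ := hw ξ (by linarith)
    have hw'ξ : |w' ξ| ≤ m := by
      rw [abs_of_nonpos (hw' ξ (by linarith)), hslope, ← neg_div, div_le_iff₀ (by linarith)]
      have := hw (2 * ρ) (by linarith)
      nlinarith
    -- Split `|w|^(p+1) = |w|^(p-1) w²` and spend the decay rate on the first factor, which makes
    -- this term comparable to `w'²`.
    have hFξ : powPrimitive p (w ξ) ≤ C * m ^ 2 / (p + 1) := by
      rw [powPrimitive, abs_of_pos hwξ0]
      gcongr
      have e1 : (m * ρ) ^ (p + 1) = (m * ρ) ^ (p - 1) * (m * ρ) ^ 2 := by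
        rw [← Real.rpow_add_natCast (by positivity)]; congr 1; push_cast; ring
      have h3 := hdecay ρ hρ
      rw [hwm] at h3
      calc w ξ ^ (p + 1) ≤ (m * ρ) ^ (p + 1) := Real.rpow_le_rpow hwξ0.le hwξ (by linarith)
        _ = ((m * ρ) ^ (p - 1) * ρ ^ 2) * m ^ 2 := by rw [e1]; ring
        _ ≤ C * m ^ 2 := by gcongr
    have hsq : w' ξ ^ 2 ≤ m ^ 2 := by
      rw [← sq_abs]; exact pow_le_pow_left₀ (abs_nonneg _) hw'ξ 2
    have hcross : ((d : ℝ) - 1) / 2 * (w ξ * w' ξ) ≤ |((d : ℝ) - 1) / 2| * (m * ρ * m) := by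
      refine (le_abs_self _).trans ?_
      rw [abs_mul, abs_mul, abs_of_pos hwξ0]
      gcongr
    have hF0 := powPrimitive_nonneg hp (w ξ)
    calc ε ≤ pohozaev d p w w' ξ := hP ξ (by linarith)
      _ ≤ ξ ^ d * (ξ * (m ^ 2 / 2 + C * m ^ 2 / (p + 1)) + |((d : ℝ) - 1) / 2| * (m * ρ * m)) := by
          unfold pohozaev
          gcongr
      _ ≤ (2 * ρ) ^ d * ((2 * ρ) * (m ^ 2 / 2 + C * m ^ 2 / (p + 1))
            + |((d : ℝ) - 1) / 2| * (m * ρ * m)) := by gcongr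
      _ = _ := by rw [hA, mul_pow]; ring
  set e : ℝ := 4 / (p - 1) - (d - 1) with he
  have he0 : 0 < e := by
    rw [he, sub_pos, lt_div_iff₀ hp1]; exact hsub
  have hlim : Tendsto (fun ρ : ℝ => A * C ^ (2 / (p - 1)) * ρ ^ (-e)) atTop (𝓝 0) := by
    simpa using (tendsto_rpow_neg_atTop he0).const_mul (A * C ^ (2 / (p - 1)))
  obtain ⟨ρ, hρ, hlt⟩ := ((eventually_ge_atTop (4 * a)).and (hlim.eventually_lt_const hε)).exists
  have hρ0 : 0 < ρ := by linarith
  have hwρ : 0 < w ρ := hw ρ (by linarith)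
  refine absurd (hbound ρ hρ) (not_le.2 (lt_of_le_of_lt ?_ hlt))
  rw [mul_assoc A]
  refine mul_le_mul_of_nonneg_left ?_ hA0.le
  have h1 : w ρ ^ (p - 1) ≤ C / ρ ^ 2 := by
    rw [le_div_iff₀ (by positivity)]; exact hdecay ρ hρ
  have h2 : w ρ ^ 2 ≤ (C / ρ ^ 2) ^ (2 / (p - 1)) := by
    calc w ρ ^ 2 = (w ρ ^ (p - 1)) ^ (2 / (p - 1)) := by
          rw [← Real.rpow_mul hwρ.le, mul_div_cancel₀ _ hp1.ne', Real.rpow_ofNat]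
      _ ≤ _ := Real.rpow_le_rpow (Real.rpow_nonneg hwρ.le _) h1 (by positivity)
  have e1 : (C / ρ ^ 2) ^ (2 / (p - 1)) = C ^ (2 / (p - 1)) * ρ ^ (-(4 / (p - 1))) := by
    rw [Real.div_rpow hC.le (by positivity), ← Real.rpow_natCast ρ 2, ← Real.rpow_mul hρ0.le,
      Real.rpow_neg hρ0.le, div_eq_mul_inv]
    congr 3; push_cast; ring
  have e2 : ρ ^ (d + 1) * (w ρ / ρ) ^ 2 = ρ ^ ((d : ℝ) - 1) * w ρ ^ 2 := by
    rw [Real.rpow_sub_one hρ0.ne', Real.rpow_natCast]; field_simp; ring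
  calc ρ ^ (d + 1) * (w ρ / ρ) ^ 2 = ρ ^ ((d : ℝ) - 1) * w ρ ^ 2 := e2
    _ ≤ ρ ^ ((d : ℝ) - 1) * (C ^ (2 / (p - 1)) * ρ ^ (-(4 / (p - 1)))) := by
        rw [← e1]; gcongr
    _ = C ^ (2 / (p - 1)) * (ρ ^ ((d : ℝ) - 1) * ρ ^ (-(4 / (p - 1)))) := by ring
    _ = _ := by rw [← Real.rpow_add hρ0]; congr 2; rw [he]; ring

end IsRadialSolution

/-! ### The maximal profile on the positive half-line -/

namespace IsMaximalProfile

variable {d : ℕ} {p R : ℝ} {v : ℝ → ℝ}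

/-- The equation is odd, so `not_eventually_nonneg` applies to `w` and to `-w` and excludes an
eventual sign of either kind. -/
lemma frequently_sign (h : IsMaximalProfile d p R v) (hp : 1 < p)
    (hsub : ((d : ℝ) - 1) * (p - 1) < 4) :
    (∃ᶠ r in atTop, 0 < v r) ∧ ∃ᶠ r in atTop, v r < 0 := by
  have hrad := h.isRadialSolution
  have hsq : Tendsto (fun ρ : ℝ => ρ ^ 2) atTop atTop := tendsto_pow_atTop two_ne_zero
  have h0 : v ((0 : ℝ) ^ 2) ≠ 0 := by simp [h.apply_zero]
  constructor <;> intro hev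
  · refine hrad.neg.not_eventually_nonneg hp hsub (by simpa using h0) ?_
    filter_upwards [hsq.eventually hev] with ρ hρ
    linarith
  · refine hrad.not_eventually_nonneg hp hsub h0 ?_
    filter_upwards [hsq.eventually hev] with ρ hρ
    linarith

lemma tendsto_zero (h : IsMaximalProfile d p R v) (hp : 1 < p) (hd : 1 ≤ d) :
    Tendsto v atTop (𝓝 0) := by
  have h1 := h.isRadialSolution.tendsto_zero hp hd fun ρ _ => h.abs_le_one _ (sq_nonneg ρ)
  refine (h1.comp Real.tendsto_sqrt_atTop).congr' ?_
  filter_upwards [eventually_ge_atTop 0] with r hr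
  simp [Real.sq_sqrt hr]

lemma pos_of_supercritical (h : IsMaximalProfile d p R v) (hp : 1 < p)
    (hsup : 4 ≤ ((d : ℝ) - 1) * (p - 1)) {r : ℝ} (hr : 0 ≤ r) : 0 < v r := by
  have h1 := h.isRadialSolution.pos_of_supercritical hp hsup (by simp [h.apply_zero])
    (fun ρ hρ hpos => ?_) (Real.sqrt_nonneg r)
  · simpa [Real.sq_sqrt hr] using h1
  · have h2 := h.deriv_neg (ρ ^ 2) (sq_nonneg ρ) fun t ht => by
      have := hpos (Real.sqrt t) ⟨Real.sqrt_nonneg t, by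
        rw [Real.sqrt_lt' hρ]; exact ht.2⟩
      rwa [Real.sq_sqrt ht.1] at this
    nlinarith

lemma deriv_neg_of_supercritical (h : IsMaximalProfile d p R v) (hp : 1 < p)
    (hsup : 4 ≤ ((d : ℝ) - 1) * (p - 1)) {r : ℝ} (hr : -R < r) : deriv v r < 0 := by
  rcases le_total r 0 with h0 | h0
  · exact h.deriv_neg_of_nonpos r hr h0
  · exact h.deriv_neg r h0 fun t ht => h.pos_of_supercritical hp hsup ht.1

end IsMaximalProfile

/-! ### Composition with a quadratic function -/

/-- A smooth function with the Taylor expansion `φ(z + t y) = φ(z) + t B(z, y) + t² C(y)`. -/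
structure IsQuadratic {E : Type*} [NormedAddCommGroup E] [NormedSpace ℝ E] (φ : E → ℝ)
    (B : E → E → ℝ) (C : E → ℝ) : Prop where
  contDiff : ContDiff ℝ 2 φ
  expand : ∀ z y (t : ℝ), φ (z + t • y) = φ z + t * B z y + t ^ 2 * C y

namespace IsQuadratic

variable {E : Type*} [NormedAddCommGroup E] [NormedSpace ℝ E] {φ : E → ℝ} {B : E → E → ℝ}
  {C : E → ℝ}

lemma differentiable (h : IsQuadratic φ B C) : Differentiable ℝ φ :=
  h.contDiff.differentiable (by norm_num)

lemma fderiv_apply (h : IsQuadratic φ B C) (z y : E) : fderiv ℝ φ z y = B z y := by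
  have h1 : HasLineDerivAt ℝ φ (fderiv ℝ φ z y) z y :=
    (h.differentiable z).hasFDerivAt.hasLineDerivAt y
  have h2 : HasDerivAt (fun t : ℝ => φ z + t * B z y + t ^ 2 * C y) (B z y) 0 := by
    refine ((((hasDerivAt_id (0 : ℝ)).mul_const (B z y)).const_add (φ z)).add
      ((hasDerivAt_pow 2 (0 : ℝ)).mul_const (C y))).congr_deriv (by simp)
  exact h1.unique (h2.congr_of_eventuallyEq (.of_forall fun t => h.expand z y t))

/-- Compare the expansions of `φ(z + (t+1) y)` about `z` and about `z + t y`. -/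
lemma bilin_add (h : IsQuadratic φ B C) (z y : E) (t : ℝ) :
    B (z + t • y) y = B z y + 2 * t * C y := by
  have h1 := h.expand (z + t • y) y 1
  have h2 := h.expand z y (t + 1)
  have h3 := h.expand z y t
  rw [add_assoc, ← add_smul] at h1
  linarith

lemma fderiv_fderiv_apply (h : IsQuadratic φ B C) (z y : E) :
    fderiv ℝ (fderiv ℝ φ) z y y = 2 * C y := by
  have hd : DifferentiableAt ℝ (fderiv ℝ φ) z :=
    (h.contDiff.fderiv_right (m := 1) (by norm_num)).differentiable (by norm_num) z
  have h1 : HasLineDerivAt ℝ (fun z => fderiv ℝ φ z y) (fderiv ℝ (fderiv ℝ φ) z y y) z y := by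
    have := (hd.hasFDerivAt.clm_apply (hasFDerivAt_const y z)).hasLineDerivAt y
    simpa using this
  have h2 : HasDerivAt (fun t : ℝ => B z y + 2 * t * C y) (2 * C y) 0 := by
    refine ((((hasDerivAt_id (0 : ℝ)).const_mul 2).mul_const (C y)).const_add (B z y)).congr_deriv
      (by simp)
  refine h1.unique (h2.congr_of_eventuallyEq (.of_forall fun t => ?_))
  simp only [h.fderiv_apply, h.bilin_add]

lemma fderiv_comp (h : IsQuadratic φ B C) {v : ℝ → ℝ} {z : E} (hv : DifferentiableAt ℝ v (φ z)) :
    fderiv ℝ (v ∘ φ) z = deriv v (φ z) • fderiv ℝ φ z :=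
  (hv.hasDerivAt.comp_hasFDerivAt z (h.differentiable z).hasFDerivAt).fderiv

/-- The d'Alembertian uses second derivatives only along repeated directions, so the expansion along
lines suffices and `B`, `C` need no linear structure. -/
lemma iteratedFDeriv_two_comp (h : IsQuadratic φ B C) {v : ℝ → ℝ} {z : E}
    (hv : ContDiffAt ℝ 2 v (φ z)) (y : E) :
    iteratedFDeriv ℝ 2 (v ∘ φ) z (fun _ => y)
      = deriv (deriv v) (φ z) * B z y ^ 2 + deriv v (φ z) * (2 * C y) := by
  rw [iteratedFDeriv_two_apply]
  have hev : fderiv ℝ (v ∘ φ) =ᶠ[𝓝 z] fun x => deriv v (φ x) • fderiv ℝ φ x := by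
    have h1 := h.contDiff.continuous.continuousAt.eventually (hv.eventually (by simp))
    filter_upwards [h1] with x hx using h.fderiv_comp (hx.differentiableAt (by norm_num))
  have hd : DifferentiableAt ℝ (fderiv ℝ φ) z :=
    (h.contDiff.fderiv_right (m := 1) (by norm_num)).differentiable (by norm_num) z
  have h2 := (hv.hasDerivAt_deriv.2.comp_hasFDerivAt z (h.differentiable z).hasFDerivAt).smul
    hd.hasFDerivAt
  rw [hev.fderiv_eq]
  erw [h2.fderiv]
  simp [h.fderiv_apply, h.fderiv_fderiv_apply]
  ring

end IsQuadratic

/-! ### The d'Alembertian on functions of one level function -/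

lemma Fin.card_filter_val_mem_Ico {n a b : ℕ} (hb : b ≤ n) :
    (Finset.univ.filter fun i : Fin n => a ≤ i.val ∧ i.val < b).card = b - a := by
  have : (Finset.univ.filter fun i : Fin n => a ≤ i.val ∧ i.val < b)
      = (Finset.Ico a b).attachFin fun i hi => (Finset.mem_Ico.1 hi).2.trans_le hb := by
    ext i; simp
  rw [this, Finset.card_attachFin, Nat.card_Ico]

lemma Fin.card_filter_val_lt' {n b : ℕ} (hb : b ≤ n) :
    (Finset.univ.filter fun i : Fin n => i.val < b).card = b := by
  simpa using Fin.card_filter_val_mem_Ico (a := 0) hb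

lemma Fin.sum_univ_eq_sum_castLE_add {s n : ℕ} (h : s ≤ n) (F : Fin n → ℝ) :
    ∑ j, F j = ∑ i : Fin s, F (Fin.castLE h i) + ∑ j : Fin n with s ≤ j.val, F j := by
  rw [← Finset.sum_filter_add_sum_filter_not Finset.univ fun j : Fin n => j.val < s]
  congr 1
  · symm
    refine Finset.sum_bij (fun i _ => Fin.castLE h i) (by simp) (by simp) (fun j hj => ?_) (by simp)
    exact ⟨⟨j.val, by simpa using hj⟩, by simp, rfl⟩
  · simp only [not_lt]

namespace SemiEuclidean

variable {m s : ℕ}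

lemma box_comp {φ : SemiEuclidean m s → ℝ} {B : SemiEuclidean m s → SemiEuclidean m s → ℝ}
    {C : SemiEuclidean m s → ℝ} (h : IsQuadratic φ B C) {v : ℝ → ℝ} {z : SemiEuclidean m s}
    (hv : ContDiffAt ℝ 2 v (φ z)) :
    box (v ∘ φ) z = deriv (deriv v) (φ z) * (-(∑ i : Fin s, B z (Pi.single i 1, 0) ^ 2)
        + ∑ j : Fin (m - s), B z (0, Pi.single j 1) ^ 2)
      + 2 * deriv v (φ z) * (-(∑ i : Fin s, C (Pi.single i 1, 0))
        + ∑ j : Fin (m - s), C (0, Pi.single j 1)) := by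
  simp only [box, h.iteratedFDeriv_two_comp hv, Finset.sum_add_distrib, ← Finset.mul_sum]
  ring

lemma contDiff_fst_apply (i : Fin s) : ContDiff ℝ 2 fun z : SemiEuclidean m s => z.1 i :=
  (contDiff_apply ℝ ℝ i).comp contDiff_fst

lemma contDiff_snd_apply (j : Fin (m - s)) : ContDiff ℝ 2 fun z : SemiEuclidean m s => z.2 j :=
  (contDiff_apply ℝ ℝ j).comp contDiff_snd

lemma isQuadratic_metric (a : SemiEuclidean m s) :
    IsQuadratic (metric a) (fun _ y => metric a y) fun _ => 0 where
  contDiff := (ContDiff.sum fun i _ => contDiff_const.mul (contDiff_fst_apply i)).neg.add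
    (ContDiff.sum fun j _ => contDiff_const.mul (contDiff_snd_apply j))
  expand z y t := by
    simp only [metric, Prod.fst_add, Prod.snd_add, Prod.smul_fst, Prod.smul_snd, Pi.add_apply,
      Pi.smul_apply, smul_eq_mul, mul_add, Finset.sum_add_distrib, mul_left_comm _ t,
      ← Finset.mul_sum]
    ring

lemma isQuadratic_ell (k n : ℕ) :
    IsQuadratic (ell (m := m) (s := s) k n)
      (fun z y => -(∑ i : Fin s with i.val < k, 2 * z.1 i * y.1 i)
        + ∑ j : Fin (m - s) with j.val < n, 2 * z.2 j * y.2 j) (ell k n) where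
  contDiff := (ContDiff.sum fun i _ => (contDiff_fst_apply i).pow 2).neg.add
    (ContDiff.sum fun j _ => (contDiff_snd_apply j).pow 2)
  expand z y t := by
    have h1 : ∀ {ι : Type} (S : Finset ι) (f g : ι → ℝ), ∑ i ∈ S, (f i + t * g i) ^ 2
        = ∑ i ∈ S, f i ^ 2 + t * ∑ i ∈ S, 2 * f i * g i + t ^ 2 * ∑ i ∈ S, g i ^ 2 := by
      intro ι S f g
      rw [Finset.mul_sum, Finset.mul_sum, ← Finset.sum_add_distrib, ← Finset.sum_add_distrib]
      exact Finset.sum_congr rfl fun i _ => by ring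
    simp only [ell, Prod.fst_add, Prod.snd_add, Prod.smul_fst, Prod.smul_snd, Pi.add_apply,
      Pi.smul_apply, smul_eq_mul, h1]
    ring

lemma isQuadratic_parabolic (h : s ≤ m - s) (ε : Fin s → ℝ) (ω : ℕ) :
    IsQuadratic (parabolic (m := m) h ε ω)
      (fun z y => (∑ i, 2 * (z.1 i + ε i * z.2 (Fin.castLE h i)) *
          (y.1 i + ε i * y.2 (Fin.castLE h i)))
        + 2 * ∑ j : Fin (m - s) with s ≤ j.val ∧ j.val < s + ω, y.2 j)
      (fun y => ∑ i, (y.1 i + ε i * y.2 (Fin.castLE h i)) ^ 2) where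
  contDiff := (ContDiff.sum fun i _ => ((contDiff_fst_apply i).add
      (contDiff_const.mul (contDiff_snd_apply _))).pow 2).add
    (contDiff_const.mul (ContDiff.sum fun j _ => contDiff_snd_apply j))
  expand z y t := by
    simp only [parabolic, Prod.fst_add, Prod.snd_add, Prod.smul_fst, Prod.smul_snd, Pi.add_apply,
      Pi.smul_apply, smul_eq_mul, Finset.sum_add_distrib, ← Finset.mul_sum]
    have h1 : ∑ i, (z.1 i + t * y.1 i + ε i * (z.2 (Fin.castLE h i) + t * y.2 (Fin.castLE h i))) ^ 2
        = ∑ i, (z.1 i + ε i * z.2 (Fin.castLE h i)) ^ 2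
        + t * ∑ i, 2 * (z.1 i + ε i * z.2 (Fin.castLE h i)) * (y.1 i + ε i * y.2 (Fin.castLE h i))
        + t ^ 2 * ∑ i, (y.1 i + ε i * y.2 (Fin.castLE h i)) ^ 2 := by
      rw [Finset.mul_sum, Finset.mul_sum, ← Finset.sum_add_distrib, ← Finset.sum_add_distrib]
      exact Finset.sum_congr rfl fun i _ => by ring
    rw [h1]
    ring

lemma box_comp_metric (a : SemiEuclidean m s) {v : ℝ → ℝ} {z : SemiEuclidean m s}
    (hv : ContDiffAt ℝ 2 v (metric a z)) :
    box (v ∘ metric a) z = metric a a * deriv (deriv v) (metric a z) := by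
  rw [box_comp (isQuadratic_metric a) hv]
  simp [metric, Pi.single_apply, ← sq]
  ring

/-- In `□ℓ` the minus signs of the metric and of `ℓ` cancel, so only `k + n` appears; in `⟨∇ℓ,∇ℓ⟩`
the gradient is squared, one sign survives, and the result is `4ℓ`. -/
lemma box_comp_ell {k n : ℕ} (hk : k ≤ s) (hn : n ≤ m - s) {v : ℝ → ℝ} {z : SemiEuclidean m s}
    (hv : ContDiffAt ℝ 2 v (ell k n z)) :
    box (v ∘ ell k n) z = 4 * ell k n z * deriv (deriv v) (ell k n z)
      + 2 * (k + n) * deriv v (ell k n z) := by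
  rw [box_comp (isQuadratic_ell k n) hv]
  have h1 : ∑ i : Fin s, ell (m := m) k n (Pi.single i 1, 0) = -k := by
    simp [ell, Pi.single_apply, Fin.card_filter_val_lt' hk]
  have h2 : ∑ j : Fin (m - s), ell (s := s) k n (0, Pi.single j 1) = n := by
    simp [ell, Pi.single_apply, Fin.card_filter_val_lt' hn]
  have h3 : ∀ i : Fin s, (-(∑ i' : Fin s with i'.val < k,
      2 * z.1 i' * (Pi.single i (1 : ℝ) : Fin s → ℝ) i')
      + ∑ j : Fin (m - s) with j.val < n, 2 * z.2 j * (0 : Fin (m - s) → ℝ) j) ^ 2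
      = if i.val < k then 4 * z.1 i ^ 2 else 0 := fun i => by
    simp only [Pi.single_apply, mul_ite, mul_one, mul_zero, Finset.sum_ite_eq', Finset.mem_filter,
      Finset.mem_univ, true_and, Pi.zero_apply, Finset.sum_const_zero]
    split_ifs <;> ring
  have h4 : ∀ j : Fin (m - s), (-(∑ i : Fin s with i.val < k, 2 * z.1 i * (0 : Fin s → ℝ) i)
      + ∑ j' : Fin (m - s) with j'.val < n,
        2 * z.2 j' * (Pi.single j (1 : ℝ) : Fin (m - s) → ℝ) j') ^ 2
      = if j.val < n then 4 * z.2 j ^ 2 else 0 := fun j => by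
    simp only [Pi.single_apply, mul_ite, mul_one, mul_zero, Finset.sum_ite_eq', Finset.mem_filter,
      Finset.mem_univ, true_and, Pi.zero_apply, Finset.sum_const_zero]
    split_ifs <;> ring
  rw [h1, h2]
  simp only [h3, h4, ← Finset.sum_filter, ← Finset.mul_sum]
  simp only [ell]
  ring

/-- The functions `tᵢ + εᵢ xᵢ` have null gradients because `εᵢ² = 1`, so the contributions of `tᵢ`
and `xᵢ` cancel at both orders. Only the `ω` linear terms remain, each contributing `2² = 4` to the
coefficient of `v''`. -/
lemma box_comp_parabolic (h : s ≤ m - s) {ε : Fin s → ℝ} {ω : ℕ} (hε : ∀ i, ε i = 1 ∨ ε i = -1)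
    (hω : ω ≤ m - 2 * s) {v : ℝ → ℝ} {z : SemiEuclidean m s}
    (hv : ContDiffAt ℝ 2 v (parabolic h ε ω z)) :
    box (v ∘ parabolic h ε ω) z = 4 * ω * deriv (deriv v) (parabolic h ε ω z) := by
  rw [box_comp (isQuadratic_parabolic h ε ω) hv]
  -- Separate the space coordinates paired with a time coordinate from the remaining ones.
  rw [Fin.sum_univ_eq_sum_castLE_add h, Fin.sum_univ_eq_sum_castLE_add h]
  have hε2 : ∀ i, ε i ^ 2 = 1 := fun i => by rcases hε i with h | h <;> rw [h] <;> norm_num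
  have hne : ∀ (i : Fin s) (j : Fin (m - s)), s ≤ j.val → Fin.castLE h i ≠ j := fun i j hj he => by
    have := congrArg Fin.val he
    simp only [Fin.val_castLE] at this
    omega
  have hS : ∀ i : Fin s, ¬ (s ≤ (Fin.castLE h i).val ∧ (Fin.castLE h i).val < s + ω) := fun i => by
    simp
  have h1 : ∀ i : Fin s, ∑ i' : Fin s, ((Pi.single i (1 : ℝ) : Fin s → ℝ) i'
      + ε i' * (0 : Fin (m - s) → ℝ) (Fin.castLE h i')) ^ 2 = 1 := fun i => by
    simp [Pi.single_apply]
  have h2 : ∀ i : Fin s, ∑ i' : Fin s, ((0 : Fin s → ℝ) i'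
      + ε i' * (Pi.single (Fin.castLE h i) (1 : ℝ) : Fin (m - s) → ℝ) (Fin.castLE h i')) ^ 2
      = 1 := fun i => by
    simp [Pi.single_apply, hε2]
  have h3 : ∀ j ∈ Finset.univ.filter fun j : Fin (m - s) => s ≤ j.val,
      ∑ i' : Fin s, ((0 : Fin s → ℝ) i'
        + ε i' * (Pi.single j (1 : ℝ) : Fin (m - s) → ℝ) (Fin.castLE h i')) ^ 2 = 0 := fun j hj => by
    simp only [Finset.mem_filter, Finset.mem_univ, true_and] at hj
    simp [hne _ j hj]
  obtain ⟨q, hq⟩ : ∃ q : Fin s → ℝ, ∀ i, z.1 i + ε i * z.2 (Fin.castLE h i) = q i :=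
    ⟨_, fun _ => rfl⟩
  have h4 : ∀ i : Fin s, ((∑ i' : Fin s, 2 * q i' * ((Pi.single i (1 : ℝ) : Fin s → ℝ) i'
      + ε i' * (0 : Fin (m - s) → ℝ) (Fin.castLE h i')))
      + 2 * ∑ j : Fin (m - s) with s ≤ j.val ∧ j.val < s + ω, (0 : Fin (m - s) → ℝ) j) ^ 2
      = 4 * q i ^ 2 := fun i => by
    simp [Pi.single_apply]; ring
  have h5 : ∀ i : Fin s, ((∑ i' : Fin s, 2 * q i' * ((0 : Fin s → ℝ) i'
      + ε i' * (Pi.single (Fin.castLE h i) (1 : ℝ) : Fin (m - s) → ℝ) (Fin.castLE h i')))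
      + 2 * ∑ j : Fin (m - s) with s ≤ j.val ∧ j.val < s + ω,
        (Pi.single (Fin.castLE h i) (1 : ℝ) : Fin (m - s) → ℝ) j) ^ 2
      = 4 * q i ^ 2 := fun i => by
    simp only [Pi.single_apply, Finset.sum_ite_eq', Finset.mem_filter, hS, and_false, if_false]
    simp
    linear_combination 4 * q i ^ 2 * hε2 i
  have h6 : ∀ j ∈ Finset.univ.filter fun j : Fin (m - s) => s ≤ j.val,
      ((∑ i' : Fin s, 2 * q i' * ((0 : Fin s → ℝ) i'
        + ε i' * (Pi.single j (1 : ℝ) : Fin (m - s) → ℝ) (Fin.castLE h i')))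
      + 2 * ∑ j' : Fin (m - s) with s ≤ j'.val ∧ j'.val < s + ω,
        (Pi.single j (1 : ℝ) : Fin (m - s) → ℝ) j') ^ 2
      = if j.val < s + ω then 4 else 0 := fun j hj => by
    simp only [Finset.mem_filter, Finset.mem_univ, true_and] at hj
    simp [Pi.single_apply, hne _ j hj, hj]
    split_ifs <;> norm_num
  simp only [hq, h1, h2, h4, h5]
  rw [Finset.sum_congr rfl h3, Finset.sum_congr rfl h6, ← Finset.sum_filter, Finset.filter_filter,
    Finset.sum_const, Fin.card_filter_val_mem_Ico (by omega)]
  simp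
  ring

/-! ### Nodal domains, values and critical points of the level functions -/

/-- If `V` changes sign arbitrarily far out and `ψ` takes all large values on `Ω`, then `V ∘ ψ` has
infinitely many nodal domains. -/
lemma isOscillating_comp {Ω : Set (SemiEuclidean m s)} {u ψ : SemiEuclidean m s → ℝ} {V : ℝ → ℝ}
    (hψ : Continuous ψ) (hu : ContinuousOn u Ω) (huV : ∀ z ∈ Ω, u z = V (ψ z))
    (hpos : ∃ᶠ r in atTop, 0 < V r) (hneg : ∃ᶠ r in atTop, V r < 0)
    (hsurj : ∀ r, 0 ≤ r → ∃ z ∈ Ω, ψ z = r) : IsOscillating Ω u := by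
  have hex : ∀ {P : ℝ → Prop}, (∃ᶠ r in atTop, P r) → ∀ b, ∃ r, b < r ∧ P r ∧ ∃ z ∈ Ω, ψ z = r :=
    fun hP b => by
      obtain ⟨r, hr, hb⟩ := (hP.and_eventually ((eventually_gt_atTop b).and
        (eventually_ge_atTop 0))).exists
      exact ⟨r, hb.1, hr, hsurj r hb.2⟩
  refine ⟨⟨?_, ?_⟩, fun hfin => ?_⟩
  · obtain ⟨r, -, hr, z, hz, rfl⟩ := hex hpos 0
    exact ⟨z, hz, by rwa [huV z hz]⟩
  · obtain ⟨r, -, hr, z, hz, rfl⟩ := hex hneg 0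
    exact ⟨z, hz, by rwa [huV z hz]⟩
  -- Choose a level `r` beyond `ψ z` where `V` has the opposite sign. If the connected set `C`
  -- reached past `r` it would contain a point at level `r`, and `u` would vanish somewhere in `C`.
  · have hbdd : ∀ C ∈ nodalDomains Ω u, BddAbove (ψ '' C) := by
      rintro C ⟨z, hz, rfl⟩
      set C := connectedComponentIn {y ∈ Ω | u y ≠ 0} z
      have hC : IsPreconnected C := isPreconnected_connectedComponentIn
      have hsub : C ⊆ {y ∈ Ω | u y ≠ 0} := connectedComponentIn_subset _ _
      have hzC : z ∈ C := mem_connectedComponentIn hz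
      have huC := (hC.image u (hu.mono fun y hy => (hsub hy).1)).ordConnected
      have hψC := (hC.image ψ hψ.continuousOn).ordConnected
      have h0 : (0 : ℝ) ∉ u '' C := by
        rintro ⟨y, hy, h⟩
        exact (hsub hy).2 h
      obtain ⟨r, hr, hsign⟩ : ∃ r, ψ z < r ∧ V r * u z < 0 := by
        rcases lt_or_gt_of_ne hz.2 with h | h
        · obtain ⟨r, hr, hVr, -⟩ := hex hpos (ψ z)
          exact ⟨r, hr, mul_neg_of_pos_of_neg hVr h⟩
        · obtain ⟨r, hr, hVr, -⟩ := hex hneg (ψ z)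
          exact ⟨r, hr, mul_neg_of_neg_of_pos hVr h⟩
      refine ⟨r, ?_⟩
      rintro _ ⟨y, hy, rfl⟩
      by_contra hc
      obtain ⟨x, hx, hxr⟩ := hψC.out ⟨z, hzC, rfl⟩ ⟨y, hy, rfl⟩ ⟨hr.le, (not_le.1 hc).le⟩
      rw [← hxr, ← huV x (hsub hx).1] at hsign
      rcases mul_neg_iff.1 hsign with h | h
      · exact h0 (huC.out ⟨z, hzC, rfl⟩ ⟨x, hx, rfl⟩ ⟨h.2.le, h.1.le⟩)
      · exact h0 (huC.out ⟨x, hx, rfl⟩ ⟨z, hzC, rfl⟩ ⟨h.1.le, h.2.le⟩)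
    -- Finitely many nodal domains would share one bound for `ψ`, yet `u ≠ 0` at points of larger
    -- level.
    obtain ⟨b, hb⟩ := (hfin.bddAbove_biUnion).2 hbdd
    obtain ⟨r, hr, hVr, z, hz, rfl⟩ := hex hpos b
    have hz' : z ∈ {y ∈ Ω | u y ≠ 0} := ⟨hz, by rw [huV z hz]; exact hVr.ne'⟩
    have := hb (mem_iUnion₂.2 ⟨_, ⟨z, hz', rfl⟩, ⟨z, mem_connectedComponentIn hz', rfl⟩⟩)
    linarith

lemma exists_ell_eq_of_nonneg {k n : ℕ} (hn : 1 ≤ n) (hns : n ≤ m - s) {r : ℝ} (hr : 0 ≤ r) :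
    ∃ z : SemiEuclidean m s, ell k n z = r := by
  refine ⟨(0, Pi.single ⟨0, by omega⟩ (Real.sqrt r)), ?_⟩
  simp [ell, Pi.single_apply, Real.sq_sqrt hr, Finset.sum_ite_eq', show 0 < n by omega]

lemma exists_ell_eq_of_nonpos {k n : ℕ} (hk : 1 ≤ k) (hks : k ≤ s) {r : ℝ} (hr : r ≤ 0) :
    ∃ z : SemiEuclidean m s, ell k n z = r := by
  refine ⟨(Pi.single ⟨0, by omega⟩ (Real.sqrt (-r)), 0), ?_⟩
  simp [ell, Pi.single_apply, Real.sq_sqrt (neg_nonneg.2 hr), Finset.sum_ite_eq',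
    show 0 < k by omega]

lemma exists_metric_eq {a : SemiEuclidean m s} (ha : metric a a ≠ 0) (r : ℝ) :
    ∃ z, metric a z = r := by
  refine ⟨(r / metric a a) • a, ?_⟩
  have := (isQuadratic_metric a).expand 0 a (r / metric a a)
  have h0 : metric a 0 = 0 := by simp [metric]
  rw [zero_add, h0] at this
  rw [this]; field_simp; ring

lemma exists_parabolic_eq (h : s ≤ m - s) (ε : Fin s → ℝ) {ω : ℕ} (h1 : 1 ≤ ω)
    (hω : ω ≤ m - 2 * s) (r : ℝ) : ∃ z : SemiEuclidean m s, parabolic h ε ω z = r := by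
  refine ⟨(0, Pi.single ⟨s, by omega⟩ (r / 2)), ?_⟩
  have hne : ∀ i : Fin s, Fin.castLE h i ≠ ⟨s, by omega⟩ := fun i he => by
    have := congrArg Fin.val he
    simp only [Fin.val_castLE] at this
    omega
  simp [parabolic, Pi.single_apply, hne, show 0 < ω by omega]
  ring

lemma fderiv_ell_eq_zero_iff (k n : ℕ) (z : SemiEuclidean m s) :
    fderiv ℝ (ell k n) z = 0 ↔ z ∈ focal k n := by
  constructor
  · intro h0
    refine ⟨fun i hi => ?_, fun j hj => ?_⟩
    · have h1 := (isQuadratic_ell k n).fderiv_apply z (Pi.single i 1, 0)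
      rw [h0] at h1
      simpa [Pi.single_apply, Finset.sum_ite_eq', hi] using h1
    · have h1 := (isQuadratic_ell k n).fderiv_apply z (0, Pi.single j 1)
      rw [h0] at h1
      simpa [Pi.single_apply, Finset.sum_ite_eq', hj] using h1
  · intro hz
    refine ContinuousLinearMap.ext fun y => ?_
    rw [(isQuadratic_ell k n).fderiv_apply, zero_apply,
      Finset.sum_eq_zero, Finset.sum_eq_zero]
    · simp
    · intro j hj
      simp [hz.2 j (Finset.mem_filter.1 hj).2]
    · intro i hi
      simp [hz.1 i (Finset.mem_filter.1 hi).2]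

lemma ell_eq_zero_of_mem_focal {k n : ℕ} {z : SemiEuclidean m s} (hz : z ∈ focal k n) :
    ell k n z = 0 := by
  rw [ell, Finset.sum_eq_zero, Finset.sum_eq_zero]
  · simp
  · intro j hj
    simp [hz.2 j (Finset.mem_filter.1 hj).2]
  · intro i hi
    simp [hz.1 i (Finset.mem_filter.1 hi).2]

lemma ell_add_of_mem_focal {k n : ℕ} {z : SemiEuclidean m s} (hz : z ∈ focal k n)
    (y : SemiEuclidean m s) (t : ℝ) : ell k n (z + t • y) = t ^ 2 * ell k n y := by
  rw [(isQuadratic_ell k n).expand, ell_eq_zero_of_mem_focal hz,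
    ← (isQuadratic_ell k n).fderiv_apply, (fderiv_ell_eq_zero_iff k n z).2 hz]
  simp

lemma ell_zero_nonneg (n : ℕ) (z : SemiEuclidean m s) : 0 ≤ ell 0 n z := by
  simp only [ell, not_lt_zero, Finset.filter_false, Finset.sum_empty, neg_zero, zero_add]
  positivity

lemma ell_zero_nonpos (k : ℕ) (z : SemiEuclidean m s) : ell k 0 z ≤ 0 := by
  simp only [ell, not_lt_zero, Finset.filter_false, Finset.sum_empty, add_zero]
  exact neg_nonpos.2 (by positivity)

lemma fderiv_metric_ne_zero {a : SemiEuclidean m s} (ha : metric a a ≠ 0)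
    (z : SemiEuclidean m s) : fderiv ℝ (metric a) z ≠ 0 := fun h0 => ha <| by
  rw [← (isQuadratic_metric a).fderiv_apply z a, h0, zero_apply]

lemma fderiv_parabolic_ne_zero (h : s ≤ m - s) (ε : Fin s → ℝ) {ω : ℕ} (h1 : 1 ≤ ω)
    (hω : ω ≤ m - 2 * s) (z : SemiEuclidean m s) : fderiv ℝ (parabolic h ε ω) z ≠ 0 := fun h0 => by
  have hne : ∀ i : Fin s, Fin.castLE h i ≠ ⟨s, by omega⟩ := fun i he => by
    have := congrArg Fin.val he
    simp only [Fin.val_castLE] at this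
    omega
  have h2 := (isQuadratic_parabolic h ε ω).fderiv_apply z (0, Pi.single ⟨s, by omega⟩ 1)
  rw [h0] at h2
  simp [Pi.single_apply, hne, show 0 < ω by omega] at h2

end SemiEuclidean

/-! ### Solutions `V(μ ℓ_{k,n})` -/

lemma tendsto_mul_nhdsGT_of_pos {μ R : ℝ} (hμ : 0 < μ) :
    Tendsto (fun r => μ * r) (𝓝[>] (-(R / μ))) (𝓝[>] (-R)) := by
  have h0 : μ * -(R / μ) = -R := by field_simp
  refine tendsto_nhdsWithin_iff.2 ⟨?_, ?_⟩
  · rw [← h0]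
    exact ((continuous_const_mul μ).tendsto _).mono_left nhdsWithin_le_nhds
  · filter_upwards [self_mem_nhdsWithin] with r hr
    rw [mem_Ioi, ← h0]
    exact mul_lt_mul_of_pos_left hr hμ

lemma tendsto_mul_nhdsGT_of_neg {μ R : ℝ} (hμ : μ < 0) :
    Tendsto (fun r => μ * r) (𝓝[<] (R / -μ)) (𝓝[>] (-R)) := by
  have h0 : μ * (R / -μ) = -R := by have := hμ.ne; field_simp
  refine tendsto_nhdsWithin_iff.2 ⟨?_, ?_⟩
  · rw [← h0]
    exact ((continuous_const_mul μ).tendsto _).mono_left nhdsWithin_le_nhds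
  · filter_upwards [self_mem_nhdsWithin] with r hr
    rw [mem_Ioi, ← h0]
    exact mul_lt_mul_of_neg_left hr hμ

lemma neg_lt_mul_iff_of_pos {μ R r : ℝ} (hμ : 0 < μ) : -(R / μ) < r ↔ -R < μ * r := by
  rw [← neg_div, div_lt_iff₀ hμ, mul_comm]

lemma lt_iff_neg_lt_mul_of_neg {μ R r : ℝ} (hμ : μ < 0) : r < R / -μ ↔ -R < μ * r := by
  rw [lt_div_iff₀ (neg_pos.2 hμ)]
  constructor <;> intro h <;> linarith

namespace IsMaximalProfile

open SemiEuclidean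

variable {d : ℕ} {p R : ℝ} {V : ℝ → ℝ} {m s k n : ℕ} {μ : ℝ} {Ω : Set (SemiEuclidean m s)}

lemma contDiffAt_mul (h : IsMaximalProfile d p R V) {r : ℝ} (hr : -R < μ * r) :
    ContDiffAt ℝ 2 (fun r => V (μ * r)) r :=
  (h.contDiffAt _ hr).comp r (contDiffAt_const.mul contDiffAt_id)

lemma pos_of_nonpos (h : IsMaximalProfile d p R V) {r : ℝ} (hr : -R < r) (h0 : r ≤ 0) : 0 < V r :=
  zero_lt_one.trans_le (h.one_le r hr h0)

/-- In `4 r v'' + 2(k+n) v'` with `v(r) = V(μ r)` one factor `μ` is absorbed into the argument, so a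
single `μ` multiplies the profile equation; this works for either sign of `μ`. -/
lemma isSolutionOn_ell (h : IsMaximalProfile d p R V) (hd : k + n = d + 1) (hk : k ≤ s)
    (hn : n ≤ m - s) (hΩo : IsOpen Ω) (hΩ : ∀ z ∈ Ω, -R < μ * ell k n z) :
    IsSolutionOn p μ Ω ((fun r => V (μ * r)) ∘ ell k n) where
  isOpen := hΩo
  contDiffOn z hz := ((h.contDiffAt_mul (hΩ z hz)).comp z
    (isQuadratic_ell k n).contDiff.contDiffAt).contDiffWithinAt
  equation z hz := by
    have hr := hΩ z hz
    rw [box_comp_ell hk hn (h.contDiffAt_mul hr)]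
    have h1 : deriv (fun r => V (μ * r)) = fun r => μ * deriv V (μ * r) := by
      ext r; rw [deriv_comp_mul_left, smul_eq_mul]
    have h2 : deriv (fun r => μ * deriv V (μ * r)) (ell k n z)
        = μ * (μ * deriv (deriv V) (μ * ell k n z)) := by
      rw [deriv_const_mul_field, deriv_comp_mul_left, smul_eq_mul]
    rw [h1, h2]
    have h3 := h.eqn _ hr
    have h4 : ((k : ℝ) + n) = d + 1 := by exact_mod_cast hd
    rw [h4]
    simp only [Function.comp, oddPow] at h3 ⊢
    linear_combination -μ * h3

lemma continuousOn_ell (h : IsMaximalProfile d p R V) (hΩ : ∀ z ∈ Ω, -R < μ * ell k n z) :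
    ContinuousOn ((fun r => V (μ * r)) ∘ ell k n) Ω := fun z hz =>
  ((h.contDiffAt_mul (hΩ z hz)).comp z
    (isQuadratic_ell k n).contDiff.contDiffAt).continuousAt.continuousWithinAt

lemma isOscillating_ell (h : IsMaximalProfile d p R V) (hp : 1 < p)
    (hsub : ((d : ℝ) - 1) * (p - 1) < 4) (hk : k ≤ s) (hn : n ≤ m - s)
    (hsign : 1 ≤ n ∧ 0 < μ ∨ 1 ≤ k ∧ μ < 0)
    (hΩ : ∀ z : SemiEuclidean m s, z ∈ Ω ↔ -R < μ * ell k n z) :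
    IsOscillating Ω ((fun r => V (μ * r)) ∘ ell k n) := by
  obtain ⟨hpos, hneg⟩ := h.frequently_sign hp hsub
  refine isOscillating_comp (ψ := fun z => μ * ell k n z) (V := V)
    (continuous_const.mul (isQuadratic_ell k n).contDiff.continuous)
    (h.continuousOn_ell fun z hz => (hΩ z).1 hz) (fun z _ => rfl) hpos hneg fun r hr => ?_
  have hμ : μ ≠ 0 := by rcases hsign with h | h; exacts [h.2.ne', h.2.ne]
  obtain ⟨z, hz⟩ : ∃ z : SemiEuclidean m s, ell k n z = r / μ := by
    rcases hsign with ⟨h1, h2⟩ | ⟨h1, h2⟩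
    · exact exists_ell_eq_of_nonneg h1 hn (div_nonneg hr h2.le)
    · exact exists_ell_eq_of_nonpos h1 hk (div_nonpos_of_nonneg_of_nonpos hr h2.le)
  have hz' : μ * ell k n z = r := by rw [hz]; field_simp
  exact ⟨z, (hΩ z).2 (by rw [hz']; linarith [h.pos]), hz'⟩

lemma criticalSet_ell (h : IsMaximalProfile d p R V) (hμ : μ ≠ 0)
    (hΩ : ∀ z : SemiEuclidean m s, z ∈ Ω ↔ -R < μ * ell k n z)
    (hneg : ∀ z ∈ Ω, deriv V (μ * ell k n z) < 0) :
    criticalSet Ω ((fun r => V (μ * r)) ∘ ell k n) = focal k n := by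
  ext z
  have key : ∀ z ∈ Ω, fderiv ℝ ((fun r => V (μ * r)) ∘ ell k n) z = 0 ↔ z ∈ focal k n :=
    fun z hz => by
      rw [(isQuadratic_ell k n).fderiv_comp
        ((h.contDiffAt_mul ((hΩ z).1 hz)).differentiableAt (by norm_num)), smul_eq_zero,
        fderiv_ell_eq_zero_iff, deriv_comp_mul_left]
      simp [hμ, (hneg z hz).ne]
  refine ⟨fun hz => (key z hz.1).1 hz.2, fun hz => ?_⟩
  have hzΩ : z ∈ Ω := by
    rw [hΩ, ell_eq_zero_of_mem_focal hz, mul_zero]; linarith [h.pos]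
  exact ⟨hzΩ, (key z hzΩ).2 hz⟩

lemma vanishesAs_ell_atTop (h : IsMaximalProfile d p R V) (hp : 1 < p) (hd : 1 ≤ d)
    (hμ : 0 < μ) :
    VanishesAs (m := m) (s := s) (ell k n) atTop ((fun r => V (μ * r)) ∘ ell k n) := by
  have h1 := (h.tendsto_zero hp hd).abs
  rw [abs_zero] at h1
  exact (h1.comp (tendsto_id.const_mul_atTop hμ)).comp tendsto_comap

lemma vanishesAs_ell_atBot (h : IsMaximalProfile d p R V) (hp : 1 < p) (hd : 1 ≤ d)
    (hμ : μ < 0) :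
    VanishesAs (m := m) (s := s) (ell k n) atBot ((fun r => V (μ * r)) ∘ ell k n) := by
  have h1 := (h.tendsto_zero hp hd).abs
  rw [abs_zero] at h1
  exact (h1.comp (tendsto_id.const_mul_atBot_of_neg hμ)).comp tendsto_comap

lemma blowsUpAs_ell_of_pos (h : IsMaximalProfile d p R V) (hμ : 0 < μ) :
    BlowsUpAs (m := m) (s := s) (ell k n) (𝓝[>] (-(R / μ))) ((fun r => V (μ * r)) ∘ ell k n) :=
  ((tendsto_abs_atTop_atTop.comp h.tendsto).comp (tendsto_mul_nhdsGT_of_pos hμ)).comp tendsto_comap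

lemma blowsUpAs_ell_of_neg (h : IsMaximalProfile d p R V) (hμ : μ < 0) :
    BlowsUpAs (m := m) (s := s) (ell k n) (𝓝[<] (R / -μ)) ((fun r => V (μ * r)) ∘ ell k n) :=
  ((tendsto_abs_atTop_atTop.comp h.tendsto).comp (tendsto_mul_nhdsGT_of_neg hμ)).comp tendsto_comap

lemma isBoundedSolution_ell (h : IsMaximalProfile d p R V) (hd : k + n = d + 1) (hk : k ≤ s)
    (hn : n ≤ m - s) (hnn : ∀ z : SemiEuclidean m s, 0 ≤ μ * ell k n z) :
    IsBoundedSolution (m := m) (s := s) p μ ((fun r => V (μ * r)) ∘ ell k n) where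
  isSolutionOn := h.isSolutionOn_ell hd hk hn isOpen_univ fun z _ => by linarith [hnn z, h.pos]
  bounded := ⟨1, fun z => h.abs_le_one _ (hnn z)⟩

lemma isPositiveWithMaxAt_ell (h : IsMaximalProfile d p R V) (hp : 1 < p)
    (hsup : 4 ≤ ((d : ℝ) - 1) * (p - 1)) (hμ : μ ≠ 0)
    (hnn : ∀ z : SemiEuclidean m s, 0 ≤ μ * ell k n z) :
    IsPositiveWithMaxAt (m := m) (s := s) univ (focal k n) ((fun r => V (μ * r)) ∘ ell k n) := by
  have hR := h.pos
  refine ⟨fun z _ => h.pos_of_supercritical hp hsup (hnn z), h.criticalSet_ell hμ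
    (fun z => ⟨fun _ => by linarith [hnn z], fun _ => mem_univ z⟩)
    (fun z _ => h.deriv_neg_of_supercritical hp hsup (by linarith [hnn z])),
    fun z hz y _ => ?_⟩
  simp only [mem_ofPred_eq, Function.comp, ell_eq_zero_of_mem_focal hz, mul_zero, h.apply_zero]
  exact (le_abs_self _).trans (h.abs_le_one _ (hnn y))

lemma isPositiveWithMinAt_ell (h : IsMaximalProfile d p R V) (hμ : μ ≠ 0)
    (hΩ : ∀ z : SemiEuclidean m s, z ∈ Ω ↔ -R < μ * ell k n z)
    (hnp : ∀ z : SemiEuclidean m s, μ * ell k n z ≤ 0) :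
    IsPositiveWithMinAt Ω (focal k n) ((fun r => V (μ * r)) ∘ ell k n) := by
  refine ⟨fun z hz => h.pos_of_nonpos ((hΩ z).1 hz) (hnp z), h.criticalSet_ell hμ hΩ
    (fun z hz => h.deriv_neg_of_nonpos _ ((hΩ z).1 hz) (hnp z)), fun z hz y hy => ?_⟩
  simp only [mem_ofPred_eq, Function.comp, ell_eq_zero_of_mem_focal hz, mul_zero, h.apply_zero]
  exact h.one_le _ ((hΩ y).1 hy) (hnp y)

lemma strictAntiOn_of_supercritical (h : IsMaximalProfile d p R V) (hp : 1 < p)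
    (hsup : 4 ≤ ((d : ℝ) - 1) * (p - 1)) : StrictAntiOn V (Ioi (-R)) :=
  strictAntiOn_of_deriv_neg (convex_Ioi _)
    (fun r hr => (h.contDiffAt r hr).continuousAt.continuousWithinAt) fun r hr => by
      rw [interior_Ioi] at hr
      exact h.deriv_neg_of_supercritical hp hsup hr

/-- From a focal point `z`, `μ ℓ` equals `t²` along one line and `-t²` along another, and `V` is
strictly decreasing across `0`, so `u` takes smaller and larger values arbitrarily close to `z`. -/
lemma isPositiveWithSaddleAt_ell (h : IsMaximalProfile d p R V) (hp : 1 < p)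
    (hsup : 4 ≤ ((d : ℝ) - 1) * (p - 1)) (hμ : μ ≠ 0) (hk : 1 ≤ k) (hks : k ≤ s) (hn : 1 ≤ n)
    (hns : n ≤ m - s) (hΩ : ∀ z : SemiEuclidean m s, z ∈ Ω ↔ -R < μ * ell k n z) :
    IsPositiveWithSaddleAt Ω (focal k n) ((fun r => V (μ * r)) ∘ ell k n) := by
  refine ⟨fun z hz => ?_, h.criticalSet_ell hμ hΩ
    (fun z hz => h.deriv_neg_of_supercritical hp hsup ((hΩ z).1 hz)), fun z hz => ?_⟩
  · rcases le_total 0 (μ * ell k n z) with h0 | h0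
    · exact h.pos_of_supercritical hp hsup h0
    · exact h.pos_of_nonpos ((hΩ z).1 hz) h0
  · have hanti := h.strictAntiOn_of_supercritical hp hsup
    have hline : ∀ y : SemiEuclidean m s, Tendsto (fun t : ℝ => z + t • y) (𝓝[>] 0) (𝓝 z) :=
      fun y => by
        have h1 : Continuous fun t : ℝ => z + t • y := by fun_prop
        simpa using (h1.tendsto 0).mono_left (nhdsWithin_le_nhds (s := Ioi 0))
    have hΩo : ∀ᶠ y in 𝓝 z, -R < μ * ell k n y := by
      have hc : Continuous fun z : SemiEuclidean m s => μ * ell k n z :=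
        continuous_const.mul (isQuadratic_ell k n).contDiff.continuous
      refine hc.continuousAt.eventually (lt_mem_nhds ?_)
      beta_reduce
      rw [ell_eq_zero_of_mem_focal hz, mul_zero]; linarith [h.pos]
    have hmem0 : (0 : ℝ) ∈ Ioi (-R) := by simpa using h.pos
    have hsurj : ∀ c : ℝ, ∃ y : SemiEuclidean m s, μ * ell k n y = c := fun c => by
      obtain ⟨y, hy⟩ : ∃ y : SemiEuclidean m s, ell k n y = c / μ := by
        rcases le_total 0 (c / μ) with h0 | h0
        · exact exists_ell_eq_of_nonneg hn hns h0
        · exact exists_ell_eq_of_nonpos hk hks h0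
      exact ⟨y, by rw [hy]; field_simp⟩
    have hval : ∀ (y : SemiEuclidean m s) (t : ℝ),
        μ * ell k n (z + t • y) = t ^ 2 * (μ * ell k n y) := fun y t => by
      rw [ell_add_of_mem_focal hz]; ring
    rintro (hmin | hmax)
    · obtain ⟨y, hy⟩ := hsurj 1
      obtain ⟨t, ⟨h1, h2⟩, ht⟩ :=
        (((hline y).eventually (hmin.and hΩo)).and self_mem_nhdsWithin).exists
      have ht : 0 < t := ht
      simp only [Function.comp, ell_eq_zero_of_mem_focal hz, mul_zero] at h1
      rw [hval, hy] at h1 h2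
      exact absurd (hanti hmem0 h2 (by positivity)) (not_lt.2 h1)
    · obtain ⟨y, hy⟩ := hsurj (-1)
      obtain ⟨t, ⟨h1, h2⟩, ht⟩ :=
        (((hline y).eventually (hmax.and hΩo)).and self_mem_nhdsWithin).exists
      have ht : 0 < t := ht
      simp only [Function.comp, ell_eq_zero_of_mem_focal hz, mul_zero] at h1
      rw [hval, hy] at h1 h2
      exact absurd (hanti h2 hmem0 (by nlinarith)) (not_lt.2 h1)

/-! ### The case `d = 0`: hyperplanes and parabolic cylinders -/

lemma contDiffAt_sq (h : IsMaximalProfile d p R V) {κ y : ℝ} (hy : -R < κ * y ^ 2) :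
    ContDiffAt ℝ 2 (fun y => V (κ * y ^ 2)) y :=
  ContDiffAt.comp (f := fun y : ℝ => κ * y ^ 2) y (h.contDiffAt _ hy)
    (contDiffAt_const.mul (contDiffAt_id.pow 2))

lemma hasDerivAt_sq (h : IsMaximalProfile d p R V) {κ y : ℝ} (hy : -R < κ * y ^ 2) :
    HasDerivAt (fun y => V (κ * y ^ 2)) (2 * κ * y * deriv V (κ * y ^ 2)) y := by
  have hsq : HasDerivAt (fun y : ℝ => κ * y ^ 2) (κ * (2 * y)) y := by
    simpa using (hasDerivAt_pow 2 y).const_mul κ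
  exact (HasDerivAt.comp (h := fun y : ℝ => κ * y ^ 2) y
    (h.contDiffAt _ hy).hasDerivAt_deriv.1 hsq).congr_deriv (by ring)

/-- For `d = 0` the substitution `r = κ y²` removes the degeneracy: `κ (4 r V'' + 2 V')` is the full
second derivative, leaving an autonomous equation. The sign of `κ` selects the oscillating or the
blowing-up half of `V`. -/
lemma deriv_deriv_sq (h : IsMaximalProfile 0 p R V) {κ y : ℝ} (hy : -R < κ * y ^ 2) :
    deriv (deriv fun y => V (κ * y ^ 2)) y = -κ * oddPow p (V (κ * y ^ 2)) := by
  have hsq : HasDerivAt (fun y : ℝ => κ * y ^ 2) (κ * (2 * y)) y := by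
    simpa using (hasDerivAt_pow 2 y).const_mul κ
  have hev : deriv (fun y => V (κ * y ^ 2)) =ᶠ[𝓝 y] fun y => 2 * κ * y * deriv V (κ * y ^ 2) := by
    have hc : Continuous fun y : ℝ => κ * y ^ 2 := by fun_prop
    filter_upwards [hc.continuousAt.eventually (lt_mem_nhds hy)] with x hx
      using (h.hasDerivAt_sq hx).deriv
  have h2 := ((hasDerivAt_id y).const_mul (2 * κ)).mul
    (HasDerivAt.comp (h := fun y : ℝ => κ * y ^ 2) y (h.contDiffAt _ hy).hasDerivAt_deriv.2 hsq)
  have h3 : deriv (fun y => 2 * κ * y * deriv V (κ * y ^ 2)) y = _ := h2.deriv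
  rw [hev.deriv_eq, h3]
  have h4 := h.eqn _ hy
  simp only [id, Function.comp]
  push_cast at h4
  linear_combination κ * h4

variable {φ : SemiEuclidean m s → ℝ} {B : SemiEuclidean m s → SemiEuclidean m s → ℝ}
  {C : SemiEuclidean m s → ℝ} {A : ℝ}

lemma isSolutionOn_sq (h : IsMaximalProfile 0 p R V) (hφ : IsQuadratic φ B C) (hA : A ≠ 0)
    (hbox : ∀ {v : ℝ → ℝ} {z}, ContDiffAt ℝ 2 v (φ z) →
      box (v ∘ φ) z = A * deriv (deriv v) (φ z))
    (hΩo : IsOpen Ω) (hΩ : ∀ z ∈ Ω, -R < μ / A * φ z ^ 2) :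
    IsSolutionOn p μ Ω ((fun y => V (μ / A * y ^ 2)) ∘ φ) where
  isOpen := hΩo
  contDiffOn z hz := ((h.contDiffAt_sq (hΩ z hz)).comp z
    hφ.contDiff.contDiffAt).contDiffWithinAt
  equation z hz := by
    rw [hbox (h.contDiffAt_sq (hΩ z hz)), h.deriv_deriv_sq (hΩ z hz)]
    simp only [Function.comp, oddPow]
    field_simp

lemma exists_bounded_oscillating (h : IsMaximalProfile 0 p R V) (hp : 1 < p)
    (hφ : IsQuadratic φ B C) (hbox : ∀ {v : ℝ → ℝ} {z}, ContDiffAt ℝ 2 v (φ z) →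
      box (v ∘ φ) z = A * deriv (deriv v) (φ z))
    (hsurj : ∀ r, ∃ z, φ z = r) (hμA : 0 < μ * A) :
    ∃ v : ℝ → ℝ, IsBoundedSolution p μ (v ∘ φ) ∧ IsOscillating univ (v ∘ φ) := by
  have hA : A ≠ 0 := fun h0 => by simp [h0] at hμA
  have hκ : 0 < μ / A := by
    have : μ / A = μ * A / A ^ 2 := by field_simp
    rw [this]; positivity
  have hnn : ∀ y : ℝ, 0 ≤ μ / A * y ^ 2 := fun y => by positivity
  have hsol := h.isSolutionOn_sq (Ω := univ) (μ := μ) hφ hA hbox isOpen_univ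
    fun z _ => by linarith [hnn (φ z), h.pos]
  refine ⟨_, ⟨hsol, 1, fun z => h.abs_le_one _ (hnn _)⟩, ?_⟩
  -- For `d = 0` the factor `d - 1` is negative, so every `p > 1` counts as subcritical.
  obtain ⟨hpos, hneg⟩ := h.frequently_sign hp (by push_cast; linarith)
  refine isOscillating_comp (ψ := fun z => μ / A * φ z ^ 2) (V := V)
    (continuous_const.mul (hφ.contDiff.continuous.pow 2)) hsol.contDiffOn.continuousOn
    (fun z _ => rfl) hpos hneg fun r hr => ?_
  obtain ⟨z, hz⟩ := hsurj (Real.sqrt (r / (μ / A)))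
  refine ⟨z, mem_univ z, ?_⟩
  rw [hz, Real.sq_sqrt (by positivity), mul_div_cancel₀ _ hκ.ne']

lemma exists_blowup (h : IsMaximalProfile 0 p R V) (hφ : IsQuadratic φ B C)
    (hbox : ∀ {v : ℝ → ℝ} {z}, ContDiffAt ℝ 2 v (φ z) →
      box (v ∘ φ) z = A * deriv (deriv v) (φ z))
    (hreg : ∀ z, fderiv ℝ φ z ≠ 0) (hμA : μ * A < 0) :
    ∃ R > (0 : ℝ), ∃ v : ℝ → ℝ,
      IsSolutionOn p μ {z | |φ z| < R} (v ∘ φ) ∧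
      IsPositiveWithMinAt {z | |φ z| < R} {z | φ z = 0} (v ∘ φ) ∧
      BlowsUpAs φ (𝓝[<] R) (v ∘ φ) ∧ BlowsUpAs φ (𝓝[>] (-R)) (v ∘ φ) := by
  have hA : A ≠ 0 := fun h0 => by simp [h0] at hμA
  have hκ : μ / A < 0 := by
    have : μ / A = μ * A / A ^ 2 := by field_simp
    rw [this]; exact div_neg_of_neg_of_pos hμA (by positivity)
  have hR := h.pos
  have hκ' : 0 < -(μ / A) := neg_pos.2 hκ
  set κ := μ / A with hκdef
  have hS : 0 < R / -κ := by positivity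
  have hS2 : κ * (R / -κ) = -R := by have := hκ.ne; field_simp
  -- Chosen so that `κ S² = -R`: the level `φ = ±S` corresponds to the blow-up point of `V`.
  set S := Real.sqrt (R / -κ) with hSdef
  have hSsq : S ^ 2 = R / -κ := Real.sq_sqrt hS.le
  have hS0 : 0 < S := Real.sqrt_pos.2 hS
  have hiff : ∀ y : ℝ, |y| < S ↔ -R < κ * y ^ 2 := fun y => by
    rw [← lt_iff_neg_lt_mul_of_neg hκ, ← hSsq, sq_lt_sq, abs_of_pos hS0]
  have hnp : ∀ y : ℝ, κ * y ^ 2 ≤ 0 := fun y =>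
    mul_nonpos_of_nonpos_of_nonneg hκ.le (sq_nonneg y)
  have hev : ∀ (l : Filter ℝ), Tendsto (fun y : ℝ => y ^ 2) l (𝓝[<] (R / -κ)) →
      BlowsUpAs φ l ((fun y => V (κ * y ^ 2)) ∘ φ) := fun l hl =>
    ((tendsto_abs_atTop_atTop.comp h.tendsto).comp
      ((tendsto_mul_nhdsGT_of_neg hκ).comp hl)).comp tendsto_comap
  have hcont : Continuous fun y : ℝ => y ^ 2 := continuous_pow 2
  refine ⟨S, hS0, fun y => V (κ * y ^ 2), ?_, ⟨fun z hz => ?_, ?_, fun z hz y hy => ?_⟩,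
    hev _ (tendsto_nhdsWithin_iff.2 ⟨?_, ?_⟩), hev _ (tendsto_nhdsWithin_iff.2 ⟨?_, ?_⟩)⟩
  · exact h.isSolutionOn_sq hφ hA hbox
      (isOpen_lt (continuous_abs.comp hφ.contDiff.continuous) continuous_const)
      fun z hz => (hiff _).1 hz
  · exact h.pos_of_nonpos ((hiff _).1 hz) (hnp _)
  · ext z
    have key : ∀ z, |φ z| < S → (fderiv ℝ ((fun y => V (κ * y ^ 2)) ∘ φ) z = 0 ↔ φ z = 0) :=
      fun z hz => by
        have hr := (hiff _).1 hz
        rw [hφ.fderiv_comp (h.hasDerivAt_sq hr).differentiableAt, (h.hasDerivAt_sq hr).deriv,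
          smul_eq_zero]
        simp [hreg z, hκ.ne, (h.deriv_neg_of_nonpos _ hr (hnp _)).ne]
    refine ⟨fun hz => (key z hz.1).1 hz.2, fun hz => ?_⟩
    have hz : φ z = 0 := hz
    have hzS : |φ z| < S := by rw [hz, abs_zero]; exact hS0
    exact ⟨hzS, (key z hzS).2 hz⟩
  · have hz : φ z = 0 := hz
    simp only [mem_ofPred_eq, Function.comp, hz]
    rw [zero_pow two_ne_zero, mul_zero, h.apply_zero]
    exact h.one_le _ ((hiff _).1 hy) (hnp _)
  · rw [← hSsq]
    exact (hcont.tendsto S).mono_left nhdsWithin_le_nhds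
  · filter_upwards [Ioo_mem_nhdsLT hS0] with y hy
    rw [mem_Iio, ← hSsq]
    exact pow_lt_pow_left₀ hy.2 hy.1.le two_ne_zero
  · rw [← hSsq, ← neg_sq S]
    exact (hcont.tendsto (-S)).mono_left nhdsWithin_le_nhds
  · filter_upwards [Ioo_mem_nhdsGT (neg_lt_zero.2 hS0)] with y hy
    rw [mem_Iio, ← hSsq, sq_lt_sq, abs_of_pos hS0, abs_lt]
    exact ⟨hy.1, by linarith [hy.2]⟩

end IsMaximalProfile

/-! ### The critical exponent and the assembly of the cases -/

namespace SemiEuclidean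

/-- Clearing the denominator `N - 2` gives a form that also covers `N ≤ 2`, where the left side is
nonpositive. -/
lemma IsSubcritical.mul_lt {N d : ℕ} {p : ℝ} (h : IsSubcritical N p) (hN : N = d + 1) :
    ((d : ℝ) - 1) * (p - 1) < 4 := by
  obtain ⟨hp, hsub⟩ := h
  rcases lt_or_ge 2 N with h2 | h2
  · have h3 := hsub h2
    have h4 : (2 : ℝ) < N := by exact_mod_cast h2
    rw [lt_div_iff₀ (by linarith)] at h3
    have h5 : (N : ℝ) = d + 1 := by exact_mod_cast hN
    rw [h5] at h3
    linarith
  · have h3 : (d : ℝ) ≤ 1 := by exact_mod_cast (by omega : d ≤ 1)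
    nlinarith

lemma four_le_mul_of_supercritical {N d : ℕ} {p : ℝ} (hN : N = d + 1) (h2 : 2 < N)
    (hsup : ((N : ℝ) + 2) / ((N : ℝ) - 2) ≤ p) : 4 ≤ ((d : ℝ) - 1) * (p - 1) := by
  have h4 : (2 : ℝ) < N := by exact_mod_cast h2
  rw [div_le_iff₀ (by linarith)] at hsup
  have h5 : (N : ℝ) = d + 1 := by exact_mod_cast hN
  rw [h5] at hsup
  linarith

lemma mul_ell_nonneg {m s k n : ℕ} {μ : ℝ} (h : k = 0 ∧ 0 < μ ∨ n = 0 ∧ μ < 0)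
    (z : SemiEuclidean m s) : 0 ≤ μ * ell k n z := by
  rcases h with ⟨rfl, hμ⟩ | ⟨rfl, hμ⟩
  · exact mul_nonneg hμ.le (ell_zero_nonneg n z)
  · exact mul_nonneg_of_nonpos_of_nonpos hμ.le (ell_zero_nonpos k z)

lemma exists_isBoundedSolution_isOscillating {m s k n : ℕ} {p μ : ℝ} (hp : 1 < p) (hk : k ≤ s)
    (hn : n ≤ m - s) (hsign : k = 0 ∧ 0 < μ ∨ n = 0 ∧ μ < 0) {d : ℕ} (hd : k + n = d + 1)
    (hsub : ((d : ℝ) - 1) * (p - 1) < 4) :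
    ∃ R V, IsMaximalProfile d p R V ∧
      IsBoundedSolution (m := m) (s := s) p μ ((fun r => V (μ * r)) ∘ ell k n) ∧
      IsOscillating (m := m) (s := s) univ ((fun r => V (μ * r)) ∘ ell k n) := by
  obtain ⟨R, V, hV⟩ := exists_isMaximalProfile d hp
  refine ⟨R, V, hV, hV.isBoundedSolution_ell hd hk hn (mul_ell_nonneg hsign),
    hV.isOscillating_ell hp hsub hk hn ?_ fun z =>
      ⟨fun _ => by linarith [mul_ell_nonneg hsign z, hV.pos], fun _ => mem_univ z⟩⟩
  rcases hsign with ⟨h0, hμ⟩ | ⟨h0, hμ⟩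
  · exact Or.inl ⟨by omega, hμ⟩
  · exact Or.inr ⟨by omega, hμ⟩

lemma isOpen_setOf_lt_ell {m s : ℕ} (k n : ℕ) (R : ℝ) :
    IsOpen {z : SemiEuclidean m s | R < ell k n z} :=
  isOpen_lt continuous_const (isQuadratic_ell k n).contDiff.continuous

lemma isOpen_setOf_ell_lt {m s : ℕ} (k n : ℕ) (R : ℝ) :
    IsOpen {z : SemiEuclidean m s | ell k n z < R} :=
  isOpen_lt (isQuadratic_ell k n).contDiff.continuous continuous_const

end SemiEuclidean

theorem mainTheorem1 (m s : ℕ) (hm : 3 ≤ m) (hs : 1 ≤ s) (hsm : s < m)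
    (p μ : ℝ) (hp : 1 < p) (hμ : μ ≠ 0) :
    -- (Y1), `k + n = 0`: hyperplanes
    (∀ a : SemiEuclidean m s, 0 < μ * SemiEuclidean.metric a a →
      ∃ v : ℝ → ℝ,
        SemiEuclidean.IsBoundedSolution p μ (v ∘ SemiEuclidean.metric a) ∧
        SemiEuclidean.IsOscillating univ (v ∘ SemiEuclidean.metric a)) ∧
    -- (Y1), `k + n = 0`: parabolic cylinders
    (∀ (h : s ≤ m - s) (ε : Fin s → ℝ) (ω : ℕ), (∀ i, ε i = 1 ∨ ε i = -1) →
      1 ≤ ω → ω ≤ m - 2 * s → 0 < μ →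
      ∃ v : ℝ → ℝ,
        SemiEuclidean.IsBoundedSolution p μ (v ∘ SemiEuclidean.parabolic h ε ω) ∧
        SemiEuclidean.IsOscillating univ (v ∘ SemiEuclidean.parabolic h ε ω)) ∧
    -- (Y1), `k + n = 1`
    (∀ k n : ℕ, k ≤ s → n ≤ m - s → k + n = 1 → (k = 0 ∧ 0 < μ ∨ n = 0 ∧ μ < 0) →
      ∃ v : ℝ → ℝ,
        SemiEuclidean.IsBoundedSolution (m := m) (s := s) p μ (v ∘ SemiEuclidean.ell k n) ∧
        SemiEuclidean.IsOscillating (m := m) (s := s) univ (v ∘ SemiEuclidean.ell k n)) ∧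
    -- (Y2)
    (∀ k n : ℕ, k ≤ s → n ≤ m - s → 2 ≤ k + n → (k = 0 ∧ 0 < μ ∨ n = 0 ∧ μ < 0) →
      SemiEuclidean.IsSubcritical (k + n) p →
      ∃ v : ℝ → ℝ,
        SemiEuclidean.IsBoundedSolution (m := m) (s := s) p μ (v ∘ SemiEuclidean.ell k n) ∧
        SemiEuclidean.IsOscillating (m := m) (s := s) univ (v ∘ SemiEuclidean.ell k n) ∧
        (k = 0 → SemiEuclidean.VanishesAs (m := m) (s := s) (SemiEuclidean.ell k n) atTop
          (v ∘ SemiEuclidean.ell k n)) ∧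
        (n = 0 → SemiEuclidean.VanishesAs (m := m) (s := s) (SemiEuclidean.ell k n) atBot
          (v ∘ SemiEuclidean.ell k n))) ∧
    -- (Y3)
    (∀ k n : ℕ, k ≤ s → n ≤ m - s → 2 < k + n → (k = 0 ∧ 0 < μ ∨ n = 0 ∧ μ < 0) →
      (((k + n : ℕ) : ℝ) + 2) / (((k + n : ℕ) : ℝ) - 2) ≤ p →
      ∃ v : ℝ → ℝ,
        SemiEuclidean.IsBoundedSolution (m := m) (s := s) p μ (v ∘ SemiEuclidean.ell k n) ∧
        SemiEuclidean.IsPositiveWithMaxAt (m := m) (s := s) univ (SemiEuclidean.focal k n)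
          (v ∘ SemiEuclidean.ell k n) ∧
        (k = 0 → SemiEuclidean.VanishesAs (m := m) (s := s) (SemiEuclidean.ell k n) atTop
          (v ∘ SemiEuclidean.ell k n)) ∧
        (n = 0 → SemiEuclidean.VanishesAs (m := m) (s := s) (SemiEuclidean.ell k n) atBot
          (v ∘ SemiEuclidean.ell k n))) ∧
    -- (Y4), `k = 0 < n`
    (∀ n : ℕ, 1 ≤ n → n ≤ m - s → μ < 0 →
      ∃ R > (0 : ℝ), ∃ v : ℝ → ℝ,
        SemiEuclidean.IsSolutionOn (m := m) (s := s) p μ {z | SemiEuclidean.ell 0 n z < R}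
          (v ∘ SemiEuclidean.ell 0 n) ∧
        SemiEuclidean.IsPositiveWithMinAt (m := m) (s := s) {z | SemiEuclidean.ell 0 n z < R}
          (SemiEuclidean.focal 0 n) (v ∘ SemiEuclidean.ell 0 n) ∧
        SemiEuclidean.BlowsUpAs (m := m) (s := s) (SemiEuclidean.ell 0 n) (𝓝[<] R)
          (v ∘ SemiEuclidean.ell 0 n)) ∧
    -- (Y4), `n = 0 < k`
    (∀ k : ℕ, 1 ≤ k → k ≤ s → 0 < μ →
      ∃ R > (0 : ℝ), ∃ v : ℝ → ℝ,
        SemiEuclidean.IsSolutionOn (m := m) (s := s) p μ {z | -R < SemiEuclidean.ell k 0 z}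
          (v ∘ SemiEuclidean.ell k 0) ∧
        SemiEuclidean.IsPositiveWithMinAt (m := m) (s := s) {z | -R < SemiEuclidean.ell k 0 z}
          (SemiEuclidean.focal k 0) (v ∘ SemiEuclidean.ell k 0) ∧
        SemiEuclidean.BlowsUpAs (m := m) (s := s) (SemiEuclidean.ell k 0) (𝓝[>] (-R))
          (v ∘ SemiEuclidean.ell k 0)) ∧
    -- (Y4), `k = n = 0`: hyperplanes
    (∀ a : SemiEuclidean m s, μ * SemiEuclidean.metric a a < 0 →
      ∃ R > (0 : ℝ), ∃ v : ℝ → ℝ,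
        SemiEuclidean.IsSolutionOn p μ {z | |SemiEuclidean.metric a z| < R}
          (v ∘ SemiEuclidean.metric a) ∧
        SemiEuclidean.IsPositiveWithMinAt {z | |SemiEuclidean.metric a z| < R}
          {z | SemiEuclidean.metric a z = 0} (v ∘ SemiEuclidean.metric a) ∧
        SemiEuclidean.BlowsUpAs (SemiEuclidean.metric a) (𝓝[<] R)
          (v ∘ SemiEuclidean.metric a) ∧
        SemiEuclidean.BlowsUpAs (SemiEuclidean.metric a) (𝓝[>] (-R))
          (v ∘ SemiEuclidean.metric a)) ∧
    -- (Y4), `k = n = 0`: parabolic cylinders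
    (∀ (h : s ≤ m - s) (ε : Fin s → ℝ) (ω : ℕ), (∀ i, ε i = 1 ∨ ε i = -1) →
      1 ≤ ω → ω ≤ m - 2 * s → μ < 0 →
      ∃ R > (0 : ℝ), ∃ v : ℝ → ℝ,
        SemiEuclidean.IsSolutionOn p μ {z | |SemiEuclidean.parabolic h ε ω z| < R}
          (v ∘ SemiEuclidean.parabolic h ε ω) ∧
        SemiEuclidean.IsPositiveWithMinAt {z | |SemiEuclidean.parabolic h ε ω z| < R}
          {z | SemiEuclidean.parabolic h ε ω z = 0} (v ∘ SemiEuclidean.parabolic h ε ω) ∧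
        SemiEuclidean.BlowsUpAs (SemiEuclidean.parabolic h ε ω) (𝓝[<] R)
          (v ∘ SemiEuclidean.parabolic h ε ω) ∧
        SemiEuclidean.BlowsUpAs (SemiEuclidean.parabolic h ε ω) (𝓝[>] (-R))
          (v ∘ SemiEuclidean.parabolic h ε ω)) ∧
    -- (Y5), `0 < μ`
    (∀ k n : ℕ, 1 ≤ k → k ≤ s → 1 ≤ n → n ≤ m - s → SemiEuclidean.IsSubcritical (k + n) p →
      0 < μ →
      ∃ R > (0 : ℝ), ∃ v : ℝ → ℝ,
        SemiEuclidean.IsSolutionOn (m := m) (s := s) p μ {z | -R < SemiEuclidean.ell k n z}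
          (v ∘ SemiEuclidean.ell k n) ∧
        SemiEuclidean.IsOscillating (m := m) (s := s) {z | -R < SemiEuclidean.ell k n z}
          (v ∘ SemiEuclidean.ell k n) ∧
        SemiEuclidean.VanishesAs (m := m) (s := s) (SemiEuclidean.ell k n) atTop
          (v ∘ SemiEuclidean.ell k n) ∧
        SemiEuclidean.BlowsUpAs (m := m) (s := s) (SemiEuclidean.ell k n) (𝓝[>] (-R))
          (v ∘ SemiEuclidean.ell k n)) ∧
    -- (Y5), `μ < 0`
    (∀ k n : ℕ, 1 ≤ k → k ≤ s → 1 ≤ n → n ≤ m - s → SemiEuclidean.IsSubcritical (k + n) p →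
      μ < 0 →
      ∃ R > (0 : ℝ), ∃ v : ℝ → ℝ,
        SemiEuclidean.IsSolutionOn (m := m) (s := s) p μ {z | SemiEuclidean.ell k n z < R}
          (v ∘ SemiEuclidean.ell k n) ∧
        SemiEuclidean.IsOscillating (m := m) (s := s) {z | SemiEuclidean.ell k n z < R}
          (v ∘ SemiEuclidean.ell k n) ∧
        SemiEuclidean.VanishesAs (m := m) (s := s) (SemiEuclidean.ell k n) atBot
          (v ∘ SemiEuclidean.ell k n) ∧
        SemiEuclidean.BlowsUpAs (m := m) (s := s) (SemiEuclidean.ell k n) (𝓝[<] R)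
          (v ∘ SemiEuclidean.ell k n)) ∧
    -- (Y6), `0 < μ`
    (∀ k n : ℕ, 1 ≤ k → k ≤ s → 1 ≤ n → n ≤ m - s → 2 < k + n →
      (((k + n : ℕ) : ℝ) + 2) / (((k + n : ℕ) : ℝ) - 2) ≤ p → 0 < μ →
      ∃ R > (0 : ℝ), ∃ v : ℝ → ℝ,
        SemiEuclidean.IsSolutionOn (m := m) (s := s) p μ {z | -R < SemiEuclidean.ell k n z}
          (v ∘ SemiEuclidean.ell k n) ∧
        SemiEuclidean.IsPositiveWithSaddleAt (m := m) (s := s)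
          {z | -R < SemiEuclidean.ell k n z} (SemiEuclidean.focal k n)
          (v ∘ SemiEuclidean.ell k n) ∧
        SemiEuclidean.VanishesAs (m := m) (s := s) (SemiEuclidean.ell k n) atTop
          (v ∘ SemiEuclidean.ell k n) ∧
        SemiEuclidean.BlowsUpAs (m := m) (s := s) (SemiEuclidean.ell k n) (𝓝[>] (-R))
          (v ∘ SemiEuclidean.ell k n)) ∧
    -- (Y6), `μ < 0`
    (∀ k n : ℕ, 1 ≤ k → k ≤ s → 1 ≤ n → n ≤ m - s → 2 < k + n →
      (((k + n : ℕ) : ℝ) + 2) / (((k + n : ℕ) : ℝ) - 2) ≤ p → μ < 0 →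
      ∃ R > (0 : ℝ), ∃ v : ℝ → ℝ,
        SemiEuclidean.IsSolutionOn (m := m) (s := s) p μ {z | SemiEuclidean.ell k n z < R}
          (v ∘ SemiEuclidean.ell k n) ∧
        SemiEuclidean.IsPositiveWithSaddleAt (m := m) (s := s)
          {z | SemiEuclidean.ell k n z < R} (SemiEuclidean.focal k n)
          (v ∘ SemiEuclidean.ell k n) ∧
        SemiEuclidean.VanishesAs (m := m) (s := s) (SemiEuclidean.ell k n) atBot
          (v ∘ SemiEuclidean.ell k n) ∧
        SemiEuclidean.BlowsUpAs (m := m) (s := s) (SemiEuclidean.ell k n) (𝓝[<] R)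
          (v ∘ SemiEuclidean.ell k n)) := by
  have hR : ∀ {d R V}, IsMaximalProfile d p R V → 0 < μ → 0 < R / μ := fun hV h => div_pos hV.pos h
  have hR' : ∀ {d R V}, IsMaximalProfile d p R V → μ < 0 → 0 < R / -μ := fun hV h =>
    div_pos hV.pos (neg_pos.2 h)
  refine ⟨fun a ha => ?_, fun h ε ω hε h1 hω hpos => ?_, fun k n hk hn hN hsign => ?_,
    fun k n hk hn hN hsign hsub => ?_, fun k n hk hn hN hsign hsup => ?_, fun n hn hns hneg => ?_,
    fun k hk hks hpos => ?_, fun a ha => ?_, fun h ε ω hε h1 hω hneg => ?_,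
    fun k n hk hks hn hns hsub hpos => ?_, fun k n hk hks hn hns hsub hneg => ?_,
    fun k n hk hks hn hns hN hsup hpos => ?_, fun k n hk hks hn hns hN hsup hneg => ?_⟩
  · obtain ⟨R, V, hV⟩ := exists_isMaximalProfile 0 hp
    have ha0 : SemiEuclidean.metric a a ≠ 0 := fun h0 => by simp [h0] at ha
    exact hV.exists_bounded_oscillating hp (SemiEuclidean.isQuadratic_metric a)
      (SemiEuclidean.box_comp_metric a) (SemiEuclidean.exists_metric_eq ha0) ha
  · obtain ⟨R, V, hV⟩ := exists_isMaximalProfile 0 hp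
    have hω0 : (0 : ℝ) < ω := by exact_mod_cast h1
    exact hV.exists_bounded_oscillating hp (SemiEuclidean.isQuadratic_parabolic h ε ω)
      (SemiEuclidean.box_comp_parabolic h hε hω) (SemiEuclidean.exists_parabolic_eq h ε h1 hω)
      (by positivity)
  · obtain ⟨R, V, -, hb, ho⟩ := SemiEuclidean.exists_isBoundedSolution_isOscillating hp hk hn hsign
      (d := 0) hN (by push_cast; linarith)
    exact ⟨_, hb, ho⟩
  · obtain ⟨d, hd⟩ : ∃ d, k + n = d + 1 := ⟨k + n - 1, by omega⟩
    obtain ⟨R, V, hV, hb, ho⟩ := SemiEuclidean.exists_isBoundedSolution_isOscillating hp hk hn hsign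
      hd (hsub.mul_lt hd)
    have hd1 : 1 ≤ d := by omega
    refine ⟨_, hb, ho, fun h0 => hV.vanishesAs_ell_atTop hp hd1 ?_,
      fun h0 => hV.vanishesAs_ell_atBot hp hd1 ?_⟩
    -- With `k = 0` the alternative `n = 0` is impossible because `k + n ≥ 2`, so the sign of `μ` is
    -- determined.
    · exact hsign.elim And.right fun h => absurd h.1 (by omega)
    · exact hsign.elim (fun h => absurd h.1 (by omega)) And.right
  · obtain ⟨d, hd⟩ : ∃ d, k + n = d + 1 := ⟨k + n - 1, by omega⟩
    obtain ⟨R, V, hV⟩ := exists_isMaximalProfile d hp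
    have hd1 : 1 ≤ d := by omega
    have hnn := SemiEuclidean.mul_ell_nonneg (m := m) (s := s) hsign
    refine ⟨_, hV.isBoundedSolution_ell hd hk hn hnn, hV.isPositiveWithMaxAt_ell hp
      (SemiEuclidean.four_le_mul_of_supercritical hd hN hsup) hμ hnn,
      fun h0 => hV.vanishesAs_ell_atTop hp hd1 ?_, fun h0 => hV.vanishesAs_ell_atBot hp hd1 ?_⟩
    · exact hsign.elim And.right fun h => absurd h.1 (by omega)
    · exact hsign.elim (fun h => absurd h.1 (by omega)) And.right
  · obtain ⟨d, hd⟩ : ∃ d, 0 + n = d + 1 := ⟨n - 1, by omega⟩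
    obtain ⟨R, V, hV⟩ := exists_isMaximalProfile d hp
    exact ⟨R / -μ, hR' hV hneg, _, hV.isSolutionOn_ell hd (Nat.zero_le s) hns
      (SemiEuclidean.isOpen_setOf_ell_lt 0 n _) (fun z hz => (lt_iff_neg_lt_mul_of_neg hneg).1 hz),
      hV.isPositiveWithMinAt_ell hμ (fun z => lt_iff_neg_lt_mul_of_neg hneg) (fun z =>
        mul_nonpos_of_nonpos_of_nonneg hneg.le (SemiEuclidean.ell_zero_nonneg n z)),
      hV.blowsUpAs_ell_of_neg hneg⟩
  · obtain ⟨d, hd⟩ : ∃ d, k + 0 = d + 1 := ⟨k - 1, by omega⟩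
    obtain ⟨R, V, hV⟩ := exists_isMaximalProfile d hp
    exact ⟨R / μ, hR hV hpos, _, hV.isSolutionOn_ell hd hks (Nat.zero_le _)
      (SemiEuclidean.isOpen_setOf_lt_ell k 0 _) (fun z hz => (neg_lt_mul_iff_of_pos hpos).1 hz),
      hV.isPositiveWithMinAt_ell hμ (fun z => neg_lt_mul_iff_of_pos hpos) (fun z =>
        mul_nonpos_of_nonneg_of_nonpos hpos.le (SemiEuclidean.ell_zero_nonpos k z)),
      hV.blowsUpAs_ell_of_pos hpos⟩
  · obtain ⟨R, V, hV⟩ := exists_isMaximalProfile 0 hp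
    have ha0 : SemiEuclidean.metric a a ≠ 0 := fun h0 => by simp [h0] at ha
    exact hV.exists_blowup (SemiEuclidean.isQuadratic_metric a)
      (SemiEuclidean.box_comp_metric a) (SemiEuclidean.fderiv_metric_ne_zero ha0) ha
  · obtain ⟨R, V, hV⟩ := exists_isMaximalProfile 0 hp
    have hω0 : (0 : ℝ) < ω := by exact_mod_cast h1
    exact hV.exists_blowup (SemiEuclidean.isQuadratic_parabolic h ε ω)
      (SemiEuclidean.box_comp_parabolic h hε hω) (SemiEuclidean.fderiv_parabolic_ne_zero h ε h1 hω)
      (mul_neg_of_neg_of_pos hneg (by positivity))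
  · obtain ⟨d, hd⟩ : ∃ d, k + n = d + 1 := ⟨k + n - 1, by omega⟩
    obtain ⟨R, V, hV⟩ := exists_isMaximalProfile d hp
    exact ⟨R / μ, hR hV hpos, _, hV.isSolutionOn_ell hd hks hns
      (SemiEuclidean.isOpen_setOf_lt_ell k n _) (fun z hz => (neg_lt_mul_iff_of_pos hpos).1 hz),
      hV.isOscillating_ell hp (hsub.mul_lt hd) hks hns (Or.inl ⟨hn, hpos⟩)
        (fun z => neg_lt_mul_iff_of_pos hpos),
      hV.vanishesAs_ell_atTop hp (by omega) hpos, hV.blowsUpAs_ell_of_pos hpos⟩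
  · obtain ⟨d, hd⟩ : ∃ d, k + n = d + 1 := ⟨k + n - 1, by omega⟩
    obtain ⟨R, V, hV⟩ := exists_isMaximalProfile d hp
    exact ⟨R / -μ, hR' hV hneg, _, hV.isSolutionOn_ell hd hks hns
      (SemiEuclidean.isOpen_setOf_ell_lt k n _) (fun z hz => (lt_iff_neg_lt_mul_of_neg hneg).1 hz),
      hV.isOscillating_ell hp (hsub.mul_lt hd) hks hns (Or.inr ⟨hk, hneg⟩)
        (fun z => lt_iff_neg_lt_mul_of_neg hneg),
      hV.vanishesAs_ell_atBot hp (by omega) hneg, hV.blowsUpAs_ell_of_neg hneg⟩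
  · obtain ⟨d, hd⟩ : ∃ d, k + n = d + 1 := ⟨k + n - 1, by omega⟩
    obtain ⟨R, V, hV⟩ := exists_isMaximalProfile d hp
    exact ⟨R / μ, hR hV hpos, _, hV.isSolutionOn_ell hd hks hns
      (SemiEuclidean.isOpen_setOf_lt_ell k n _) (fun z hz => (neg_lt_mul_iff_of_pos hpos).1 hz),
      hV.isPositiveWithSaddleAt_ell hp (SemiEuclidean.four_le_mul_of_supercritical hd hN hsup) hμ
        hk hks hn hns (fun z => neg_lt_mul_iff_of_pos hpos),
      hV.vanishesAs_ell_atTop hp (by omega) hpos, hV.blowsUpAs_ell_of_pos hpos⟩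
  · obtain ⟨d, hd⟩ : ∃ d, k + n = d + 1 := ⟨k + n - 1, by omega⟩
    obtain ⟨R, V, hV⟩ := exists_isMaximalProfile d hp
    exact ⟨R / -μ, hR' hV hneg, _, hV.isSolutionOn_ell hd hks hns
      (SemiEuclidean.isOpen_setOf_ell_lt k n _) (fun z hz => (lt_iff_neg_lt_mul_of_neg hneg).1 hz),
      hV.isPositiveWithSaddleAt_ell hp (SemiEuclidean.four_le_mul_of_supercritical hd hN hsup) hμ
        hk hks hn hns (fun z => lt_iff_neg_lt_mul_of_neg hneg),
      hV.vanishesAs_ell_atBot hp (by omega) hneg, hV.blowsUpAs_ell_of_neg hneg⟩
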